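/- Let $\mathcal G$ be a connected noncompact metric graph with finitely many edges: a multigraph (self-loops and multiple edges allowed) in which each bounded edge $e$ is identified with an interval $I_e=[0,\ell_e]$, $0<\ell_e<\infty$, and each unbounded edge with a half-line $I_e=[0,\infty)$ attached at $0$ to a vertex. Assume that its compact core $\mathcal K$, the subgraph of the bounded edges, contains at least one edge. Let $H^1(\mathcal G)$ be the space of the continuous functions $u=(u_e):\mathcal G\to\mathbb R$ with $u_e\in H^1(I_e)$ for every edge $e$. For $\mu>0$ let $H^1_\mu(\mathcal G)=\{u\in H^1(\mathcal G):\|u\|_{L^2(\mathcal G)}^2=\mu\}$ and $$E(u,\mathcal K)=\frac12\int_{\mathcal G}|u'|^2\,dx-\frac16\int_{\mathcal K}|u|^6\,dx,\qquad \mathcal E_{\mathcal G}(\mu,\mathcal K)=\inf_{u\in H^1_\mu(\mathcal G)}E(u,\mathcal K)\in[-\infty,\infty).$$ A ground state of mass $\mu$ is a function $u\in H^1_\mu(\mathcal G)$ with $E(u,\mathcal K)=\mathcal E_{\mathcal G}(\mu,\mathcal K)$. Set $\mu_{\mathbb R}=\frac{\sqrt3\,\pi}{2}$, $\mu_{\mathbb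 R^+}=\frac{\sqrt3\,\pi}{4}$ and $$C_{\mathcal K}=\sup_{0\not\equiv u\in H^1(\mathcal G)}\frac{\|u\|_{L^6(\mathcal K)}^6}{\|u\|_{L^2(\mathcal G)}^4\,\|u'\|_{L^2(\mathcal G)}^2},\qquad \mu_{\mathcal K}=\sqrt{\frac{3}{C_{\mathcal K}}}.$$ A terminal edge is an edge ending with a vertex of degree $1$. The graph admits a cycle covering if each edge belongs to a cycle, where a cycle is either a closed path of consecutive, pairwise distinct bounded edges, or an unbounded path formed by two distinct half-lines and a (possibly empty) path of pairwise distinct bounded edges joining the vertices at which they start. Then $C_{\mathcal K}<\infty$, $\mu_{\mathcal K}\in[\mu_{\mathbb R^+},\mu_{\mathbb R}]$, and for every $\mu>0$ $$\mathcal E_{\mathcal G}(\mu,\mathcal K)\begin{cases}=0&\text{if }\mu\le\mu_{\mathcal K},\\<0&\text{if }\mu\in(\mu_{\mathcal K},\mu_{\mathbb R}],\\=-\infty&\text{if }\mu>\mu_{\mathbb R}.\end{cases}$$ Moreover: (i) if $\mathcal G$ has at least one terminal edge, then $\mu_{\mathcal K}=\mu_{\mathbb R^+}$, $\mathcal E_{\mathcal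 G}(\mu,\mathcal K)=-\infty$ for all $\mu>\mu_{\mathcal K}$, and there is no ground state of any mass $\mu>0$; (ii) if $\mathcal G$ admits a cycle covering, then $\mu_{\mathcal K}=\mu_{\mathbb R}$ and there is no ground state of any mass $\mu>0$; (iii) if $\mathcal G$ has exactly one half-line and no terminal edge, then $\mu_{\mathbb R^+}<\mu_{\mathcal K}<\sqrt3$, and a ground state of mass $\mu>0$ exists if and only if $\mu\in[\mu_{\mathcal K},\mu_{\mathbb R}]$; (iv) if $\mathcal G$ has neither a terminal edge nor a cycle covering, and at least two half-lines, then $\mu_{\mathbb R^+}<\mu_{\mathcal K}\le\mu_{\mathbb R}$, and, provided that $\mu_{\mathcal K}\ne\mu_{\mathbb R}$, a ground state of mass $\mu>0$ exists if and only if $\mu\in[\mu_{\mathcal K},\mu_{\mathbb R}]$. -/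

import Mathlib

open MeasureTheory

/-- A metric graph: a multigraph with vertex set `V`, set of bounded edges `B` and set of half-lines
`H`. The bounded edge `b` is the interval `[0, len b]`, glued at `0` to the vertex `src b` and at
`len b` to the vertex `tgt b` (self-loops and multiple edges are allowed); the half-line `h` is
`[0, ∞)`, glued at `0` to the vertex `root h`. -/
structure MetricGraph (V B H : Type*) where
  src : B → V
  tgt : B → V
  len : B → ℝ
  len_pos : ∀ b, 0 < len b
  root : H → V

namespace MetricGraph

variable {V B H : Type*}

/-! ### Topology of the graph -/

/-- `G.Walk v w l`: starting at `v` and traversing consecutively the bounded edges of the list `l`,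
each in one of its two directions, one can arrive at `w`. -/
inductive Walk (G : MetricGraph V B H) : V → V → List B → Prop
  | nil (v : V) : Walk G v v []
  | forward (b : B) {w : V} {l : List B} : Walk G (G.tgt b) w l → Walk G (G.src b) w (b :: l)
  | backward (b : B) {w : V} {l : List B} : Walk G (G.src b) w l → Walk G (G.tgt b) w (b :: l)

/-- Connectedness. Half-lines have only one vertex, so only bounded edges join vertices. -/
def Connected (G : MetricGraph V B H) : Prop :=
  Nonempty V ∧ ∀ v w : V, ∃ l : List B, G.Walk v w l

/-- Degree of a vertex; a self-loop is counted twice. -/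
noncomputable def degree (G : MetricGraph V B H) (v : V) : ℕ :=
  Nat.card {b : B // G.src b = v} + Nat.card {b : B // G.tgt b = v} +
    Nat.card {h : H // G.root h = v}

/-- Incidence of an edge (bounded, or a half-line) at a vertex. -/
def Incident (G : MetricGraph V B H) : B ⊕ H → V → Prop
  | Sum.inl b, v => G.src b = v ∨ G.tgt b = v
  | Sum.inr h, v => G.root h = v

/-- There is an edge ending with a vertex of degree one. -/
def HasTerminalEdge (G : MetricGraph V B H) : Prop :=
  ∃ (e : B ⊕ H) (v : V), G.Incident e v ∧ G.degree v = 1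

/-- The edge `e` belongs to a closed path of consecutive (pairwise distinct) bounded edges. -/
def OnBoundedCycle (G : MetricGraph V B H) (e : B ⊕ H) : Prop :=
  ∃ (v : V) (l : List B), G.Walk v v l ∧ l.Nodup ∧ ∃ b ∈ l, e = Sum.inl b

/-- The edge `e` belongs to an unbounded path, made of two distinct half-lines `h₁`, `h₂` and a path
of (pairwise distinct, possibly no) bounded edges from the vertex of `h₁` to the vertex of `h₂`. -/
def OnUnboundedCycle (G : MetricGraph V B H) (e : B ⊕ H) : Prop :=
  ∃ (h₁ h₂ : H) (l : List B), h₁ ≠ h₂ ∧ G.Walk (G.root h₁) (G.root h₂) l ∧ l.Nodup ∧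
    (e = Sum.inr h₁ ∨ e = Sum.inr h₂ ∨ ∃ b ∈ l, e = Sum.inl b)

/-- Every edge of the graph belongs to a cycle. -/
def HasCycleCovering (G : MetricGraph V B H) : Prop :=
  ∀ e : B ⊕ H, G.OnBoundedCycle e ∨ G.OnUnboundedCycle e

/-! ### Function spaces and the energy

A function on the graph is a family `u : B ⊕ H → ℝ → ℝ`; only the restriction of `u e` to the
interval `G.interval e` matters. -/

/-- The interval `I_e` parametrizing the edge `e`. -/
def interval (G : MetricGraph V B H) : B ⊕ H → Set ℝ
  | Sum.inl b => Set.Icc 0 (G.len b)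
  | Sum.inr _ => Set.Ici 0

/-- The values on the edges agree at the vertices. -/
def AgreesAtVertices (G : MetricGraph V B H) (u : B ⊕ H → ℝ → ℝ) : Prop :=
  ∃ w : V → ℝ, (∀ b, u (Sum.inl b) 0 = w (G.src b) ∧ u (Sum.inl b) (G.len b) = w (G.tgt b)) ∧
    ∀ h, u (Sum.inr h) 0 = w (G.root h)

/-- The Sobolev space `H¹(I)` for an interval `I` with minimum `0`, through continuous
representatives: the (locally) absolutely continuous functions in `L²(I)` whose derivative, which
exists almost everywhere, is in `L²(I)`. -/
def MemH1On (I : Set ℝ) (f : ℝ → ℝ) : Prop :=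
  (∀ x ∈ I, AbsolutelyContinuousOnInterval f 0 x) ∧
    MemLp f 2 (volume.restrict I) ∧ MemLp (deriv f) 2 (volume.restrict I)

/-- The space `H¹(G)` of the functions that are `H¹` on each edge and continuous on the graph. -/
def H1 (G : MetricGraph V B H) : Set (B ⊕ H → ℝ → ℝ) :=
  {u | (∀ e, MemH1On (G.interval e) (u e)) ∧ G.AgreesAtVertices u}

variable [Fintype B] [Fintype H]

/-- The mass `‖u‖²` in `L²(G)`. -/
noncomputable def mass (G : MetricGraph V B H) (u : B ⊕ H → ℝ → ℝ) : ℝ :=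
  ∑ e, ∫ x in G.interval e, |u e x| ^ 2

/-- The squared norm `‖u'‖²` in `L²(G)`. -/
noncomputable def kinetic (G : MetricGraph V B H) (u : B ⊕ H → ℝ → ℝ) : ℝ :=
  ∑ e, ∫ x in G.interval e, |deriv (u e) x| ^ 2

/-- The sixth power of the norm of `u` in `L⁶(K)`, where the compact core `K` is the subgraph of the
bounded edges. -/
noncomputable def coreSextic (G : MetricGraph V B H) (u : B ⊕ H → ℝ → ℝ) : ℝ :=
  ∑ b : B, ∫ x in G.interval (Sum.inl b), |u (Sum.inl b) x| ^ 6

/-- The energy with nonlinearity localized on the compact core. -/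
noncomputable def energy (G : MetricGraph V B H) (u : B ⊕ H → ℝ → ℝ) : ℝ :=
  1 / 2 * G.kinetic u - 1 / 6 * G.coreSextic u

/-- The functions in `H¹(G)` of mass `μ`. -/
def H1mass (G : MetricGraph V B H) (μ : ℝ) : Set (B ⊕ H → ℝ → ℝ) :=
  {u | u ∈ G.H1 ∧ G.mass u = μ}

/-- The infimum of the energy at mass `μ`, as an extended real number. -/
noncomputable def infEnergy (G : MetricGraph V B H) (μ : ℝ) : EReal :=
  ⨅ u ∈ G.H1mass μ, (G.energy u : EReal)

/-- `u` is a ground state of mass `μ`: the infimum of the energy is attained at `u`. -/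
def IsGroundState (G : MetricGraph V B H) (μ : ℝ) (u : B ⊕ H → ℝ → ℝ) : Prop :=
  u ∈ G.H1mass μ ∧ (G.energy u : EReal) = G.infEnergy μ

/-! ### The Gagliardo-Nirenberg quotient and the reduced critical mass -/

/-- The Gagliardo-Nirenberg quotient `Q(u)`. -/
noncomputable def quotient (G : MetricGraph V B H) (u : B ⊕ H → ℝ → ℝ) : ℝ :=
  G.coreSextic u / (G.mass u ^ 2 * G.kinetic u)

/-- The values of the quotient at the nonzero functions in `H¹(G)`. -/
def quotientValues (G : MetricGraph V B H) : Set ℝ :=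
  {q | ∃ u ∈ G.H1, G.mass u ≠ 0 ∧ G.quotient u = q}

/-- The sharp constant `C_K`. -/
noncomputable def sharpConstant (G : MetricGraph V B H) : ℝ :=
  sSup G.quotientValues

/-- The reduced critical mass `μ_K`. -/
noncomputable def reducedCriticalMass (G : MetricGraph V B H) : ℝ :=
  Real.sqrt (3 / G.sharpConstant)

end MetricGraph

/-- The critical mass of the real line. -/
noncomputable def criticalMassLine : ℝ := Real.pi * Real.sqrt 3 / 2

/-- The critical mass of the half-line. -/
noncomputable def criticalMassHalfLine : ℝ := criticalMassLine / 2

open Set Filter Topology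

/-! ### One-dimensional estimates -/

/-! Lower bounds come from a calibration instead of rearrangements. For a weight `h ≥ 0` with
primitive `g`, the chain rule and the arithmetic-geometric mean inequality give `|(g(u²))'| ≤ ½|u'|²
+ 2u²h(u²)²`. Let `c` be the maximum of `u²` on the core and `h(r) = √(c² - r²)/(2√3)`; then the
last term is `c²u²/6 - u⁶/6`. On half-lines a linear bound with slope `c/(2√3)` costs the same
multiple `c²/6` of the mass. Summing over edges, `E(u) + (c²/6)‖u‖²` dominates the variation of
`g(u²)` on the core plus its values at the roots. If every level is taken at least `N` times, this
is at least `N g(c) = (c²/6) N μ_{R⁺}`. Connectedness gives `N = 1`, a cycle covering `N = 2`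
(`hasMultiplicity_one`, `hasMultiplicity_two`). Equality would force `u` to vanish at the roots and
then on the whole core, so `HasMultiplicity.energy_pos` is strict, even at mass `N μ_{R⁺}`.

Truncated solitons concentrating inside a bounded edge, or half solitons at a terminal vertex, make
the energy unbounded below above `μ_R`, respectively `μ_{R⁺}`. The identity `E = (T/6)(3 - m²Q)`,
with mass `m`, kinetic term `T` and quotient `Q`, translates all this into statements on `μ_K`; (i)
and (ii) follow because the two thresholds match.

Without terminal edges, `exists_forall_energy_ge` damps the weight below `β`, the largest of the
edge minima of `u²`. The damped levels are taken twice, and the loss, of order `cβ log(c/β)`, is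
beaten for large `c` by the gain `c²βℓ/6` from the edge where `u² ≥ β`. Hence concentrating
functions have almost nonnegative energy up to mass `μ_R`, and the relevant sequences are bounded.
Their limits (`exists_H1_limit`) are nonzero because negative energy keeps the sextic term away from
zero, and mass that is lost is restored by scaling, which does not raise a nonpositive energy. This
yields ground states, and `μ_{R⁺} < μ_K` by strict positivity at `μ_{R⁺}`. With one half-line, a
perturbed plateau has quotient above `1`, so `μ_K < √3 < μ_R`. -/

theorem AbsolutelyContinuousOnInterval.lipschitz_comp {f g : ℝ → ℝ} {a b K : ℝ}
    (hg : ∀ x y, |g x - g y| ≤ K * |x - y|) (hf : AbsolutelyContinuousOnInterval f a b) :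
    AbsolutelyContinuousOnInterval (fun x => g (f x)) a b := by
  apply squeeze_zero (fun t ↦ ?_) (fun t ↦ ?_) (by simpa using Tendsto.const_mul K hf)
  · exact Finset.sum_nonneg (fun i _ ↦ dist_nonneg)
  · rw [Finset.mul_sum]
    exact Finset.sum_le_sum fun i _ => hg _ _

theorem AbsolutelyContinuousOnInterval.abs_sub_le {f : ℝ → ℝ} {a b : ℝ} (hab : a ≤ b)
    (hf : AbsolutelyContinuousOnInterval f a b) : |f b - f a| ≤ ∫ x in a..b, |deriv f x| := by
  rw [← hf.integral_deriv_eq_sub]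
  exact intervalIntegral.abs_integral_le_integral_abs hab

/-- The total variation of an absolutely continuous function dominates its oscillation along a
partition with two interior points. -/
theorem AbsolutelyContinuousOnInterval.sum_abs_sub_le {f : ℝ → ℝ} {a b x y : ℝ}
    (hax : a ≤ x) (hxy : x ≤ y) (hyb : y ≤ b) (hf : AbsolutelyContinuousOnInterval f a b) :
    |f x - f a| + |f y - f x| + |f b - f y| ≤ ∫ t in a..b, |deriv f t| := by
  have hI : IntervalIntegrable (fun t => |deriv f t|) volume a b := hf.intervalIntegrable_deriv.abs
  have sub : ∀ c d, a ≤ c → c ≤ d → d ≤ b → uIcc c d ⊆ uIcc a b := fun c d h1 h2 h3 => by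
    rw [uIcc_of_le h2, uIcc_of_le (by linarith)]; exact Icc_subset_Icc h1 h3
  have h1 := (hf.mono (sub a x le_rfl hax (by linarith))).abs_sub_le hax
  have h2 := (hf.mono (sub x y hax hxy hyb)).abs_sub_le hxy
  have h3 := (hf.mono (sub y b (by linarith) hyb le_rfl)).abs_sub_le hyb
  have i1 := hI.mono_set (sub a x le_rfl hax (by linarith))
  have i2 := hI.mono_set (sub x y hax hxy hyb)
  have i3 := hI.mono_set (sub y b (by linarith) hyb le_rfl)
  rw [← intervalIntegral.integral_add_adjacent_intervals (i1.trans i2) i3,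
    ← intervalIntegral.integral_add_adjacent_intervals i1 i2]
  linarith

/-- The primitive of `h` vanishing at `0`. -/
noncomputable def primitive (h : ℝ → ℝ) (r : ℝ) : ℝ := ∫ t in (0 : ℝ)..r, h t

@[simp] theorem primitive_zero (h : ℝ → ℝ) : primitive h 0 = 0 := by simp [primitive]

theorem hasDerivAt_primitive {h : ℝ → ℝ} (hc : Continuous h) (r : ℝ) :
    HasDerivAt (primitive h) (h r) r :=
  intervalIntegral.integral_hasDerivAt_right (hc.intervalIntegrable _ _)
    (hc.stronglyMeasurableAtFilter _ _) hc.continuousAt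

theorem primitive_sub {h : ℝ → ℝ} (hc : Continuous h) (r s : ℝ) :
    primitive h r - primitive h s = ∫ t in s..r, h t :=
  intervalIntegral.integral_interval_sub_left (hc.intervalIntegrable _ _)
    (hc.intervalIntegrable _ _)

theorem primitive_lipschitz {h : ℝ → ℝ} (hc : Continuous h) {K : ℝ} (hK : ∀ r, |h r| ≤ K)
    (r s : ℝ) : |primitive h r - primitive h s| ≤ K * |r - s| := by
  rw [primitive_sub hc]
  exact intervalIntegral.norm_integral_le_of_norm_le_const (f := h) fun x _ => hK x

theorem primitive_monotone {h : ℝ → ℝ} (hc : Continuous h) (h0 : ∀ r, 0 ≤ h r) :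
    Monotone (primitive h) := fun s r hsr => by
  rw [← sub_nonneg, primitive_sub hc]
  exact intervalIntegral.integral_nonneg hsr fun x _ => h0 x

theorem primitive_le {h : ℝ → ℝ} (hc : Continuous h) {K : ℝ} (hK : ∀ r, |h r| ≤ K)
    {r : ℝ} (hr : 0 ≤ r) : primitive h r ≤ K * r := by
  have := primitive_lipschitz hc hK r 0
  rw [primitive_zero, sub_zero, sub_zero, abs_of_nonneg hr] at this
  exact (le_abs_self _).trans this

namespace MemH1On

variable {f : ℝ → ℝ} {ℓ : ℝ}

theorem absolutelyContinuous (hℓ : 0 ≤ ℓ) (hf : MetricGraph.MemH1On (Icc 0 ℓ) f) :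
    AbsolutelyContinuousOnInterval f 0 ℓ := hf.1 ℓ ⟨hℓ, le_rfl⟩

theorem continuousOn (hℓ : 0 ≤ ℓ) (hf : MetricGraph.MemH1On (Icc 0 ℓ) f) :
    ContinuousOn f (Icc 0 ℓ) := by
  have := (absolutelyContinuous hℓ hf).continuousOn
  rwa [uIcc_of_le hℓ] at this

theorem integrable_sq {I : Set ℝ} (hf : MetricGraph.MemH1On I f) :
    IntegrableOn (fun x => |f x| ^ 2) I := by
  simpa only [sq_abs] using! hf.2.1.integrable_sq

theorem integrable_deriv_sq {I : Set ℝ} (hf : MetricGraph.MemH1On I f) :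
    IntegrableOn (fun x => |deriv f x| ^ 2) I := by
  simpa only [sq_abs] using! hf.2.2.integrable_sq

end MemH1On

section Edge

variable {f h : ℝ → ℝ} {ℓ K : ℝ}

theorem absolutelyContinuous_primitive_sq (hℓ : 0 ≤ ℓ) (hf : MetricGraph.MemH1On (Icc 0 ℓ) f)
    (hc : Continuous h) (hK : ∀ r, |h r| ≤ K) :
    AbsolutelyContinuousOnInterval (fun t => primitive h (f t ^ 2)) 0 ℓ := by
  have ac := MemH1On.absolutelyContinuous hℓ hf
  refine AbsolutelyContinuousOnInterval.lipschitz_comp (f := fun t => f t ^ 2)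
    (primitive_lipschitz hc hK) ?_
  simpa only [sq] using! ac.mul ac

theorem integrableOn_sq_mul_sq (hℓ : 0 ≤ ℓ) (hf : MetricGraph.MemH1On (Icc 0 ℓ) f)
    (hc : Continuous h) : IntegrableOn (fun t => f t ^ 2 * h (f t ^ 2) ^ 2) (Icc 0 ℓ) := by
  have cf := MemH1On.continuousOn hℓ hf
  exact ((cf.pow 2).mul ((hc.comp_continuousOn (cf.pow 2)).pow 2)).integrableOn_compact
    isCompact_Icc

theorem ae_deriv_primitive_sq (hℓ : 0 ≤ ℓ) (hf : MetricGraph.MemH1On (Icc 0 ℓ) f)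
    (hc : Continuous h) : ∀ᵐ t ∂volume.restrict (Icc 0 ℓ),
      deriv (fun t => primitive h (f t ^ 2)) t = h (f t ^ 2) * (2 * f t * deriv f t) := by
  filter_upwards [ae_restrict_of_ae (MemH1On.absolutelyContinuous hℓ hf).ae_differentiableAt,
    ae_restrict_mem measurableSet_Icc] with t ht htm
  rw [uIcc_of_le hℓ] at ht
  have h1 : HasDerivAt (fun t => f t ^ 2) (2 * f t * deriv f t) t := by
    simpa using (ht htm).hasDerivAt.fun_pow 2
  exact ((hasDerivAt_primitive hc _).comp t h1).deriv

/-- Chain rule plus `2|f f'| h ≤ ½ f'² + 2 f² h²`. The weight stays free: constants give sup bounds,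
the soliton weight reproduces the sextic term, the damped weight handles peaks. -/
theorem integral_abs_deriv_primitive_sq_le (hℓ : 0 ≤ ℓ)
    (hf : MetricGraph.MemH1On (Icc 0 ℓ) f) (hc : Continuous h) (hK : ∀ r, |h r| ≤ K) :
    (∫ t in (0 : ℝ)..ℓ, |deriv (fun t => primitive h (f t ^ 2)) t|) ≤
    1 / 2 * (∫ t in Icc 0 ℓ, |deriv f t| ^ 2) + 2 * ∫ t in Icc 0 ℓ, f t ^ 2 * h (f t ^ 2) ^ 2 := by
  have acg := absolutelyContinuous_primitive_sq hℓ hf hc hK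
  have hintg := (integrableOn_sq_mul_sq hℓ hf hc).const_mul 2
  have hder := (MemH1On.integrable_deriv_sq hf).const_mul (1 / 2)
  rw [← integral_const_mul, ← integral_const_mul, ← integral_add hder hintg,
    intervalIntegral.integral_of_le hℓ, ← integral_Icc_eq_integral_Ioc]
  refine integral_mono_ae ?_ (hder.add hintg) ?_
  · have := acg.intervalIntegrable_deriv.abs
    rw [intervalIntegrable_iff_integrableOn_Icc_of_le hℓ] at this
    exact this
  · filter_upwards [ae_deriv_primitive_sq hℓ hf hc] with t ht
    rw [ht, sq_abs, abs_le]
    have := sq_nonneg (deriv f t - 2 * f t * h (f t ^ 2))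
    have := sq_nonneg (deriv f t + 2 * f t * h (f t ^ 2))
    constructor <;> nlinarith

/-- The case of equality in `integral_abs_deriv_primitive_sq_le`. -/
theorem ae_abs_deriv_eq_of_le_integral (hℓ : 0 ≤ ℓ)
    (hf : MetricGraph.MemH1On (Icc 0 ℓ) f) (hc : Continuous h) (hK : ∀ r, |h r| ≤ K)
    (h0 : ∀ r, 0 ≤ h r)
    (heq : 1 / 2 * (∫ t in Icc 0 ℓ, |deriv f t| ^ 2) +
      2 * (∫ t in Icc 0 ℓ, f t ^ 2 * h (f t ^ 2) ^ 2) ≤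
      ∫ t in (0 : ℝ)..ℓ, |deriv (fun t => primitive h (f t ^ 2)) t|) :
    ∀ᵐ t ∂volume.restrict (Icc 0 ℓ), |deriv f t| = 2 * |f t| * h (f t ^ 2) := by
  have acg := absolutelyContinuous_primitive_sq hℓ hf hc hK
  have hintg := (integrableOn_sq_mul_sq hℓ hf hc).const_mul 2
  have hder := (MemH1On.integrable_deriv_sq hf).const_mul (1 / 2)
  have hg : IntegrableOn (fun t => |deriv (fun t => primitive h (f t ^ 2)) t|) (Icc 0 ℓ) := by
    have := acg.intervalIntegrable_deriv.abs
    rwa [intervalIntegrable_iff_integrableOn_Icc_of_le hℓ] at this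
  rw [← integral_const_mul, ← integral_const_mul, ← integral_add hder hintg,
    intervalIntegral.integral_of_le hℓ, ← integral_Icc_eq_integral_Ioc, ← sub_nonpos,
    ← integral_sub (f := fun t => 1 / 2 * |deriv f t| ^ 2 + 2 * (f t ^ 2 * h (f t ^ 2) ^ 2))
      (hder.add hintg) hg] at heq
  have hae := ae_deriv_primitive_sq hℓ hf hc
  -- The gap between the two integrands is a perfect square, so a nonpositive integral makes it
  -- vanish almost everywhere.
  have hform : ∀ᵐ t ∂volume.restrict (Icc 0 ℓ),
      1 / 2 * |deriv f t| ^ 2 + 2 * (f t ^ 2 * h (f t ^ 2) ^ 2) -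
        |deriv (fun t => primitive h (f t ^ 2)) t| =
      1 / 2 * (|deriv f t| - 2 * |f t| * h (f t ^ 2)) ^ 2 := by
    filter_upwards [hae] with t ht
    rw [ht, abs_mul, abs_mul, abs_mul, abs_two, abs_of_nonneg (h0 _), ← sq_abs (f t)]
    ring
  have hnn : 0 ≤ᵐ[volume.restrict (Icc 0 ℓ)] fun t =>
      1 / 2 * |deriv f t| ^ 2 + 2 * (f t ^ 2 * h (f t ^ 2) ^ 2) -
        |deriv (fun t => primitive h (f t ^ 2)) t| := by
    filter_upwards [hform] with t ht
    rw [ht]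
    positivity
  have hz := (integral_eq_zero_iff_of_nonneg_ae hnn ((hder.add hintg).sub hg)).1
    (le_antisymm heq (integral_nonneg_of_ae hnn))
  filter_upwards [hform, hz] with t h1 h2
  rw [h1] at h2
  have : (|deriv f t| - 2 * |f t| * h (f t ^ 2)) ^ 2 = 0 := by
    simpa using h2
  linarith [pow_eq_zero_iff (two_ne_zero) |>.1 this]

end Edge

/-- A pointwise bound on a half-line, with an arbitrary parameter. -/
theorem mul_sq_le_of_memH1On_Ici {f : ℝ → ℝ} (hf : MetricGraph.MemH1On (Ici 0) f) {κ x : ℝ}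
    (hκ : 0 ≤ κ) (hx : 0 ≤ x) :
    κ * f x ^ 2 ≤ (∫ t in Ici 0, |deriv f t| ^ 2) + κ ^ 2 * ∫ t in Ici 0, |f t| ^ 2 := by
  rcases hκ.eq_or_lt with rfl | hκ
  · simpa using integral_nonneg fun t => by positivity
  set J := (∫ t in Ici 0, |deriv f t| ^ 2) + κ ^ 2 * ∫ t in Ici 0, |f t| ^ 2 with hJ
  have i1 := MemH1On.integrable_deriv_sq hf
  have i2 := (MemH1On.integrable_sq hf).const_mul (κ ^ 2)
  -- From `2κ|f f'| ≤ f'² + κ²f²`, the quantity `κ f²` can drop by at most `J` to the right of `x`.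
  have key : ∀ y, x ≤ y → κ * f x ^ 2 - J ≤ κ * f y ^ 2 := by
    intro y hy
    have ac : AbsolutelyContinuousOnInterval f x y := (hf.1 y (hx.trans hy)).mono (by
      rw [uIcc_of_le hy, uIcc_of_le (hx.trans hy)]; exact Icc_subset_Icc_left hx)
    have ac2 : AbsolutelyContinuousOnInterval (fun t => f t * f t) x y := ac.mul ac
    have h1 := ac2.abs_sub_le hy
    have h2 : κ * (∫ t in x..y, |deriv (fun t => f t * f t) t|) ≤ J := by
      rw [hJ, ← integral_const_mul, ← integral_add i1 i2, ← intervalIntegral.integral_const_mul,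
        intervalIntegral.integral_of_le hy]
      have sub : Ioc x y ⊆ Ici 0 := fun t ht => hx.trans ht.1.le
      refine le_trans (integral_mono_ae ?_ ((i1.add i2).mono_set sub) ?_)
        (setIntegral_mono_set (i1.add i2) (ae_of_all _ fun t => by
          simp only [Pi.zero_apply, Pi.add_apply]; positivity) sub.eventuallyLE)
      · have := (ac2.intervalIntegrable_deriv.abs).const_mul κ
        rwa [intervalIntegrable_iff_integrableOn_Ioc_of_le hy] at this
      · filter_upwards [ae_restrict_of_ae ac.ae_differentiableAt,
          ae_restrict_mem measurableSet_Ioc] with t ht htm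
        rw [uIcc_of_le hy] at ht
        have hd := (ht (Ioc_subset_Icc_self htm)).hasDerivAt
        have hd2 : deriv (fun t => f t * f t) t = 2 * (f t * deriv f t) := by
          rw [(hd.fun_mul hd).deriv]; ring
        simp only [Pi.add_apply]
        rw [hd2, abs_mul, abs_mul, abs_two]
        nlinarith [sq_nonneg (|deriv f t| - κ * |f t|)]
    have h3 := (abs_le.mp h1).1
    nlinarith
  -- Otherwise `f²` stays above a positive constant on `[x, ∞)`, against square integrability; no
  -- limit at infinity is needed.
  by_contra! hlt
  have i3 : IntegrableOn (fun t => |f t| ^ 2) (Ici x) :=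
    (MemH1On.integrable_sq hf).mono_set (Ici_subset_Ici.2 hx)
  have i4 : IntegrableOn (fun _ => (κ * f x ^ 2 - J) / κ) (Ici x) := by
    refine Integrable.mono' i3 (by fun_prop) ?_
    filter_upwards [ae_restrict_mem measurableSet_Ici] with t ht
    rw [Real.norm_of_nonneg (div_nonneg (by linarith) hκ.le), div_le_iff₀ hκ, sq_abs]
    linarith [key t ht]
  rw [integrableOn_const_iff (by simp)] at i4
  rcases i4 with h | h
  · exact (div_pos (sub_pos.2 hlt) hκ).ne' (enorm_eq_zero.1 h)
  · simp at h

/-! ### Level counting on the graph -/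

/-- If every level in `(0, Y)` lies in at least `N` of the intervals `[p i, q i)`, then these have
total length at least `N * Y`. -/
theorem mul_le_sum_length {ι : Type*} [Fintype ι] {p q : ι → ℝ} (hpq : ∀ i, p i ≤ q i) {N Y : ℝ}
    (hY : 0 ≤ Y)
    (hN : ∀ t ∈ Ioo 0 Y, N ≤ ∑ i, (Ico (p i) (q i)).indicator (fun _ => (1 : ℝ)) t) :
    N * Y ≤ ∑ i, (q i - p i) := by
  have hi : ∀ i, Integrable ((Ico (p i) (q i)).indicator (fun _ => (1 : ℝ))) := fun i =>
    (integrable_indicator_iff measurableSet_Ico).2 (by simp)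
  have h1 : ∫ t in Ioo 0 Y, N = N * Y := by
    simp [hY, mul_comm]
  have h2 : ∀ i, ∫ t, (Ico (p i) (q i)).indicator (fun _ => (1 : ℝ)) t = q i - p i := fun i => by
    rw [integral_indicator measurableSet_Ico]; simp [hpq i]
  rw [← h1, ← Finset.sum_congr rfl fun i _ => h2 i, ← integral_finsetSum _ fun i _ => hi i]
  have hs : Integrable fun t => ∑ i, (Ico (p i) (q i)).indicator (fun _ => (1 : ℝ)) t :=
    integrable_finsetSum _ fun i _ => hi i
  have hnn : ∀ t, 0 ≤ ∑ i, (Ico (p i) (q i)).indicator (fun _ => (1 : ℝ)) t := fun t =>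
    Finset.sum_nonneg fun i _ => indicator_nonneg (fun _ _ => zero_le_one) t
  refine (setIntegral_mono_on (by simp) hs.integrableOn measurableSet_Ioo hN).trans ?_
  exact setIntegral_le_integral hs (ae_of_all _ hnn)

namespace MetricGraph

variable {V B H : Type*} {G : MetricGraph V B H}

theorem Walk.mem_iff_mem {R : Set V} {v w : V} {l : List B} (hw : G.Walk v w l)
    (hl : ∀ b ∈ l, G.src b ∈ R ↔ G.tgt b ∈ R) : v ∈ R ↔ w ∈ R := by
  induction hw with
  | nil => rfl
  | forward b _ ih =>
    rw [hl b (by simp), ih fun b' hb' => hl b' (by simp [hb'])]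
  | backward b _ ih =>
    rw [← hl b (by simp), ih fun b' hb' => hl b' (by simp [hb'])]

/-- A path traversing exactly one edge of the cut given by `R` joins the two sides of the cut. -/
theorem Walk.not_mem_iff_mem {R : Set V} {v w : V} {l : List B} (hw : G.Walk v w l)
    (hnd : l.Nodup) {b : B} (hb : b ∈ l) (hcut : ¬ (G.src b ∈ R ↔ G.tgt b ∈ R))
    (hl : ∀ b' ∈ l, b' ≠ b → (G.src b' ∈ R ↔ G.tgt b' ∈ R)) : ¬ (v ∈ R ↔ w ∈ R) := by
  induction hw with
  | nil => simp at hb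
  | forward c hw ih =>
    rw [List.nodup_cons] at hnd
    by_cases hcb : c = b
    · subst hcb
      rw [← hw.mem_iff_mem fun b' hb' => hl b' (by simp [hb']) fun h => hnd.1 (h ▸ hb')]
      exact hcut
    · rw [hl c (by simp) hcb]
      exact ih hnd.2 (by simpa [Ne.symm hcb] using hb) fun b' hb' => hl b' (by simp [hb'])
  | backward c hw ih =>
    rw [List.nodup_cons] at hnd
    by_cases hcb : c = b
    · subst hcb
      rw [← hw.mem_iff_mem fun b' hb' => hl b' (by simp [hb']) fun h => hnd.1 (h ▸ hb')]
      exact fun h => hcut h.symm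
    · rw [← hl c (by simp) hcb]
      exact ih hnd.2 (by simpa [Ne.symm hcb] using hb) fun b' hb' => hl b' (by simp [hb'])

/-- Every vertex therefore lies on the core, and bounds on the core control the values at the roots
of the half-lines. -/
theorem Connected.exists_incident (hconn : G.Connected) (hB : Nonempty B) (v : V) :
    ∃ b, v = G.src b ∨ v = G.tgt b := by
  obtain ⟨b₀⟩ := hB
  obtain ⟨l, hl⟩ := hconn.2 v (G.src b₀)
  generalize hw : G.src b₀ = w at hl
  cases hl with
  | nil => exact ⟨b₀, Or.inl hw.symm⟩
  | forward b _ => exact ⟨b, Or.inl rfl⟩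
  | backward b _ => exact ⟨b, Or.inr rfl⟩

/-- In a graph with a cycle covering, no edge separates the roots of the half-lines from the rest. -/
theorem HasCycleCovering.exists_of_cut (hG : G.HasCycleCovering) {R : Set V} {b : B}
    (hcut : ¬ (G.src b ∈ R ↔ G.tgt b ∈ R)) (hroot : ∀ h, G.root h ∉ R) :
    ∃ b', b' ≠ b ∧ ¬ (G.src b' ∈ R ↔ G.tgt b' ∈ R) := by
  -- A cycle through `b` would cross the cut exactly once and so have its ends on opposite sides.
  -- But a closed path returns to its start, and an unbounded one has both ends outside `R`.
  by_contra! hne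
  rcases hG (Sum.inl b) with ⟨v, l, hw, hnd, b', hb', he⟩ | ⟨h₁, h₂, l, -, hw, hnd, he⟩
  · rw [Sum.inl.injEq] at he
    subst he
    exact hw.not_mem_iff_mem hnd hb' hcut (fun c _ => hne c) Iff.rfl
  · rcases he with he | he | ⟨b', hb', he⟩
    · cases he
    · cases he
    rw [Sum.inl.injEq] at he
    subst he
    exact hw.not_mem_iff_mem hnd hb' hcut (fun c _ => hne c) (by simp [hroot])

variable [Fintype B] [Fintype H]

open Classical in
/-- Every function on the graph vanishing at infinity takes at least `N` times almost every value
below its maximum `Y` on the core; the statement is about the values at the vertices and at a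
maximum point on the edge `b₀`. -/
def HasMultiplicity (G : MetricGraph V B H) (N : ℝ) : Prop :=
  ∀ (y : V → ℝ) (Y : ℝ) (b₀ : B), (∀ v, 0 ≤ y v) → y (G.src b₀) ≤ Y → y (G.tgt b₀) ≤ Y →
    N * Y ≤ (∑ b, if b = b₀ then (Y - y (G.src b)) + (Y - y (G.tgt b))
      else |y (G.src b) - y (G.tgt b)|) + ∑ h, y (G.root h)

open Classical in
/-- Lower endpoints of the intervals of levels crossed by the edges. -/
noncomputable def levelMin (G : MetricGraph V B H) (y : V → ℝ) (b₀ : B) :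
    (B ⊕ H) ⊕ Unit → ℝ
  | Sum.inl (Sum.inl b) => if b = b₀ then y (G.src b) else min (y (G.src b)) (y (G.tgt b))
  | Sum.inl (Sum.inr _) => 0
  | Sum.inr _ => y (G.tgt b₀)

open Classical in
/-- Upper endpoints of the intervals of levels crossed by the edges. -/
noncomputable def levelMax (G : MetricGraph V B H) (y : V → ℝ) (Y : ℝ) (b₀ : B) :
    (B ⊕ H) ⊕ Unit → ℝ
  | Sum.inl (Sum.inl b) => if b = b₀ then Y else max (y (G.src b)) (y (G.tgt b))
  | Sum.inl (Sum.inr h) => y (G.root h)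
  | Sum.inr _ => Y

/-- The edge `b₀` is split at its maximum point: its own index carries the half at the source, the
extra `Unit` index the half at the target. The interval lengths then add up to the right-hand side
of `HasMultiplicity`. -/
theorem hasMultiplicity_of_level {N : ℝ} (hN : ∀ (y : V → ℝ) (Y : ℝ) (b₀ : B), (∀ v, 0 ≤ y v) →
      ∀ t ∈ Ioo 0 Y, N ≤ ∑ i, (Ico (G.levelMin y b₀ i) (G.levelMax y Y b₀ i)).indicator
        (fun _ => (1 : ℝ)) t) : G.HasMultiplicity N := by
  classical
  intro y Y b₀ hy hs ht
  have := mul_le_sum_length (p := G.levelMin y b₀) (q := G.levelMax y Y b₀) (N := N) (Y := Y) (by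
    rintro ((b | h) | _)
    · by_cases hb : b = b₀
      · simp [levelMin, levelMax, hb, hs]
      · simp [levelMin, levelMax, hb]
    · exact hy _
    · exact ht) ((hy _).trans hs) (hN y Y b₀ hy)
  refine this.trans (le_of_eq ?_)
  rw [Fintype.sum_sum_type, Fintype.sum_sum_type]
  simp only [levelMin, levelMax, Finset.univ_unique, Finset.sum_singleton, sub_zero]
  have : ∀ b, ((if b = b₀ then Y else max (y (G.src b)) (y (G.tgt b))) -
      if b = b₀ then y (G.src b) else min (y (G.src b)) (y (G.tgt b))) =
      (if b = b₀ then (Y - y (G.src b)) + (Y - y (G.tgt b)) else |y (G.src b) - y (G.tgt b)|) -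
      if b = b₀ then (Y - y (G.tgt b₀)) else 0 := by
    intro b
    by_cases hb : b = b₀
    · simp [hb]
    · simp [hb, max_sub_min_eq_abs']
  rw [Finset.sum_congr rfl fun b _ => this b, Finset.sum_sub_distrib, Finset.sum_ite_eq']
  simp only [Finset.mem_univ, if_true]
  ring

/-- If nothing crosses level `t`, the set `{t < y}` contains both ends of `b₀` and is invariant
along bounded edges. By connectedness it then contains the root of a half-line, along which the
level is crossed after all. -/
theorem exists_mem_level (hconn : G.Connected) (hH : Nonempty H) (y : V → ℝ) (Y : ℝ) (b₀ : B)
    {t : ℝ} (ht : t ∈ Ioo 0 Y) : ∃ i, t ∈ Ico (G.levelMin y b₀ i) (G.levelMax y Y b₀ i) := by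
  classical
  by_contra! hne
  obtain ⟨h⟩ := hH
  obtain ⟨l, hl⟩ := hconn.2 (G.src b₀) (G.root h)
  have h1 := hne (Sum.inl (Sum.inl b₀))
  have h2 := hne (Sum.inr ())
  have h3 := hne (Sum.inl (Sum.inr h))
  simp only [levelMin, levelMax, if_true, mem_Ico, not_and, not_lt] at h1 h2 h3
  have hs : t < y (G.src b₀) := by by_contra! hc; linarith [h1 hc, ht.2]
  have ht' : t < y (G.tgt b₀) := by by_contra! hc; linarith [h2 hc, ht.2]
  have := hl.mem_iff_mem (R := {v | t < y v}) fun b _ => by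
    by_cases hb : b = b₀
    · subst hb; simp [hs, ht']
    · have := hne (Sum.inl (Sum.inl b))
      simp only [levelMin, levelMax, hb, if_false, mem_Ico] at this
      simp only [mem_ofPred_eq]
      grind
  have := this.1 hs
  simp only [mem_ofPred_eq] at this
  linarith [h3 ht.1.le]

theorem hasMultiplicity_one (hconn : G.Connected) (hH : Nonempty H) : G.HasMultiplicity 1 := by
  refine hasMultiplicity_of_level fun y Y b₀ _ t ht => ?_
  obtain ⟨i, hi⟩ := exists_mem_level hconn hH y Y b₀ ht
  refine le_trans ?_ (Finset.single_le_sum (fun j _ => indicator_nonneg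
    (fun _ _ => zero_le_one) t) (Finset.mem_univ i))
  rw [indicator_of_mem hi]

/-- Suppose only one interval contains `t`. If it belongs to a bounded edge, or to a half of `b₀`,
that edge alone cuts `{t < y}` from its complement and no root lies in `{t < y}`, against
`exists_of_cut`. If it belongs to a half-line, no bounded edge leaves `{t < y}`, so the root of a
second half-line lies there too. -/
theorem hasMultiplicity_two (hconn : G.Connected) (hH : Nonempty H) (hG : G.HasCycleCovering) :
    G.HasMultiplicity 2 := by
  classical
  refine hasMultiplicity_of_level fun y Y b₀ hy t ht => ?_
  obtain ⟨i, hi⟩ := exists_mem_level hconn hH y Y b₀ ht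
  suffices h : ∃ j, j ≠ i ∧ t ∈ Ico (G.levelMin y b₀ j) (G.levelMax y Y b₀ j) by
    obtain ⟨j, hji, hj⟩ := h
    have := Finset.sum_le_sum_of_subset_of_nonneg (Finset.subset_univ {j, i})
      (f := fun i => (Ico (G.levelMin y b₀ i) (G.levelMax y Y b₀ i)).indicator
        (fun _ => (1 : ℝ)) t) fun k _ _ => indicator_nonneg (fun _ _ => zero_le_one) t
    rw [Finset.sum_pair hji, indicator_of_mem hi, indicator_of_mem hj] at this
    linarith
  by_contra! hne
  set R : Set V := {v | t < y v} with hR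
  have hroot : ∀ h, Sum.inl (Sum.inr h) ≠ i → G.root h ∉ R := fun h hh hm => by
    have := hne _ hh
    simp only [levelMin, levelMax, mem_Ico, not_and, not_lt] at this
    exact absurd hm (not_lt.2 (this ht.1.le))
  have hsrc : Sum.inl (Sum.inl b₀) ≠ i → G.src b₀ ∈ R := fun hh => by
    have := hne _ hh
    simp only [levelMin, levelMax, if_true, mem_Ico, not_and, not_lt] at this
    by_contra hc
    linarith [this (not_lt.1 hc), ht.2]
  have htgt : Sum.inr () ≠ i → G.tgt b₀ ∈ R := fun hh => by
    have := hne _ hh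
    simp only [levelMin, levelMax, mem_Ico, not_and, not_lt] at this
    by_contra hc
    linarith [this (not_lt.1 hc), ht.2]
  have hnc : ∀ b, b ≠ b₀ → Sum.inl (Sum.inl b) ≠ i → (G.src b ∈ R ↔ G.tgt b ∈ R) :=
    fun b hb hh => by
      have := hne _ hh
      simp only [levelMin, levelMax, hb, if_false, mem_Ico] at this
      simp only [hR, mem_ofPred_eq]
      grind
  rcases i with (b | h) | ⟨⟩
  · have hb₀ : b ≠ b₀ → (G.src b₀ ∈ R ↔ G.tgt b₀ ∈ R) := fun hb => by
      simp [hsrc (by simpa using hb.symm), htgt (by simp)]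
    have hcut : ¬ (G.src b ∈ R ↔ G.tgt b ∈ R) := by
      by_cases hb : b = b₀
      · subst hb
        simp only [levelMin, levelMax, if_true, mem_Ico] at hi
        exact fun h => absurd (h.2 (htgt (by simp))) (not_lt.2 hi.1)
      · simp only [levelMin, levelMax, hb, if_false, mem_Ico] at hi
        simp only [hR, mem_ofPred_eq]
        grind
    obtain ⟨b', hb', hc⟩ := hG.exists_of_cut hcut fun h => hroot h (by simp)
    by_cases hbb : b' = b₀
    · subst hbb; exact hc (hb₀ hb'.symm)
    · exact hc (hnc b' hbb (by simpa using hb'))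
  · have hiff : ∀ b, G.src b ∈ R ↔ G.tgt b ∈ R := fun b => by
      by_cases hb : b = b₀
      · subst hb; simp [hsrc (by simp), htgt (by simp)]
      · exact hnc b hb (by simp)
    have hin : G.root h ∈ R := hi.2
    -- A bounded cycle contains no half-line, so the cycle covering `h` is unbounded and supplies
    -- the second half-line.
    obtain ⟨h', hh'⟩ : ∃ h', h' ≠ h := by
      rcases hG (Sum.inr h) with ⟨_, _, _, _, _, _, he⟩ | ⟨h₁, h₂, l, h12, -, -, he⟩
      · cases he
      · by_cases h1 : h₁ = h
        · exact ⟨h₂, fun h2 => h12 (h1.trans h2.symm)⟩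
        · exact ⟨h₁, h1⟩
    obtain ⟨l, hl⟩ := hconn.2 (G.root h) (G.root h')
    exact hroot h' (by simpa using hh') ((hl.mem_iff_mem fun b _ => hiff b).1 hin)
  · simp only [levelMin, levelMax, mem_Ico] at hi
    have hcut : ¬ (G.src b₀ ∈ R ↔ G.tgt b₀ ∈ R) := fun h =>
      absurd (h.1 (hsrc (by simp))) (not_lt.2 hi.1)
    obtain ⟨b', hb', hc⟩ := hG.exists_of_cut hcut fun h => hroot h (by simp)
    exact hc (hnc b' hb' (by simp))

end MetricGraph

/-! ### Lower bounds for the energy -/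

/-- The weight for which the calibration argument is sharp on solitons of squared height `c`. -/
noncomputable def solitonWeight (c r : ℝ) : ℝ := √(c ^ 2 - r ^ 2) / (2 * √3)

theorem continuous_solitonWeight (c : ℝ) : Continuous (solitonWeight c) := by
  unfold solitonWeight; fun_prop

theorem solitonWeight_nonneg (c r : ℝ) : 0 ≤ solitonWeight c r := by
  unfold solitonWeight; positivity

theorem solitonWeight_le {c : ℝ} (hc : 0 ≤ c) (r : ℝ) : solitonWeight c r ≤ c / (2 * √3) := by
  unfold solitonWeight
  gcongr
  exact Real.sqrt_le_iff.2 ⟨hc, by nlinarith [sq_nonneg r]⟩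

theorem abs_solitonWeight_le {c : ℝ} (hc : 0 ≤ c) (r : ℝ) :
    |solitonWeight c r| ≤ c / (2 * √3) := by
  rw [abs_of_nonneg (solitonWeight_nonneg c r)]
  exact solitonWeight_le hc r

/-- With `r = u²` this turns `2 r h(r)²` into `c²u²/6 - u⁶/6`, a multiple of the mass density minus
the potential. -/
theorem solitonWeight_sq {c r : ℝ} (hr : 0 ≤ r) (hrc : r ≤ c) :
    solitonWeight c r ^ 2 = (c ^ 2 - r ^ 2) / 12 := by
  unfold solitonWeight
  rw [div_pow, Real.sq_sqrt (by nlinarith), mul_pow, Real.sq_sqrt (by norm_num)]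
  norm_num

theorem integral_sqrt_sq_sub_sq {c : ℝ} (hc : 0 ≤ c) :
    ∫ t in (0 : ℝ)..c, √(c ^ 2 - t ^ 2) = c ^ 2 * Real.pi / 4 := by
  have hhalf : ∫ x in (0 : ℝ)..1, √(1 - x ^ 2) = Real.pi / 4 := by
    have h1 := integral_sqrt_one_sub_sq
    have hcont : Continuous fun x : ℝ => √(1 - x ^ 2) := by fun_prop
    rw [← intervalIntegral.integral_add_adjacent_intervals (hcont.intervalIntegrable (-1) 0)
      (hcont.intervalIntegrable 0 1)] at h1
    have h2 : ∫ x in (-1 : ℝ)..0, √(1 - x ^ 2) = ∫ x in (0 : ℝ)..1, √(1 - x ^ 2) := by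
      have := intervalIntegral.integral_comp_neg (a := 0) (b := 1) fun x : ℝ => √(1 - x ^ 2)
      simpa using this.symm
    linarith
  have h3 : ∀ x : ℝ, √(c ^ 2 - (c * x) ^ 2) = c * √(1 - x ^ 2) := fun x => by
    rw [show c ^ 2 - (c * x) ^ 2 = c ^ 2 * (1 - x ^ 2) by ring, Real.sqrt_mul (sq_nonneg c),
      Real.sqrt_sq hc]
  have h4 := intervalIntegral.smul_integral_comp_mul_left (a := 0) (b := 1)
    (fun t => √(c ^ 2 - t ^ 2)) c
  simp only [h3, intervalIntegral.integral_const_mul, hhalf, mul_zero, mul_one] at h4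
  rw [← h4, smul_eq_mul]
  ring

/-- The area of a quarter disk of radius `c`; this is how `μ_{R⁺}` enters the lower bounds. -/
theorem primitive_solitonWeight {c : ℝ} (hc : 0 ≤ c) :
    primitive (solitonWeight c) c = c ^ 2 / 6 * criticalMassHalfLine := by
  unfold primitive solitonWeight criticalMassHalfLine criticalMassLine
  rw [intervalIntegral.integral_div, integral_sqrt_sq_sub_sq hc]
  have h3 : √3 * √3 = (3 : ℝ) := Real.mul_self_sqrt (by norm_num)
  have h0 : √3 ≠ (0 : ℝ) := by positivity
  field_simp
  nlinarith

/-- Below its maximal slope, the primitive of the weight is strictly sublinear. -/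
theorem primitive_solitonWeight_lt {c r : ℝ} (hr : 0 < r) (hrc : r ≤ c) :
    primitive (solitonWeight c) r < c / (2 * √3) * r := by
  have hc : 0 ≤ c := by linarith
  have h : ∫ t in (0 : ℝ)..r, solitonWeight c t < ∫ t in (0 : ℝ)..r, c / (2 * √3) := by
    refine intervalIntegral.integral_lt_integral_of_continuousOn_of_le_of_exists_lt hr
      (continuous_solitonWeight c).continuousOn continuousOn_const
      (fun t _ => solitonWeight_le hc t) ⟨r, ⟨hr.le, le_rfl⟩, ?_⟩
    unfold solitonWeight
    gcongr
    rw [Real.sqrt_lt' (by linarith)]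
    nlinarith
  rw [intervalIntegral.integral_const, sub_zero, smul_eq_mul] at h
  rw [mul_comm]
  exact h

/-- A function on a bounded interval controlled by a multiple of itself vanishes identically as soon
as it vanishes at one end. -/
theorem eq_zero_of_ae_abs_deriv_le {f : ℝ → ℝ} {ℓ C : ℝ} (hf : MetricGraph.MemH1On (Icc 0 ℓ) f)
    (hC : ∀ᵐ t ∂volume.restrict (Icc 0 ℓ), |deriv f t| ≤ C * |f t|)
    (h0 : f 0 = 0 ∨ f ℓ = 0) {x : ℝ} (hx : x ∈ Icc 0 ℓ) : f x = 0 := by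
  have hℓ : 0 ≤ ℓ := hx.1.trans hx.2
  have ac := MemH1On.absolutelyContinuous hℓ hf
  -- Grönwall with an integrating factor: `s = -2C` makes the product nonincreasing, for a zero at
  -- the left end; `s = 2C` makes it nondecreasing, for a zero at the right end.
  have acg : ∀ s : ℝ, AbsolutelyContinuousOnInterval (fun t => Real.exp (s * t) * (f t * f t)) 0 ℓ :=
    fun s => AbsolutelyContinuousOnInterval.mul
      (ContDiffOn.absolutelyContinuousOnInterval (by fun_prop)) (ac.mul ac)
  have hder : ∀ s : ℝ, ∀ᵐ t ∂volume.restrict (Icc 0 ℓ),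
      deriv (fun t => Real.exp (s * t) * (f t * f t)) t =
        Real.exp (s * t) * (s * (f t) ^ 2 + 2 * f t * deriv f t) := fun s => by
    filter_upwards [ae_restrict_of_ae ac.ae_differentiableAt, ae_restrict_mem measurableSet_Icc]
      with t ht htm
    rw [uIcc_of_le hℓ] at ht
    have hd := (ht htm).hasDerivAt
    have he : HasDerivAt (fun t => Real.exp (s * t)) (Real.exp (s * t) * (s * 1)) t :=
      ((hasDerivAt_id t).const_mul s).exp
    rw [(he.fun_mul (hd.fun_mul hd)).deriv]
    ring
  suffices h : f x ^ 2 ≤ 0 by nlinarith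
  rcases h0 with h0 | h0
  · have h1 := ((acg (-(2 * C))).mono (c := 0) (d := x) (by
      rw [uIcc_of_le hx.1, uIcc_of_le hℓ]; exact Icc_subset_Icc_right hx.2)).integral_deriv_eq_sub
    have h2 : ∫ t in (0 : ℝ)..x, deriv (fun t => Real.exp (-(2 * C) * t) * (f t * f t)) t ≤ 0 := by
      rw [intervalIntegral.integral_of_le hx.1]
      refine integral_nonpos_of_ae (ae_restrict_of_ae_restrict_of_subset
        (t := Icc 0 ℓ) (fun t ht => ⟨ht.1.le, ht.2.trans hx.2⟩) ?_)
      filter_upwards [hder (-(2 * C)), hC] with t ht hCt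
      rw [ht]
      refine mul_nonpos_of_nonneg_of_nonpos (Real.exp_nonneg _) ?_
      have := abs_mul (f t) (deriv f t)
      have h3 := le_abs_self (f t * deriv f t)
      have h4 := mul_le_mul_of_nonneg_left hCt (abs_nonneg (f t))
      rw [show |f t| * (C * |f t|) = C * |f t| ^ 2 by ring, sq_abs] at h4
      linarith
    rw [h1, h0] at h2
    have := Real.exp_pos (-(2 * C) * x)
    by_contra! hc
    nlinarith [mul_pos this hc]
  · have h1 := ((acg (2 * C)).mono (c := x) (d := ℓ) (by
      rw [uIcc_of_le hx.2, uIcc_of_le hℓ]; exact Icc_subset_Icc_left hx.1)).integral_deriv_eq_sub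
    have h2 : 0 ≤ ∫ t in x..ℓ, deriv (fun t => Real.exp (2 * C * t) * (f t * f t)) t := by
      rw [intervalIntegral.integral_of_le hx.2]
      refine integral_nonneg_of_ae (ae_restrict_of_ae_restrict_of_subset
        (t := Icc 0 ℓ) (fun t ht => ⟨hx.1.trans ht.1.le, ht.2⟩) ?_)
      filter_upwards [hder (2 * C), hC] with t ht hCt
      rw [ht]
      refine mul_nonneg (Real.exp_nonneg _) ?_
      have := abs_mul (f t) (deriv f t)
      have h3 := neg_abs_le (f t * deriv f t)
      have h4 := mul_le_mul_of_nonneg_left hCt (abs_nonneg (f t))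
      rw [show |f t| * (C * |f t|) = C * |f t| ^ 2 by ring, sq_abs] at h4
      linarith
    rw [h1, h0] at h2
    have := Real.exp_pos (2 * C * x)
    by_contra! hc
    nlinarith [mul_pos this hc]

/-! ### The calibrated energy of functions on the graph -/

namespace MetricGraph

variable {V B H : Type*} {G : MetricGraph V B H}

theorem H1.memH1On_bounded {u : B ⊕ H → ℝ → ℝ} (hu : u ∈ G.H1) (b : B) :
    MemH1On (Icc 0 (G.len b)) (u (Sum.inl b)) := hu.1 (Sum.inl b)

theorem H1.memH1On_halfLine {u : B ⊕ H → ℝ → ℝ} (hu : u ∈ G.H1) (h : H) :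
    MemH1On (Ici 0) (u (Sum.inr h)) := hu.1 (Sum.inr h)

theorem H1.integrableOn_pow {u : B ⊕ H → ℝ → ℝ} (hu : u ∈ G.H1) (b : B) (n : ℕ) :
    IntegrableOn (fun x => |u (Sum.inl b) x| ^ n) (Icc 0 (G.len b)) :=
  ((MemH1On.continuousOn (G.len_pos b).le (H1.memH1On_bounded hu b)).abs.pow
    n).integrableOn_compact isCompact_Icc

theorem H1.halfLine_bound {u : B ⊕ H → ℝ → ℝ} (hu : u ∈ G.H1) (h : H) {K x : ℝ} (hK : 0 ≤ K)
    (hx : 0 ≤ x) : K * u (Sum.inr h) x ^ 2 ≤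
      1 / 2 * (∫ t in Ici 0, |deriv (u (Sum.inr h)) t| ^ 2) +
        2 * K ^ 2 * ∫ t in Ici 0, |u (Sum.inr h) t| ^ 2 := by
  have := mul_sq_le_of_memH1On_Ici (H1.memH1On_halfLine hu h) (κ := 2 * K) (by linarith) hx
  linarith

/-- The maximum of `|u|` on the compact core is attained at the point `x₀` of the edge `b₀`. -/
def IsCoreMax (G : MetricGraph V B H) (u : B ⊕ H → ℝ → ℝ) (b₀ : B) (x₀ : ℝ) : Prop :=
  x₀ ∈ Icc 0 (G.len b₀) ∧
    ∀ b, ∀ x ∈ Icc 0 (G.len b), u (Sum.inl b) x ^ 2 ≤ u (Sum.inl b₀) x₀ ^ 2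

/-- The calibrated energy of a bounded edge. -/
theorem IsCoreMax.edge_eq {u : B ⊕ H → ℝ → ℝ} {b₀ : B} {x₀ : ℝ} (hm : G.IsCoreMax u b₀ x₀) (hu : u ∈ G.H1) (b : B) :
    2 * ∫ t in Icc 0 (G.len b), u (Sum.inl b) t ^ 2 *
        solitonWeight (u (Sum.inl b₀) x₀ ^ 2) (u (Sum.inl b) t ^ 2) ^ 2 =
      (u (Sum.inl b₀) x₀ ^ 2) ^ 2 / 6 * (∫ t in Icc 0 (G.len b), |u (Sum.inl b) t| ^ 2) -
        1 / 6 * ∫ t in Icc 0 (G.len b), |u (Sum.inl b) t| ^ 6 := by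
  rw [← integral_const_mul, ← integral_const_mul, ← integral_const_mul, ← integral_sub
    ((H1.integrableOn_pow hu b 2).const_mul _) ((H1.integrableOn_pow hu b 6).const_mul _)]
  refine setIntegral_congr_fun measurableSet_Icc fun t ht => ?_
  rw [solitonWeight_sq (sq_nonneg _) (hm.2 b t ht), sq_abs,
    show |u (Sum.inl b) t| ^ 6 = (|u (Sum.inl b) t| ^ 2) ^ 3 by ring, sq_abs]
  ring

variable [Fintype B]

theorem coreSextic_eq (u : B ⊕ H → ℝ → ℝ) : G.coreSextic u =
    ∑ b, ∫ x in Icc 0 (G.len b), |u (Sum.inl b) x| ^ 6 := rfl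

theorem coreSextic_nonneg (u : B ⊕ H → ℝ → ℝ) : 0 ≤ G.coreSextic u :=
  Finset.sum_nonneg fun _ _ => integral_nonneg fun _ => by positivity

theorem exists_isCoreMax (hB : Nonempty B) {u : B ⊕ H → ℝ → ℝ} (hu : u ∈ G.H1) :
    ∃ b₀ x₀, G.IsCoreMax u b₀ x₀ := by
  have h1 : ∀ b, ∃ x ∈ Icc 0 (G.len b), IsMaxOn (fun x => u (Sum.inl b) x ^ 2)
      (Icc 0 (G.len b)) x := fun b =>
    isCompact_Icc.exists_isMaxOn ⟨0, le_rfl, (G.len_pos b).le⟩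
      ((MemH1On.continuousOn (G.len_pos b).le (H1.memH1On_bounded hu b)).pow 2)
  choose X hX hm using h1
  obtain ⟨b₀, hb₀⟩ := Finite.exists_max fun b => u (Sum.inl b) (X b) ^ 2
  exact ⟨b₀, X b₀, hX b₀, fun b x hx => (hm b hx).trans (hb₀ b)⟩

variable [Fintype H]

theorem mass_eq (u : B ⊕ H → ℝ → ℝ) : G.mass u =
    (∑ b, ∫ x in Icc 0 (G.len b), |u (Sum.inl b) x| ^ 2) +
      ∑ h, ∫ x in Ici 0, |u (Sum.inr h) x| ^ 2 := Fintype.sum_sum_type _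

theorem kinetic_eq (u : B ⊕ H → ℝ → ℝ) : G.kinetic u =
    (∑ b, ∫ x in Icc 0 (G.len b), |deriv (u (Sum.inl b)) x| ^ 2) +
      ∑ h, ∫ x in Ici 0, |deriv (u (Sum.inr h)) x| ^ 2 := Fintype.sum_sum_type _

theorem mass_nonneg (u : B ⊕ H → ℝ → ℝ) : 0 ≤ G.mass u :=
  Finset.sum_nonneg fun _ _ => integral_nonneg fun _ => by positivity

theorem kinetic_nonneg (u : B ⊕ H → ℝ → ℝ) : 0 ≤ G.kinetic u :=
  Finset.sum_nonneg fun _ _ => integral_nonneg fun _ => by positivity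

/-- The basic inequality: levels of `primitive h (u ^ 2)` are taken at least `N` times. -/
theorem HasMultiplicity.mul_primitive_le {N : ℝ} (hN : G.HasMultiplicity N)
    {u : B ⊕ H → ℝ → ℝ} (hu : u ∈ G.H1) {b₀ : B} {x₀ : ℝ} (hm : G.IsCoreMax u b₀ x₀)
    {h : ℝ → ℝ} {K : ℝ} (hc : Continuous h) (h0 : ∀ r, 0 ≤ h r) (hK : ∀ r, |h r| ≤ K) :
    N * primitive h (u (Sum.inl b₀) x₀ ^ 2) ≤
      (∑ b, ∫ t in (0 : ℝ)..G.len b, |deriv (fun t => primitive h (u (Sum.inl b) t ^ 2)) t|) +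
      ∑ k, primitive h (u (Sum.inr k) 0 ^ 2) := by
  classical
  obtain ⟨w, hw, hwh⟩ := hu.2
  have hmono := primitive_monotone hc h0
  refine (hN (fun v => primitive h (w v ^ 2)) _ b₀
    (fun v => by rw [← primitive_zero h]; exact hmono (sq_nonneg _)) ?_ ?_).trans ?_
  · exact hmono (by rw [← (hw b₀).1]; exact hm.2 b₀ 0 ⟨le_rfl, (G.len_pos b₀).le⟩)
  · exact hmono (by rw [← (hw b₀).2]; exact hm.2 b₀ _ ⟨(G.len_pos b₀).le, le_rfl⟩)
  · simp only [← hwh]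
    refine add_le_add (Finset.sum_le_sum fun b _ => ?_) le_rfl
    have acg := absolutelyContinuous_primitive_sq (G.len_pos b).le (H1.memH1On_bounded hu b) hc hK
    rw [← (hw b).1, ← (hw b).2]
    split_ifs with hb
    · subst hb
      have := acg.sum_abs_sub_le hm.1.1 le_rfl hm.1.2
      simp only [sub_self, abs_zero, add_zero] at this
      refine le_trans (add_le_add (le_abs_self _) ?_) this
      rw [abs_sub_comm]
      exact le_abs_self _
    · rw [abs_sub_comm]
      exact acg.abs_sub_le (G.len_pos b).le

/-- The calibration with a constant weight `K`. The parameter is kept free; its best value gives the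
Gagliardo-Nirenberg bound `u⁴ ≤ 4 · mass · kinetic`. -/
theorem mul_sq_le_kinetic_add_mass (hN : G.HasMultiplicity 1) (hB : Nonempty B)
    {u : B ⊕ H → ℝ → ℝ} (hu : u ∈ G.H1) {K : ℝ} (hK : 0 ≤ K) (e : B ⊕ H) {x : ℝ}
    (hx : x ∈ G.interval e) :
    K * u e x ^ 2 ≤ 1 / 2 * G.kinetic u + 2 * K ^ 2 * G.mass u := by
  rcases e with b | h
  · obtain ⟨b₀, x₀, hm⟩ := exists_isCoreMax hB hu
    have hp : ∀ r, primitive (fun _ => K) r = K * r := fun r => by simp [primitive, mul_comm]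
    have h1 := hN.mul_primitive_le hu hm (h := fun _ => K) (K := K) continuous_const (fun _ => hK)
      (fun _ => (abs_of_nonneg hK).le)
    simp only [hp] at h1
    refine (mul_le_mul_of_nonneg_left (hm.2 b x hx) hK).trans ?_
    rw [one_mul] at h1
    refine h1.trans ?_
    rw [mass_eq, kinetic_eq, mul_add, mul_add, Finset.mul_sum, Finset.mul_sum, Finset.mul_sum,
      Finset.mul_sum, add_add_add_comm, ← Finset.sum_add_distrib, ← Finset.sum_add_distrib]
    refine add_le_add (Finset.sum_le_sum fun b _ => ?_) (Finset.sum_le_sum fun k _ =>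
      H1.halfLine_bound hu k hK le_rfl)
    have h2 := integral_abs_deriv_primitive_sq_le (G.len_pos b).le (H1.memH1On_bounded hu b)
      (h := fun _ => K) (K := K) continuous_const (fun _ => (abs_of_nonneg hK).le)
    simp only [hp] at h2
    refine h2.trans (le_of_eq ?_)
    rw [integral_mul_const]
    simp only [sq_abs]
    ring
  · refine (H1.halfLine_bound hu h hK hx).trans ?_
    have h1 : ∫ t in Ici 0, |deriv (u (Sum.inr h)) t| ^ 2 ≤ G.kinetic u :=
      Finset.single_le_sum (f := fun e => ∫ t in G.interval e, |deriv (u e) t| ^ 2)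
        (fun _ _ => integral_nonneg fun _ => by positivity) (Finset.mem_univ (Sum.inr h))
    have h2 : ∫ t in Ici 0, |u (Sum.inr h) t| ^ 2 ≤ G.mass u :=
      Finset.single_le_sum (f := fun e => ∫ t in G.interval e, |u e t| ^ 2)
        (fun _ _ => integral_nonneg fun _ => by positivity) (Finset.mem_univ (Sum.inr h))
    gcongr

theorem kinetic_pos (hN : G.HasMultiplicity 1) (hB : Nonempty B) {u : B ⊕ H → ℝ → ℝ}
    (hu : u ∈ G.H1) (hmass : 0 < G.mass u) : 0 < G.kinetic u := by
  refine (G.kinetic_nonneg u).lt_of_ne fun h0 => ?_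
  have hz : ∀ e, ∀ x ∈ G.interval e, u e x = 0 := by
    intro e x hx
    by_contra hne
    have hp : 0 < u e x ^ 2 := by positivity
    -- The optimal `K`: without kinetic energy it leaves `K u² ≤ K u² / 2`.
    have := mul_sq_le_kinetic_add_mass hN hB hu (K := u e x ^ 2 / (4 * G.mass u)) (by positivity)
      e hx
    rw [← h0] at this
    have h2 : 2 * (u e x ^ 2 / (4 * G.mass u)) ^ 2 * G.mass u =
        u e x ^ 2 / (4 * G.mass u) * u e x ^ 2 / 2 := by field_simp; ring
    have h3 : 0 < u e x ^ 2 / (4 * G.mass u) * u e x ^ 2 := by positivity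
    linarith
  refine hmass.ne' (Finset.sum_eq_zero fun e _ => ?_)
  refine (setIntegral_congr_fun ?_ fun x hx => ?_).trans (integral_zero _ _)
  · rcases e with b | h
    · exact measurableSet_Icc
    · exact measurableSet_Ici
  · simp [hz e x hx]

section Soliton

variable {N : ℝ} {u : B ⊕ H → ℝ → ℝ} {b₀ : B} {x₀ : ℝ}

/-- The slope `κ = c/(2√3)` on half-lines satisfies `2κ² = c²/6`, the coefficient that the soliton
weight produces on the core, so the two mass contributions merge. -/
theorem IsCoreMax.sum_calibrated (hm : G.IsCoreMax u b₀ x₀) (hu : u ∈ G.H1) :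
    (∑ b, (1 / 2 * (∫ t in Icc 0 (G.len b), |deriv (u (Sum.inl b)) t| ^ 2) +
      2 * ∫ t in Icc 0 (G.len b), u (Sum.inl b) t ^ 2 *
        solitonWeight (u (Sum.inl b₀) x₀ ^ 2) (u (Sum.inl b) t ^ 2) ^ 2)) +
      ∑ h, (1 / 2 * (∫ t in Ici 0, |deriv (u (Sum.inr h)) t| ^ 2) +
        2 * (u (Sum.inl b₀) x₀ ^ 2 / (2 * √3)) ^ 2 * ∫ t in Ici 0, |u (Sum.inr h) t| ^ 2) =
    G.energy u + (u (Sum.inl b₀) x₀ ^ 2) ^ 2 / 6 * G.mass u := by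
  have h3 : √3 ^ 2 = (3 : ℝ) := Real.sq_sqrt (by norm_num)
  rw [energy, mass_eq, kinetic_eq, coreSextic_eq]
  simp only [hm.edge_eq hu, Finset.sum_add_distrib, Finset.sum_sub_distrib, ← Finset.mul_sum]
  rw [div_pow, mul_pow, h3]
  ring

/-- The energy is positive at masses up to `N` times the critical mass of the half-line. -/
theorem HasMultiplicity.energy_pos (hN : G.HasMultiplicity N) (hconn : G.Connected)
    (hH : Nonempty H) (hB : Nonempty B) (hu : u ∈ G.H1) (h0 : 0 < G.mass u)
    (hmass : G.mass u ≤ N * criticalMassHalfLine) : 0 < G.energy u := by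
  obtain ⟨b₀, x₀, hm⟩ := exists_isCoreMax hB hu
  set c := u (Sum.inl b₀) x₀ ^ 2 with hcdef
  have hc : 0 ≤ c := sq_nonneg _
  have hT := kinetic_pos (hasMultiplicity_one hconn hH) hB hu h0
  rcases hc.eq_or_lt with hc0 | hcpos
  · have hS : G.coreSextic u = 0 := Finset.sum_eq_zero fun b _ => by
      refine (setIntegral_congr_fun measurableSet_Icc fun x hx => ?_).trans (integral_zero _ _)
      have := hm.2 b x hx
      rw [← hcdef, ← hc0] at this
      have h1 : u (Sum.inl b) x = 0 := by nlinarith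
      simp [h1]
    rw [energy, hS]
    linarith
  by_contra! hE
  have hcw := continuous_solitonWeight c
  have h1 := hN.mul_primitive_le hu hm hcw (solitonWeight_nonneg c) (abs_solitonWeight_le hc)
  rw [← hcdef, primitive_solitonWeight hc] at h1
  have h2 := hm.sum_calibrated hu
  rw [← hcdef] at h2
  have hkey : c ^ 2 / 6 * G.mass u ≤ c ^ 2 / 6 * (N * criticalMassHalfLine) := by gcongr
  have h3 := fun b => integral_abs_deriv_primitive_sq_le (G.len_pos b).le
    (H1.memH1On_bounded hu b) hcw (abs_solitonWeight_le hc)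
  have h4 := fun k => H1.halfLine_bound hu k (K := c / (2 * √3)) (by positivity) le_rfl
  have h4' := fun k => primitive_le hcw (abs_solitonWeight_le hc) (sq_nonneg (u (Sum.inr k) 0))
  have s3 := Finset.sum_le_sum fun b (_ : b ∈ Finset.univ) => h3 b
  have s4 := Finset.sum_le_sum fun k (_ : k ∈ Finset.univ) => h4 k
  have s4' := Finset.sum_le_sum fun k (_ : k ∈ Finset.univ) => h4' k
  -- With energy `≤ 0` the chain of inequalities begins and ends at `(c²/6) N μ_{R⁺}`, so each edge
  -- and each half-line gives equality.
  have e3 := (Finset.sum_eq_sum_iff_of_le fun b (_ : b ∈ Finset.univ) => h3 b).1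
    (le_antisymm s3 (by linarith))
  have e4 := (Finset.sum_eq_sum_iff_of_le fun k (_ : k ∈ Finset.univ) => h4' k).1
    (le_antisymm s4' (by linarith))
  obtain ⟨w, hw, hwh⟩ := hu.2
  obtain ⟨k⟩ := hH
  obtain ⟨l₀, hl₀⟩ := hconn.2 (G.root k) (G.src b₀)
  have hroot_le : w (G.root k) ^ 2 ≤ c := by
    obtain ⟨b, h | h⟩ := hconn.exists_incident hB (G.root k) <;> rw [h]
    · rw [← (hw b).1]; exact hm.2 b 0 ⟨le_rfl, (G.len_pos b).le⟩
    · rw [← (hw b).2]; exact hm.2 b _ ⟨(G.len_pos b).le, le_rfl⟩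
  -- Equality in the linear bound contradicts the strict sublinearity of the primitive at a nonzero
  -- root value.
  have hroot0 : w (G.root k) = 0 := by
    by_contra hne
    have hp : 0 < w (G.root k) ^ 2 := by positivity
    have := primitive_solitonWeight_lt hp hroot_le
    have e := e4 k (Finset.mem_univ k)
    rw [hwh k] at e
    linarith
  have hode : ∀ b, ∀ᵐ t ∂volume.restrict (Icc 0 (G.len b)),
      |deriv (u (Sum.inl b)) t| ≤ c / √3 * |u (Sum.inl b) t| := fun b => by
    filter_upwards [ae_abs_deriv_eq_of_le_integral (G.len_pos b).le (H1.memH1On_bounded hu b) hcw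
      (abs_solitonWeight_le hc) (solitonWeight_nonneg c) (e3 b (Finset.mem_univ b)).ge] with t ht
    rw [ht]
    have := mul_le_mul_of_nonneg_left (solitonWeight_le hc (u (Sum.inl b) t ^ 2))
      (abs_nonneg (u (Sum.inl b) t))
    have h5 : c / (2 * √3) = c / √3 / 2 := by rw [div_div, mul_comm]
    rw [h5] at this
    linarith
  have hzero : ∀ b, (w (G.src b) = 0 ∨ w (G.tgt b) = 0) → ∀ x ∈ Icc 0 (G.len b),
      u (Sum.inl b) x = 0 := fun b hb x hx =>
    eq_zero_of_ae_abs_deriv_le (H1.memH1On_bounded hu b) (hode b)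
      (by rwa [(hw b).1, (hw b).2]) hx
  -- By the differential inequality a zero at one end of an edge spreads over the edge;
  -- connectedness carries it from the root to `b₀`.
  have hsrc : w (G.src b₀) = 0 := by
    refine (hl₀.mem_iff_mem (R := {v | w v = 0}) fun b _ => ⟨fun h => ?_, fun h => ?_⟩).1 hroot0
    · rw [mem_ofPred_eq, ← (hw b).2]
      exact hzero b (Or.inl h) _ ⟨(G.len_pos b).le, le_rfl⟩
    · rw [mem_ofPred_eq, ← (hw b).1]
      exact hzero b (Or.inr h) _ ⟨le_rfl, (G.len_pos b).le⟩
  have := hzero b₀ (Or.inl hsrc) x₀ hm.1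
  rw [hcdef, this] at hcpos
  norm_num at hcpos

end Soliton

end MetricGraph

/-! ### Graphs without terminal edges -/

/-- The soliton weight, damped so that it vanishes below the level `β`. -/
noncomputable def dampedWeight (c β r : ℝ) : ℝ := (1 - β / max r β) * solitonWeight c r

section DampedWeight

variable {c β r : ℝ}

theorem div_max_mem_Icc (hβ : 0 ≤ β) (r : ℝ) : β / max r β ∈ Icc (0 : ℝ) 1 :=
  ⟨div_nonneg hβ (hβ.trans (le_max_right _ _)),
    div_le_one_of_le₀ (le_max_right _ _) (hβ.trans (le_max_right _ _))⟩

theorem continuous_div_max (hβ : 0 ≤ β) : Continuous fun r => β / max r β := by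
  rcases hβ.eq_or_lt with rfl | hβ
  · simp only [zero_div]; exact continuous_const
  · exact continuous_const.div (by fun_prop) fun r => (hβ.trans_le (le_max_right _ _)).ne'

theorem continuous_dampedWeight (hβ : 0 ≤ β) : Continuous (dampedWeight c β) :=
  (continuous_const.sub (continuous_div_max hβ)).mul (continuous_solitonWeight c)

theorem dampedWeight_nonneg (hβ : 0 ≤ β) (r : ℝ) : 0 ≤ dampedWeight c β r :=
  mul_nonneg (sub_nonneg.2 (div_max_mem_Icc hβ r).2) (solitonWeight_nonneg c r)

theorem abs_dampedWeight_le (hc : 0 ≤ c) (hβ : 0 ≤ β) (r : ℝ) :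
    |dampedWeight c β r| ≤ c / (2 * √3) := by
  rw [abs_of_nonneg (dampedWeight_nonneg hβ r)]
  refine (mul_le_of_le_one_left (solitonWeight_nonneg c r) ?_).trans (solitonWeight_le hc r)
  linarith [(div_max_mem_Icc hβ r).1]

theorem dampedWeight_eq_zero (hβ : 0 < β) (hr : r ≤ β) : dampedWeight c β r = 0 := by
  rw [dampedWeight, max_eq_right hr, div_self hβ.ne', sub_self, zero_mul]

theorem primitive_dampedWeight_eq_zero (hr : 0 ≤ r) (hrβ : r ≤ β) :
    primitive (dampedWeight c β) r = 0 := by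
  rcases hr.eq_or_lt with rfl | hr
  · simp
  refine (intervalIntegral.integral_congr fun t ht => ?_).trans intervalIntegral.integral_zero
  rw [uIcc_of_le hr.le] at ht
  exact dampedWeight_eq_zero (hr.trans_le hrβ) (ht.2.trans hrβ)

/-- Since `r(1 - β/r)² ≤ r - β` for `r > β`, the leading coefficient `c²/6` multiplies only the
excess of `r` over `β`. Where `r ≥ β` this saves `c²β/6` per unit length; the remaining terms are of
lower order in `c`. -/
theorem dampedWeight_sq_le (hβ : 0 ≤ β) (hβc : β ≤ c) (hr : 0 ≤ r) (hrc : r ≤ c) :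
    2 * (r * dampedWeight c β r ^ 2) ≤
      (c ^ 2 + c * β + β ^ 2) / 6 * (max r β - β) - r ^ 3 / 6 + β ^ 2 / 6 * r := by
  rcases le_or_gt r β with h | h
  · rw [max_eq_right h, sub_self]
    have h1 : r * dampedWeight c β r ^ 2 = 0 := by
      rcases hβ.eq_or_lt with rfl | hβ
      · rw [le_antisymm h hr, zero_mul]
      · rw [dampedWeight_eq_zero hβ h]; ring
    rw [h1]
    nlinarith [mul_nonneg hr (mul_nonneg (sub_nonneg.2 h) (add_nonneg hr hβ))]
  · have hr0 : 0 < r := hβ.trans_lt h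
    rw [dampedWeight, max_eq_left h.le, mul_pow, solitonWeight_sq hr hrc]
    have h1 : r * (1 - β / r) ^ 2 ≤ r - β := by
      have : r * (1 - β / r) ^ 2 = (r - β) ^ 2 / r := by field_simp
      rw [this, div_le_iff₀ hr0]
      nlinarith
    have h2 : 0 ≤ c ^ 2 - r ^ 2 := by nlinarith
    have h3 := mul_le_mul_of_nonneg_right h1 h2
    nlinarith [mul_nonneg (mul_nonneg (sub_nonneg.2 h.le) hβ) (sub_nonneg.2 hrc),
      mul_nonneg (mul_nonneg hβ hβ) (sub_nonneg.2 h.le)]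

theorem integral_div_max_le (hβ : 0 ≤ β) (hβc : β ≤ c) :
    ∫ r in (0 : ℝ)..c, β / max r β ≤ β + β * Real.log (c / β) := by
  rcases hβ.eq_or_lt with rfl | hβ
  · simp
  have hcont := continuous_div_max hβ.le
  rw [← intervalIntegral.integral_add_adjacent_intervals (hcont.intervalIntegrable 0 β)
    (hcont.intervalIntegrable β c)]
  have h1 : ∫ r in (0 : ℝ)..β, β / max r β = β := by
    rw [intervalIntegral.integral_congr (g := fun _ => (1 : ℝ)) fun t ht => ?_]
    · simp
    · rw [uIcc_of_le hβ.le] at ht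
      simp only [max_eq_right ht.2, div_self hβ.ne']
  have h2 : ∫ r in β..c, β / max r β = β * Real.log (c / β) := by
    rw [intervalIntegral.integral_congr (g := fun r => β * r⁻¹) fun t ht => ?_]
    · rw [intervalIntegral.integral_const_mul, integral_inv_of_pos hβ (by linarith)]
    · rw [uIcc_of_le hβc] at ht
      simp only [max_eq_left ht.1, div_eq_mul_inv]
  rw [h1, h2]

/-- The loss from damping is at most the maximal slope `c/(2√3)` times the integral of `β / max r
β`, which grows only logarithmically in `c/β`. -/
theorem primitive_dampedWeight_ge (hβ : 0 ≤ β) (hβc : β ≤ c) :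
    c ^ 2 / 6 * criticalMassHalfLine - c / (2 * √3) * (β + β * Real.log (c / β)) ≤
      primitive (dampedWeight c β) c := by
  have hc : 0 ≤ c := hβ.trans hβc
  rw [← primitive_solitonWeight hc]
  have h1 : ∫ r in (0 : ℝ)..c, (solitonWeight c r - c / (2 * √3) * (β / max r β)) ≤
      ∫ r in (0 : ℝ)..c, dampedWeight c β r := by
    refine intervalIntegral.integral_mono_on hc ?_
      ((continuous_dampedWeight hβ).intervalIntegrable _ _) fun r _ => ?_
    · exact ((continuous_solitonWeight c).sub
        (continuous_const.mul (continuous_div_max hβ))).intervalIntegrable _ _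
    · unfold dampedWeight
      nlinarith [mul_le_mul_of_nonneg_right (solitonWeight_le hc r) (div_max_mem_Icc hβ r).1]
  rw [intervalIntegral.integral_sub ((continuous_solitonWeight c).intervalIntegrable _ _)
    (((continuous_div_max hβ).intervalIntegrable _ _).const_mul _),
    intervalIntegral.integral_const_mul] at h1
  have h2 := mul_le_mul_of_nonneg_left (integral_div_max_le hβ hβc)
    (show 0 ≤ c / (2 * √3) by positivity)
  unfold primitive
  linarith

end DampedWeight

/-- As `log c = o(c)`, the gain `c²βℓ/6` absorbs the logarithmic loss and the lower-order potential
terms. The slack `δ` makes this uniform as `β → 0`, where `log(c/β)` is unbounded. -/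
theorem exists_forall_log_loss_le {ℓ μ δ : ℝ} (hℓ : 0 < ℓ) (hμ : 0 < μ) (hδ : 0 < δ) :
    ∃ R, ∀ c β : ℝ, R ≤ c → 0 ≤ β → β ≤ c → β * ℓ ≤ μ →
      c / √3 * (β + β * Real.log (c / β)) + (c * β + 2 * β ^ 2) / 6 * μ ≤
        c ^ 2 / 6 * (β * ℓ) + δ := by
  have hlog := (Real.isLittleO_log_id_atTop.bound (show 0 < ℓ / 48 by positivity))
  have ev : ∀ᶠ c : ℝ in atTop, 1 ≤ c ∧ δ ≤ c ∧ |Real.log c| ≤ ℓ / 48 * c ∧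
      (1 + |Real.log δ| + μ / 6) ≤ ℓ / 24 * c ∧ 2 * (μ / ℓ) * μ / 6 ≤ ℓ / 24 * c := by
    filter_upwards [hlog, eventually_ge_atTop 1, eventually_ge_atTop δ,
      eventually_ge_atTop ((1 + |Real.log δ| + μ / 6) / (ℓ / 24)),
      eventually_ge_atTop (2 * (μ / ℓ) * μ / 6 / (ℓ / 24))] with c h1 h2 h3 h4 h5
    refine ⟨h2, h3, ?_, ?_, ?_⟩
    · simpa [Real.norm_eq_abs, abs_of_nonneg (zero_le_one.trans h2)] using h1
    · rw [div_le_iff₀ (by positivity)] at h4; linarith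
    · rw [div_le_iff₀ (by positivity)] at h5; linarith
  obtain ⟨R, hR⟩ := eventually_atTop.1 ev
  refine ⟨R, fun c β hc hβ hβc hβℓ => ?_⟩
  obtain ⟨h1, hδc, h2, h3, h4⟩ := hR c hc
  have hc0 : 0 < c := by linarith
  have hs : (1 : ℝ) ≤ √3 := by rw [Real.one_le_sqrt]; norm_num
  have hβμ : β ≤ μ / ℓ := by rwa [le_div_iff₀ hℓ]
  have hlogK : Real.log (c ^ 2 / δ) ≤ ℓ / 24 * c + |Real.log δ| := by
    rw [Real.log_div (by positivity) hδ.ne', Real.log_pow]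
    have := neg_abs_le (Real.log δ)
    have := le_abs_self (Real.log c)
    push_cast
    linarith
  have hlogK0 : 0 ≤ Real.log (c ^ 2 / δ) := Real.log_nonneg (by
    rw [le_div_iff₀ hδ]; nlinarith)
  -- Factor `c/β = (δ/(cβ)) · (c²/δ)`: by `log x ≤ x` the first factor costs at most `δ/c`, and the
  -- second no longer involves `β`.
  have hsplit : β * Real.log (c / β) ≤ δ / c + β * Real.log (c ^ 2 / δ) := by
    rcases hβ.eq_or_lt with rfl | hβ
    · simp; positivity
    have e : c / β = (δ / (c * β)) * (c ^ 2 / δ) := by field_simp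
    rw [e, Real.log_mul (by positivity) (by positivity), mul_add]
    have h5 : β * Real.log (δ / (c * β)) ≤ β * (δ / (c * β)) := by
      gcongr
      exact (Real.log_le_sub_one_of_pos (by positivity)).trans (by linarith)
    have h6 : β * (δ / (c * β)) = δ / c := by field_simp
    linarith
  have h7 : c / √3 * (β + β * Real.log (c / β)) ≤
      c * (β + (δ / c + β * Real.log (c ^ 2 / δ))) := by
    have hnn : 0 ≤ β + (δ / c + β * Real.log (c ^ 2 / δ)) := by positivity
    calc c / √3 * (β + β * Real.log (c / β))
        ≤ c / √3 * (β + (δ / c + β * Real.log (c ^ 2 / δ))) := by gcongr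
      _ ≤ c * (β + (δ / c + β * Real.log (c ^ 2 / δ))) := by
        gcongr
        exact div_le_self hc0.le hs
  have h8 : c * (δ / c) = δ := by field_simp
  have h9 : c * (β * Real.log (c ^ 2 / δ)) ≤ c * (β * (ℓ / 24 * c + |Real.log δ|)) := by gcongr
  have h10 : β ^ 2 * μ ≤ β * (μ / ℓ) * μ := by
    rw [sq]; gcongr
  have h11 := mul_le_mul_of_nonneg_left h3 (mul_nonneg hc0.le hβ)
  have h12 := mul_le_mul_of_nonneg_left h4 hβ
  have h13 : β * (ℓ / 24 * c) ≤ c * β * (ℓ / 24 * c) := by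
    have : 0 ≤ β * (ℓ / 24 * c) := by positivity
    nlinarith
  have h14 : 0 ≤ c * β * (ℓ * c) := by positivity
  nlinarith

/-! ### Two crossings of each damped level, and high peaks -/

namespace MetricGraph

variable {V B H : Type*} {G : MetricGraph V B H}

theorem exists_other_of_not_hasTerminalEdge (hG : ¬ G.HasTerminalEdge) {b₀ : B} {v : V}
    (hv : G.src b₀ = v ∨ G.tgt b₀ = v) :
    (G.src b₀ = v ∧ G.tgt b₀ = v) ∨ (∃ b, b ≠ b₀ ∧ (G.src b = v ∨ G.tgt b = v)) ∨
      ∃ h, G.root h = v := by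
  by_contra! hne
  obtain ⟨h1, h2, h3⟩ := hne
  refine hG ⟨Sum.inl b₀, v, hv, ?_⟩
  have e3 : Nat.card {h : H // G.root h = v} = 0 := by
    have : IsEmpty {h : H // G.root h = v} := ⟨fun h => h3 h.1 h.2⟩
    exact Nat.card_of_isEmpty
  rcases hv with hv | hv
  · have e1 : Nat.card {b : B // G.src b = v} = 1 := by
      have : Unique {b : B // G.src b = v} := ⟨⟨⟨b₀, hv⟩⟩, fun b => Subtype.ext (by
        by_contra hb; exact (h2 b.1 hb).1 b.2)⟩
      exact Nat.card_unique
    have e2 : Nat.card {b : B // G.tgt b = v} = 0 := by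
      have : IsEmpty {b : B // G.tgt b = v} := ⟨fun b => by
        by_cases hb : b.1 = b₀
        · exact h1 hv (hb ▸ b.2)
        · exact (h2 b.1 hb).2 b.2⟩
      exact Nat.card_of_isEmpty
    rw [degree, e1, e2, e3]
  · have e1 : Nat.card {b : B // G.tgt b = v} = 1 := by
      have : Unique {b : B // G.tgt b = v} := ⟨⟨⟨b₀, hv⟩⟩, fun b => Subtype.ext (by
        by_contra hb; exact (h2 b.1 hb).2 b.2)⟩
      exact Nat.card_unique
    have e2 : Nat.card {b : B // G.src b = v} = 0 := by
      have : IsEmpty {b : B // G.src b = v} := ⟨fun b => by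
        by_cases hb : b.1 = b₀
        · exact h1 (hb ▸ b.2) hv
        · exact (h2 b.1 hb).1 b.2⟩
      exact Nat.card_of_isEmpty
    rw [degree, e1, e2, e3]

variable [Fintype B] [Fintype H]

/-- Without terminal edges, if `primitive h (u ^ 2)` vanishes somewhere on every bounded edge, then
its levels are taken at least twice. -/
theorem two_mul_primitive_le (hG : ¬ G.HasTerminalEdge)
    {u : B ⊕ H → ℝ → ℝ} (hu : u ∈ G.H1) {b₀ : B} {x₀ : ℝ} (hm : G.IsCoreMax u b₀ x₀)
    {h : ℝ → ℝ} {K : ℝ} (hc : Continuous h) (h0 : ∀ r, 0 ≤ h r) (hK : ∀ r, |h r| ≤ K)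
    (hz : ∀ b, ∃ x ∈ Icc 0 (G.len b), primitive h (u (Sum.inl b) x ^ 2) = 0) :
    2 * primitive h (u (Sum.inl b₀) x₀ ^ 2) ≤
      (∑ b, ∫ t in (0 : ℝ)..G.len b, |deriv (fun t => primitive h (u (Sum.inl b) t ^ 2)) t|) +
      ∑ k, primitive h (u (Sum.inr k) 0 ^ 2) := by
  classical
  obtain ⟨w, hw, hwh⟩ := hu.2
  set A : B → ℝ := fun b =>
    ∫ t in (0 : ℝ)..G.len b, |deriv (fun t => primitive h (u (Sum.inl b) t ^ 2)) t| with hA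
  set y : V → ℝ := fun v => primitive h (w v ^ 2) with hy
  set Y := primitive h (u (Sum.inl b₀) x₀ ^ 2) with hY
  have hmono := primitive_monotone hc h0
  have hnn : ∀ s, 0 ≤ primitive h (s ^ 2) := fun s => by
    rw [← primitive_zero h]; exact hmono (sq_nonneg _)
  have hy0 : ∀ v, 0 ≤ y v := fun v => hnn _
  have hA0 : ∀ b, 0 ≤ A b := fun b =>
    intervalIntegral.integral_nonneg (G.len_pos b).le fun _ _ => abs_nonneg _
  have hAosc : ∀ b x z, 0 ≤ x → x ≤ z → z ≤ G.len b →
      |primitive h (u (Sum.inl b) x ^ 2) - y (G.src b)| +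
      |primitive h (u (Sum.inl b) z ^ 2) - primitive h (u (Sum.inl b) x ^ 2)| +
      |y (G.tgt b) - primitive h (u (Sum.inl b) z ^ 2)| ≤ A b := fun b x z h1 h2 h3 => by
    have := (absolutelyContinuous_primitive_sq (G.len_pos b).le (H1.memH1On_bounded hu b)
      hc hK).sum_abs_sub_le h1 h2 h3
    simpa only [hy, ← (hw b).1, ← (hw b).2] using this
  -- An edge on which the function vanishes somewhere has variation at least its value at either
  -- end.
  have hend : ∀ b v, (G.src b = v ∨ G.tgt b = v) → y v ≤ A b := by
    intro b v hv
    obtain ⟨x, hx, hx0⟩ := hz b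
    have := hAosc b x x hx.1 le_rfl hx.2
    rw [hx0, sub_self, abs_zero, zero_sub, sub_zero, abs_neg, abs_of_nonneg (hy0 _),
      abs_of_nonneg (hy0 _)] at this
    have h1 := hy0 (G.src b)
    have h2 := hy0 (G.tgt b)
    rcases hv with rfl | rfl <;> linarith
  simp only [hwh]
  change 2 * Y ≤ (∑ b, A b) + ∑ k, y (G.root k)
  have hsumA : A b₀ ≤ ∑ b, A b := Finset.single_le_sum (fun b _ => hA0 b) (Finset.mem_univ b₀)
  have hsumH : 0 ≤ ∑ k, y (G.root k) := Finset.sum_nonneg fun k _ => hy0 _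
  -- one end of the edge `b₀` is compensated by another edge
  have hfin : ∀ v v', (G.src b₀ = v ∧ G.tgt b₀ = v' ∨ G.src b₀ = v' ∧ G.tgt b₀ = v) →
      2 * Y + y v' - y v ≤ A b₀ → 2 * Y ≤ (∑ b, A b) + ∑ k, y (G.root k) := by
    intro v v' hv hle
    have hv1 : G.src b₀ = v ∨ G.tgt b₀ = v := by tauto
    rcases exists_other_of_not_hasTerminalEdge hG hv1 with h1 | ⟨b, hb, hbv⟩ | ⟨k, hk⟩
    · have : v' = v := by
        rcases hv with hv | hv
        · rw [← hv.2, h1.2]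
        · rw [← hv.1, h1.1]
      rw [this] at hle
      linarith
    · have h2 := Finset.sum_le_sum_of_subset_of_nonneg (Finset.subset_univ {b, b₀}) (f := A)
        fun i _ _ => hA0 i
      rw [Finset.sum_pair hb] at h2
      linarith [hend b v hbv, hy0 v']
    · have h2 : y (G.root k) ≤ ∑ k, y (G.root k) :=
        Finset.single_le_sum (f := fun k => y (G.root k)) (fun k _ => hy0 _) (Finset.mem_univ k)
      rw [hk] at h2
      linarith [hy0 v']
  have hY0 : 0 ≤ Y := hnn _
  obtain ⟨x, hx, hx0⟩ := hz b₀
  -- On the side of `x₀` containing the zero, the function falls from `Y` to `0` and climbs to its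
  -- value at that end; on the other side only the drop from `Y` to the end value is counted.
  rcases le_total x x₀ with hxx | hxx
  · refine hfin (G.tgt b₀) (G.src b₀) (Or.inr ⟨rfl, rfl⟩) ?_
    have := hAosc b₀ x x₀ hx.1 hxx hm.1.2
    rw [hx0, zero_sub, abs_neg, sub_zero, abs_of_nonneg (hy0 _), ← hY, abs_of_nonneg hY0] at this
    linarith [neg_abs_le (y (G.tgt b₀) - Y)]
  · refine hfin (G.src b₀) (G.tgt b₀) (Or.inl ⟨rfl, rfl⟩) ?_
    have := hAosc b₀ x₀ x hm.1.1 hxx hx.2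
    rw [hx0, zero_sub, abs_neg, sub_zero, abs_of_nonneg (hy0 _), ← hY, abs_of_nonneg hY0] at this
    linarith [le_abs_self (Y - y (G.src b₀))]

/-- Without terminal edges, functions with a high peak on the core have almost nonnegative energy up
to the critical mass of the line. -/
theorem exists_forall_energy_ge (hG : ¬ G.HasTerminalEdge) (hB : Nonempty B) {δ : ℝ}
    (hδ : 0 < δ) : ∃ R, ∀ u ∈ G.H1, ∀ b₀ x₀, G.IsCoreMax u b₀ x₀ → G.mass u ≤ criticalMassLine →
      R ≤ u (Sum.inl b₀) x₀ ^ 2 →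
      (u (Sum.inl b₀) x₀ ^ 2) ^ 2 / 6 * (criticalMassLine - G.mass u) - δ ≤ G.energy u := by
  classical
  obtain ⟨bmin, hbmin⟩ := Finite.exists_min G.len
  have hμ : 0 < criticalMassLine := by unfold criticalMassLine; positivity
  obtain ⟨R, hR⟩ := exists_forall_log_loss_le (G.len_pos bmin) hμ hδ
  refine ⟨R, fun u hu b₀ x₀ hm hmass hRc => ?_⟩
  set c := u (Sum.inl b₀) x₀ ^ 2 with hcdef
  have hc : 0 ≤ c := sq_nonneg _
  have hmin : ∀ b, ∃ x ∈ Icc 0 (G.len b), IsMinOn (fun x => u (Sum.inl b) x ^ 2)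
      (Icc 0 (G.len b)) x := fun b =>
    isCompact_Icc.exists_isMinOn ⟨0, le_rfl, (G.len_pos b).le⟩
      ((MemH1On.continuousOn (G.len_pos b).le (H1.memH1On_bounded hu b)).pow 2)
  choose X hX hXm using hmin
  -- The largest edge minimum serves twice: the damped primitive vanishes somewhere on every bounded
  -- edge, while `u² ≥ β` on the whole of `b₁`.
  obtain ⟨b₁, hb₁⟩ := Finite.exists_max fun b => u (Sum.inl b) (X b) ^ 2
  set β := u (Sum.inl b₁) (X b₁) ^ 2 with hβdef
  have hβ : 0 ≤ β := sq_nonneg _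
  have hβc : β ≤ c := hm.2 b₁ _ (hX b₁)
  have hβle : ∀ x ∈ Icc 0 (G.len b₁), β ≤ u (Sum.inl b₁) x ^ 2 := fun x hx => hXm b₁ hx
  have hcw := continuous_dampedWeight (c := c) hβ
  have h1 := two_mul_primitive_le hG hu hm hcw (dampedWeight_nonneg hβ)
    (abs_dampedWeight_le hc hβ) fun b => ⟨X b, hX b,
      primitive_dampedWeight_eq_zero (sq_nonneg _) (hb₁ b)⟩
  have h2 := primitive_dampedWeight_ge hβ hβc
  rw [← hcdef] at h1
  set Mb : B → ℝ := fun b => ∫ t in Icc 0 (G.len b), |u (Sum.inl b) t| ^ 2 with hMb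
  have hMb0 : ∀ b, 0 ≤ Mb b := fun b => integral_nonneg fun t => by positivity
  have imax : ∀ b, IntegrableOn (fun t => max (u (Sum.inl b) t ^ 2) β - β) (Icc 0 (G.len b)) :=
    fun b => (ContinuousOn.sub (ContinuousOn.sup
      ((MemH1On.continuousOn (G.len_pos b).le (H1.memH1On_bounded hu b)).pow 2)
      continuousOn_const) continuousOn_const).integrableOn_compact isCompact_Icc
  -- The gain sits on `b₁`; the shortest length replaces that of `b₁` to keep the threshold `R`
  -- independent of `u`.
  have hexc : ∀ b, ∫ t in Icc 0 (G.len b), (max (u (Sum.inl b) t ^ 2) β - β) ≤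
      Mb b - if b = b₁ then β * G.len bmin else 0 := by
    intro b
    split_ifs with hb
    · subst hb
      have : ∫ t in Icc 0 (G.len b), (max (u (Sum.inl b) t ^ 2) β - β) =
          Mb b - β * G.len b := by
        have e1 : ∫ t in Icc 0 (G.len b), β = β * G.len b := by
          simp [(G.len_pos b).le, mul_comm]
        rw [← e1, hMb, ← integral_sub (H1.integrableOn_pow hu b 2) (by simp)]
        refine setIntegral_congr_fun measurableSet_Icc fun t ht => ?_
        simp only [max_eq_left (hβle t ht), sq_abs]
      rw [this]
      have := mul_le_mul_of_nonneg_left (hbmin b) hβ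
      linarith
    · rw [sub_zero]
      refine setIntegral_mono_on (imax b) (H1.integrableOn_pow hu b 2) measurableSet_Icc
        fun t _ => ?_
      rw [sq_abs]
      rcases max_cases (u (Sum.inl b) t ^ 2) β with h | h <;> nlinarith [sq_nonneg (u (Sum.inl b) t)]
  have hpot : ∀ b, 2 * ∫ t in Icc 0 (G.len b), u (Sum.inl b) t ^ 2 *
      dampedWeight c β (u (Sum.inl b) t ^ 2) ^ 2 ≤
      (c ^ 2 + c * β + β ^ 2) / 6 * (Mb b - if b = b₁ then β * G.len bmin else 0) -
      1 / 6 * (∫ t in Icc 0 (G.len b), |u (Sum.inl b) t| ^ 6) + β ^ 2 / 6 * Mb b := by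
    intro b
    have i2 := (H1.integrableOn_pow hu b 2).const_mul (β ^ 2 / 6)
    have i6 := (H1.integrableOn_pow hu b 6).const_mul (1 / 6)
    have im := (imax b).const_mul ((c ^ 2 + c * β + β ^ 2) / 6)
    have step : ∫ t in Icc 0 (G.len b), 2 * (u (Sum.inl b) t ^ 2 *
        dampedWeight c β (u (Sum.inl b) t ^ 2) ^ 2) ≤
        ∫ t in Icc 0 (G.len b), ((c ^ 2 + c * β + β ^ 2) / 6 * (max (u (Sum.inl b) t ^ 2) β - β) -
          1 / 6 * |u (Sum.inl b) t| ^ 6 + β ^ 2 / 6 * |u (Sum.inl b) t| ^ 2) := by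
      refine setIntegral_mono_on
        ((integrableOn_sq_mul_sq (G.len_pos b).le (H1.memH1On_bounded hu b) hcw).const_mul 2)
        ((im.sub i6).add i2) measurableSet_Icc fun t ht => ?_
      have := dampedWeight_sq_le hβ hβc (sq_nonneg (u (Sum.inl b) t)) (hm.2 b t ht)
      rw [sq_abs, show |u (Sum.inl b) t| ^ 6 = (|u (Sum.inl b) t| ^ 2) ^ 3 by ring, sq_abs]
      linarith
    rw [integral_const_mul, integral_add (f := fun t => (c ^ 2 + c * β + β ^ 2) / 6 *
      (max (u (Sum.inl b) t ^ 2) β - β) - 1 / 6 * |u (Sum.inl b) t| ^ 6) (im.sub i6) i2,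
      integral_sub im i6, integral_const_mul, integral_const_mul, integral_const_mul] at step
    refine step.trans ?_
    gcongr
    exact hexc b
  have h3 := Finset.sum_le_sum fun b (_ : b ∈ Finset.univ) =>
    (integral_abs_deriv_primitive_sq_le (G.len_pos b).le (H1.memH1On_bounded hu b) hcw
      (abs_dampedWeight_le hc hβ)).trans (add_le_add le_rfl (hpot b))
  have h4 := Finset.sum_le_sum fun k (_ : k ∈ Finset.univ) =>
    (primitive_le hcw (abs_dampedWeight_le hc hβ) (sq_nonneg (u (Sum.inr k) 0))).trans
      (H1.halfLine_bound hu k (by positivity) le_rfl)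
  simp only [Finset.sum_add_distrib, Finset.sum_sub_distrib, ← Finset.mul_sum,
    Finset.sum_ite_eq', Finset.mem_univ, if_true] at h3 h4
  have hs3 : √3 ^ 2 = (3 : ℝ) := Real.sq_sqrt (by norm_num)
  rw [div_pow, mul_pow, hs3] at h4
  have hM := mass_eq (G := G) u
  have hT := kinetic_eq (G := G) u
  have hS := coreSextic_eq (G := G) u
  set MB := ∑ b, Mb b with hMB
  change G.mass u = MB + _ at hM
  set MH := ∑ h : H, ∫ x in Ici 0, |u (Sum.inr h) x| ^ 2 with hMH
  have hMH0 : 0 ≤ MH := Finset.sum_nonneg fun k _ => integral_nonneg fun t => by positivity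
  have hβℓ : β * G.len bmin ≤ MB := by
    have h5 := hexc b₁
    rw [if_pos rfl] at h5
    have h6 : 0 ≤ ∫ t in Icc 0 (G.len b₁), (max (u (Sum.inl b₁) t ^ 2) β - β) :=
      integral_nonneg fun t => sub_nonneg.2 (le_max_right _ _)
    linarith [Finset.single_le_sum (fun b _ => hMb0 b) (Finset.mem_univ b₁)]
  have hloss := hR c β hRc hβ hβc (by linarith)
  have hline : criticalMassLine = 2 * criticalMassHalfLine := by
    unfold criticalMassHalfLine; ring
  have h7 : c / (2 * √3) = c / √3 / 2 := by rw [div_div, mul_comm 2 √3]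
  rw [h7] at h2
  rw [energy, hT, hS]
  have h8 : (c * β + β ^ 2) / 6 * (MB - β * G.len bmin) + β ^ 2 / 6 * MB ≤
      (c * β + 2 * β ^ 2) / 6 * criticalMassLine := by
    have h9 : MB ≤ criticalMassLine := by linarith
    have h10 : 0 ≤ β * G.len bmin := mul_nonneg hβ (G.len_pos bmin).le
    have h11 : (c * β + β ^ 2) / 6 * (MB - β * G.len bmin) ≤
        (c * β + β ^ 2) / 6 * criticalMassLine := by
      gcongr
      linarith
    have h12 : β ^ 2 / 6 * MB ≤ β ^ 2 / 6 * criticalMassLine := by gcongr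
    linarith
  rw [hline] at h8 hloss ⊢
  rw [hM]
  linarith

end MetricGraph

/-! ### Compactness -/

theorem Ultrafilter.exists_tendsto_of_abs_le {ι : Type*} (𝒰 : Ultrafilter ι) {a : ι → ℝ} {A : ℝ}
    (ha : ∀ i, |a i| ≤ A) : ∃ l, Tendsto a 𝒰 (𝓝 l) := by
  obtain ⟨l, -, hl⟩ := (isCompact_Icc (a := -A) (b := A)).ultrafilter_le_nhds (𝒰.map a)
    (le_principal_iff.2 (Filter.mem_map.2 (Filter.univ_mem' fun i => abs_le.1 (ha i))))
  exact ⟨l, hl⟩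

open scoped InnerProductSpace in
/-- Bounded families in a Hilbert space converge weakly along ultrafilters. -/
theorem Ultrafilter.exists_weak_limit {ι E : Type*} [NormedAddCommGroup E] [InnerProductSpace ℝ E]
    [CompleteSpace E] (𝒰 : Ultrafilter ι) {F : ι → E} {A : ℝ} (hF : ∀ i, ‖F i‖ ≤ A) :
    ∃ g : E, ∀ ψ, Tendsto (fun i => ⟪F i, ψ⟫_ℝ) 𝒰 (𝓝 ⟪g, ψ⟫_ℝ) := by
  let Φ : ι → WeakDual ℝ E := fun i => StrongDual.toWeakDual (InnerProductSpace.toDual ℝ E (F i))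
  obtain ⟨L, -, hL⟩ := (WeakDual.isCompact_closedBall (𝕜 := ℝ) (E := E) 0 A).ultrafilter_le_nhds
    (𝒰.map Φ) (le_principal_iff.2 (Filter.mem_map.2 (Filter.univ_mem' fun i => by
      rw [mem_preimage, mem_preimage, mem_closedBall_zero_iff]
      exact ((InnerProductSpace.toDual ℝ E).norm_map (F i)).trans_le (hF i))))
  refine ⟨(InnerProductSpace.toDual ℝ E).symm (WeakDual.toStrongDual L), fun ψ => ?_⟩
  have h1 : Tendsto Φ 𝒰 (𝓝 L) := hL
  have h2 := ((WeakDual.eval_continuous ψ).tendsto L).comp h1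
  rw [InnerProductSpace.toDual_symm_apply]
  simpa [Φ, Function.comp_def] using h2

/-- Hölder continuity of functions with square integrable derivative. -/
theorem sq_sub_le_of_memH1On {f : ℝ → ℝ} {ℓ x y : ℝ} (hf : MetricGraph.MemH1On (Icc 0 ℓ) f)
    (hx : 0 ≤ x) (hxy : x ≤ y) (hy : y ≤ ℓ) :
    (f y - f x) ^ 2 ≤ (y - x) * ∫ t in Icc 0 ℓ, |deriv f t| ^ 2 := by
  rcases hxy.eq_or_lt with rfl | hlt
  · simp
  have ac : AbsolutelyContinuousOnInterval f x y :=
    (hf.1 y ⟨hx.trans hxy, hy⟩).mono (by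
      rw [uIcc_of_le hxy, uIcc_of_le (hx.trans hxy)]; exact Icc_subset_Icc_left hx)
  set D := f y - f x with hD
  -- Cauchy-Schwarz by expanding `∫ (f' - m)² ≥ 0` at the mean slope `m`.
  set m := D / (y - x) with hm
  have hsub : Ioc x y ⊆ Icc 0 ℓ := fun t ht => ⟨hx.trans ht.1.le, ht.2.trans hy⟩
  have i2 := (MemH1On.integrable_deriv_sq hf).mono_set hsub
  have i1 : IntegrableOn (deriv f) (Ioc x y) :=
    (intervalIntegrable_iff_integrableOn_Ioc_of_le hxy).1 ac.intervalIntegrable_deriv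
  have e1 : ∫ t in Ioc x y, deriv f t = D := by
    rw [← intervalIntegral.integral_of_le hxy, ac.integral_deriv_eq_sub]
  have h0 : 0 ≤ ∫ t in Ioc x y, ((|deriv f t| ^ 2 - 2 * m * deriv f t) + m ^ 2) :=
    integral_nonneg fun t => by
      simp only [Pi.zero_apply, sq_abs]
      nlinarith [sq_nonneg (deriv f t - m)]
  have i3 : Integrable (fun t => |deriv f t| ^ 2 - 2 * m * deriv f t) (volume.restrict (Ioc x y)) :=
    i2.sub (i1.const_mul _)
  rw [integral_add i3 (by simp), integral_sub i2 (i1.const_mul _),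
    integral_const_mul, e1] at h0
  have e2 : ∫ _t in Ioc x y, m ^ 2 = (y - x) * m ^ 2 := by simp [hxy]
  rw [e2] at h0
  have h1 : ∫ t in Ioc x y, |deriv f t| ^ 2 ≤ ∫ t in Icc 0 ℓ, |deriv f t| ^ 2 :=
    setIntegral_mono_set (MemH1On.integrable_deriv_sq hf)
      (ae_of_all _ fun t => by simp only [Pi.zero_apply]; positivity) hsub.eventuallyLE
  have hpos : 0 < y - x := sub_pos.2 hlt
  have h2 : (y - x) * m ^ 2 = m * D := by rw [hm]; field_simp
  have h3 : D ^ 2 = (y - x) * (m * D) := by rw [hm]; field_simp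
  rw [h3]
  gcongr
  linarith

/-- Pointwise convergence of functions with bounded derivatives in `L²` implies convergence of the
integrals of their powers, along any filter. -/
theorem tendsto_integral_abs_pow {ι : Type*} {𝓕 : Filter ι} {f : ι → ℝ → ℝ} {g : ℝ → ℝ}
    {ℓ A R : ℝ} (hℓ : 0 ≤ ℓ) (hf : ∀ i, MetricGraph.MemH1On (Icc 0 ℓ) (f i))
    (hg : MetricGraph.MemH1On (Icc 0 ℓ) g)
    (hA : ∀ i, ∫ t in Icc 0 ℓ, |deriv (f i) t| ^ 2 ≤ A) (hR : ∀ i, ∀ x ∈ Icc 0 ℓ, |f i x| ≤ R)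
    (hlim : ∀ x ∈ Icc 0 ℓ, Tendsto (fun i => f i x) 𝓕 (𝓝 (g x))) (n : ℕ) :
    Tendsto (fun i => ∫ t in Icc 0 ℓ, |f i t| ^ n) 𝓕 (𝓝 (∫ t in Icc 0 ℓ, |g t| ^ n)) := by
  let F : ι → Icc 0 ℓ → ℝ := fun i x => |f i x| ^ n
  -- The Hölder bound makes the family equicontinuous on a compact interval, so pointwise
  -- convergence along the filter is uniform.
  have hequi : Equicontinuous F := by
    refine Metric.equicontinuous_of_continuity_modulus
      (fun t => √(t * A) * n * R ^ (n - 1)) ?_ F fun x y i => ?_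
    · have : Continuous fun t : ℝ => √(t * A) * n * R ^ (n - 1) := by fun_prop
      simpa using this.tendsto 0
    · have hR0 : 0 ≤ R := (abs_nonneg _).trans (hR i x x.2)
      have hosc : |f i x - f i y| ≤ √(dist x y * A) := by
        refine Real.abs_le_sqrt ?_
        rw [Subtype.dist_eq, Real.dist_eq]
        rcases le_total (x : ℝ) y with h | h
        · rw [abs_of_nonpos (sub_nonpos.2 h)]
          have := sq_sub_le_of_memH1On (hf i) x.2.1 h y.2.2
          have h2 := mul_le_mul_of_nonneg_left (hA i) (sub_nonneg.2 h)
          nlinarith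
        · rw [abs_of_nonneg (sub_nonneg.2 h)]
          have := sq_sub_le_of_memH1On (hf i) y.2.1 h x.2.2
          have h2 := mul_le_mul_of_nonneg_left (hA i) (sub_nonneg.2 h)
          nlinarith
      rw [Real.dist_eq]
      refine (abs_pow_sub_pow_le _ _ n).trans ?_
      gcongr
      · exact (abs_abs_sub_abs_le_abs_sub _ _).trans hosc
      · rw [abs_abs, abs_abs]
        exact max_le (hR i x x.2) (hR i y y.2)
  have hpt : Tendsto F 𝓕 (𝓝 fun x => |g x| ^ n) :=
    tendsto_pi_nhds.2 fun x => ((hlim x x.2).abs).pow n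
  have hunif := (hequi.tendsto_uniformFun_iff_pi 𝓕 _).2 hpt
  rw [UniformFun.tendsto_iff_tendstoUniformly, Metric.tendstoUniformly_iff] at hunif
  rw [Metric.tendsto_nhds]
  intro ε hε
  filter_upwards [hunif (ε / (ℓ + 1)) (by positivity)] with i hi
  have ci : ∀ {φ : ℝ → ℝ}, MetricGraph.MemH1On (Icc 0 ℓ) φ →
      IntegrableOn (fun t => |φ t| ^ n) (Icc 0 ℓ) := fun hφ =>
    ((MemH1On.continuousOn hℓ hφ).abs.pow n).integrableOn_compact isCompact_Icc
  rw [Real.dist_eq, ← integral_sub (ci (hf i)) (ci hg)]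
  have hb : ‖∫ t in Icc 0 ℓ, (|f i t| ^ n - |g t| ^ n)‖ ≤
      ε / (ℓ + 1) * volume.real (Icc (0 : ℝ) ℓ) :=
    norm_setIntegral_le_of_norm_le_const (by simp) fun t ht => by
      have := hi ⟨t, ht⟩
      rw [dist_comm, Real.dist_eq] at this
      exact this.le
  rw [Real.norm_eq_abs, Real.volume_real_Icc_of_le hℓ, sub_zero] at hb
  refine hb.trans_lt ?_
  rw [div_mul_eq_mul_div, div_lt_iff₀ (by linarith)]
  nlinarith

/-- Weak compactness on a bounded edge. -/
theorem Ultrafilter.exists_memH1On_limit {ι : Type*} (𝒰 : Ultrafilter ι) {f : ι → ℝ → ℝ}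
    {ℓ A T c : ℝ} (hℓ : 0 ≤ ℓ) (hf : ∀ i, MetricGraph.MemH1On (Icc 0 ℓ) (f i))
    (hA : ∀ i, ∫ t in Icc 0 ℓ, |deriv (f i) t| ^ 2 ≤ A)
    (hc : Tendsto (fun i => f i 0) 𝒰 (𝓝 c))
    (hT : Tendsto (fun i => ∫ t in Icc 0 ℓ, |deriv (f i) t| ^ 2) 𝒰 (𝓝 T)) :
    ∃ g, MetricGraph.MemH1On (Icc 0 ℓ) g ∧ (∫ t in Icc 0 ℓ, |deriv g t| ^ 2) ≤ T ∧
      ∀ x ∈ Icc 0 ℓ, Tendsto (fun i => f i x) 𝒰 (𝓝 (g x)) := by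
  set ν : Measure ℝ := volume.restrict (Icc 0 ℓ) with hν
  let F : ι → Lp ℝ 2 ν := fun i => (hf i).2.2.toLp
  have hFn : ∀ i, ‖F i‖ ^ 2 = ∫ t in Icc 0 ℓ, |deriv (f i) t| ^ 2 := fun i => by
    rw [← real_inner_self_eq_norm_sq, L2.inner_def]
    refine integral_congr_ae ?_
    filter_upwards [(hf i).2.2.coeFn_toLp] with t ht
    simp only [F, ht, sq_abs]
    simp [sq]
  have hA0 : ∀ i, ‖F i‖ ≤ √A := fun i => Real.le_sqrt_of_sq_le ((hFn i).trans_le (hA i))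
  obtain ⟨g₀, hg₀⟩ := 𝒰.exists_weak_limit hA0
  have hg₀int : IntervalIntegrable g₀ volume 0 ℓ := by
    rw [intervalIntegrable_iff_integrableOn_Icc_of_le hℓ]
    exact (Lp.memLp g₀).integrable one_le_two
  -- Weak lower semicontinuity, from the limit of `‖F i - g₀‖² ≥ 0`.
  have hg₀T : ‖g₀‖ ^ 2 ≤ T := by
    have h1 : Tendsto (fun i => ‖F i‖ ^ 2 - 2 * inner ℝ (F i) g₀ + ‖g₀‖ ^ 2) 𝒰
        (𝓝 (T - 2 * inner ℝ g₀ g₀ + ‖g₀‖ ^ 2)) := by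
      simp only [hFn]
      exact (hT.sub ((hg₀ g₀).const_mul 2)).add tendsto_const_nhds
    have h2 := ge_of_tendsto' h1 (b := 0) fun i => by
      rw [← norm_sub_sq_real]; positivity
    rw [real_inner_self_eq_norm_sq] at h2
    linarith
  set g : ℝ → ℝ := fun x => c + ∫ t in (0 : ℝ)..x, g₀ t with hg
  have hacg : AbsolutelyContinuousOnInterval g 0 ℓ :=
    AbsolutelyContinuousOnInterval.add (f := fun _ => c)
      (ContDiffOn.absolutelyContinuousOnInterval contDiffOn_const)
      (hg₀int.absolutelyContinuousOnInterval_intervalIntegral (by simp))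
  have hderiv : deriv g =ᵐ[ν] g₀ := by
    filter_upwards [ae_restrict_of_ae hg₀int.ae_hasDerivAt_integral,
      ae_restrict_mem measurableSet_Icc] with x hx hxm
    rw [uIcc_of_le hℓ] at hx
    exact ((hx hxm 0 ⟨le_rfl, hℓ⟩).const_add c).deriv
  have hcont : ContinuousOn g (Icc 0 ℓ) := by
    have := hacg.continuousOn
    rwa [uIcc_of_le hℓ] at this
  refine ⟨g, ⟨fun x hx => hacg.mono ?_, ?_, ?_⟩, ?_, fun x hx => ?_⟩
  · rw [uIcc_of_le hx.1, uIcc_of_le hℓ]; exact Icc_subset_Icc_right hx.2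
  · rw [memLp_two_iff_integrable_sq (hcont.aestronglyMeasurable measurableSet_Icc)]
    exact (hcont.pow 2).integrableOn_compact isCompact_Icc
  · exact (memLp_congr_ae hderiv).2 (Lp.memLp g₀)
  · refine le_trans (le_of_eq ?_) hg₀T
    rw [← real_inner_self_eq_norm_sq, L2.inner_def]
    refine integral_congr_ae ?_
    filter_upwards [hderiv] with t ht
    simp only [ht, sq_abs]
    simp [sq]
  · have hsub : Ioc 0 x ⊆ Icc 0 ℓ := fun t ht => ⟨ht.1.le, ht.2.trans hx.2⟩
    have hrr : ν.restrict (Ioc 0 x) = volume.restrict (Ioc 0 x) := by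
      rw [hν, Measure.restrict_restrict measurableSet_Ioc, inter_eq_left.2 hsub]
    have hfin : ν (Ioc 0 x) ≠ ⊤ := measure_ne_top _ _
    -- Testing weak convergence of the derivatives on the indicator of `(0, x]` gives convergence of
    -- the values at `x`.
    have key : ∀ φ : Lp ℝ 2 ν, inner ℝ φ (indicatorConstLp 2 measurableSet_Ioc hfin (1 : ℝ)) =
        ∫ t in (0 : ℝ)..x, φ t := fun φ => by
      rw [real_inner_comm, L2.inner_indicatorConstLp_one, hrr,
        intervalIntegral.integral_of_le hx.1]
    have h1 := hg₀ (indicatorConstLp 2 measurableSet_Ioc hfin (1 : ℝ))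
    simp only [key] at h1
    refine (hc.add h1).congr fun i => ?_
    have h2 : ∫ t in (0 : ℝ)..x, F i t = ∫ t in (0 : ℝ)..x, deriv (f i) t := by
      rw [intervalIntegral.integral_of_le hx.1, intervalIntegral.integral_of_le hx.1]
      exact integral_congr_ae (ae_restrict_of_ae_restrict_of_subset hsub (hf i).2.2.coeFn_toLp)
    rw [h2, ((hf i).1 x hx).integral_deriv_eq_sub]
    ring

theorem memH1On_exp (w : ℝ) {κ : ℝ} (hκ : 0 < κ) :
    MetricGraph.MemH1On (Ici 0) (fun x => w * Real.exp (-κ * x)) ∧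
      ∫ x in Ici 0, |w * Real.exp (-κ * x)| ^ 2 = w ^ 2 / (2 * κ) ∧
      ∫ x in Ici 0, |deriv (fun x => w * Real.exp (-κ * x)) x| ^ 2 = w ^ 2 * κ / 2 := by
  have hd : deriv (fun x => w * Real.exp (-κ * x)) = fun x => -κ * (w * Real.exp (-κ * x)) := by
    ext x
    have he : HasDerivAt (fun t => Real.exp (-κ * t)) (Real.exp (-κ * x) * (-κ * 1)) x :=
      ((hasDerivAt_id x).const_mul (-κ)).exp
    rw [(he.const_mul w).deriv]
    ring
  have hsq : ∀ x, (w * Real.exp (-κ * x)) ^ 2 = w ^ 2 * Real.exp (-(2 * κ) * x) := fun x => by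
    rw [mul_pow, ← Real.exp_nat_mul]
    ring_nf
  have hintg : IntegrableOn (fun x => Real.exp (-(2 * κ) * x)) (Ici 0) := by
    rw [integrableOn_Ici_iff_integrableOn_Ioi]
    exact integrableOn_exp_mul_Ioi (by linarith) 0
  have hval : ∫ x in Ici 0, Real.exp (-(2 * κ) * x) = 1 / (2 * κ) := by
    rw [integral_Ici_eq_integral_Ioi, integral_exp_mul_Ioi (by linarith)]
    simp
  have hsq' : ∀ x, (-κ * (w * Real.exp (-κ * x))) ^ 2 =
      κ ^ 2 * w ^ 2 * Real.exp (-(2 * κ) * x) := fun x => by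
    rw [mul_pow, hsq]; ring
  refine ⟨⟨fun x _ => ContDiffOn.absolutelyContinuousOnInterval (by fun_prop), ?_, ?_⟩, ?_, ?_⟩
  · rw [memLp_two_iff_integrable_sq (by fun_prop)]
    simp only [hsq]
    exact hintg.const_mul _
  · rw [hd, memLp_two_iff_integrable_sq (by fun_prop)]
    simp only [hsq']
    exact hintg.const_mul _
  · simp only [sq_abs, hsq]
    rw [integral_const_mul, hval]
    ring
  · simp only [hd, sq_abs, hsq']
    rw [integral_const_mul, hval]
    field_simp

/-- An admissible profile on a half-line with prescribed value at the root. -/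
theorem exists_memH1On_halfLine {w M T : ℝ} (hM : 0 ≤ M) (hT : 0 ≤ T)
    (h : ∀ κ, 0 ≤ κ → κ * w ^ 2 ≤ T + κ ^ 2 * M) :
    ∃ f, MetricGraph.MemH1On (Ici 0) f ∧ f 0 = w ∧ (∫ x in Ici 0, |f x| ^ 2) ≤ M ∧
      (∫ x in Ici 0, |deriv f x| ^ 2) ≤ T := by
  by_cases hw : w = 0
  · subst hw
    obtain ⟨h1, h2, h3⟩ := memH1On_exp 0 one_pos
    exact ⟨_, h1, by simp, h2.trans_le (by simpa using hM), h3.trans_le (by simpa using hT)⟩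
  have hw2 : 0 < w ^ 2 := by positivity
  have hMpos : 0 < M := by
    refine hM.lt_of_ne fun h0 => ?_
    have := h ((T + 1) / w ^ 2) (by positivity)
    rw [← h0, div_mul_cancel₀ _ hw2.ne'] at this
    linarith
  -- This rate makes the mass of the exponential exactly `M`; the hypothesis at the same `κ` is then
  -- exactly the bound on its kinetic energy.
  obtain ⟨h1, h2, h3⟩ := memH1On_exp w (show 0 < w ^ 2 / (2 * M) by positivity)
  refine ⟨_, h1, by simp, h2.trans_le (le_of_eq (by field_simp)), h3.trans_le ?_⟩
  have h4 := h (w ^ 2 / (2 * M)) (by positivity)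
  have h5 : (w ^ 2 / (2 * M)) ^ 2 * M = w ^ 2 * (w ^ 2 / (2 * M)) / 2 := by field_simp
  linarith

namespace MetricGraph

variable {V B H : Type*} {G : MetricGraph V B H} [Fintype B] [Fintype H]

/-- Compactness: bounded families in `H¹(G)` converge along ultrafilters, strongly on the core. -/
theorem exists_H1_limit (hconn : G.Connected) (hH : Nonempty H) (hB : Nonempty B) {ι : Type*}
    (𝒰 : Ultrafilter ι) {u : ι → B ⊕ H → ℝ → ℝ} (hu : ∀ i, u i ∈ G.H1) {A : ℝ}
    (hM : ∀ i, G.mass (u i) ≤ A) (hT : ∀ i, G.kinetic (u i) ≤ A) :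
    ∃ v ∈ G.H1, ∃ M T, Tendsto (fun i => G.mass (u i)) 𝒰 (𝓝 M) ∧ G.mass v ≤ M ∧
      Tendsto (fun i => G.kinetic (u i)) 𝒰 (𝓝 T) ∧ G.kinetic v ≤ T ∧
      Tendsto (fun i => G.coreSextic (u i)) 𝒰 (𝓝 (G.coreSextic v)) := by
  have hN := hasMultiplicity_one hconn hH
  set R := 3 * A + 1 with hR
  have hsup : ∀ i e, ∀ x ∈ G.interval e, |u i e x| ≤ R := fun i e x hx => by
    have := mul_sq_le_kinetic_add_mass hN hB (hu i) zero_le_one e hx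
    have h1 := hM i
    have h2 := hT i
    have h3 := G.kinetic_nonneg (u i)
    rw [← sq_abs] at this
    nlinarith [sq_nonneg (|u i e x| - 1)]
  have hMe : ∀ i e, ∫ x in G.interval e, |u i e x| ^ 2 ≤ A := fun i e =>
    (Finset.single_le_sum (f := fun e => ∫ t in G.interval e, |u i e t| ^ 2)
      (fun _ _ => integral_nonneg fun _ => by positivity) (Finset.mem_univ e)).trans (hM i)
  have hTe : ∀ i e, ∫ x in G.interval e, |deriv (u i e) x| ^ 2 ≤ A := fun i e =>
    (Finset.single_le_sum (f := fun e => ∫ t in G.interval e, |deriv (u i e) t| ^ 2)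
      (fun _ _ => integral_nonneg fun _ => by positivity) (Finset.mem_univ e)).trans (hT i)
  have hlimM : ∀ e, ∃ m, Tendsto (fun i => ∫ x in G.interval e, |u i e x| ^ 2) 𝒰 (𝓝 m) :=
    fun e => 𝒰.exists_tendsto_of_abs_le (A := A) fun i => by
      rw [abs_of_nonneg (integral_nonneg fun _ => by positivity)]; exact hMe i e
  have hlimT : ∀ e, ∃ m, Tendsto (fun i => ∫ x in G.interval e, |deriv (u i e) x| ^ 2) 𝒰 (𝓝 m) :=
    fun e => 𝒰.exists_tendsto_of_abs_le (A := A) fun i => by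
      rw [abs_of_nonneg (integral_nonneg fun _ => by positivity)]; exact hTe i e
  choose m hm using hlimM
  choose τ hτ using hlimT
  choose w hw using fun i => (hu i).2
  have hlimw : ∀ v, ∃ l, Tendsto (fun i => w i v) 𝒰 (𝓝 l) := fun v =>
    𝒰.exists_tendsto_of_abs_le (A := R) fun i => by
      obtain ⟨b, h | h⟩ := hconn.exists_incident hB v <;> rw [h]
      · rw [← ((hw i).1 b).1]
        exact hsup i (Sum.inl b) 0 ⟨le_rfl, (G.len_pos b).le⟩
      · rw [← ((hw i).1 b).2]
        exact hsup i (Sum.inl b) _ ⟨(G.len_pos b).le, le_rfl⟩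
  choose W hW using hlimw
  have hcore : ∀ b, ∃ g, MemH1On (Icc 0 (G.len b)) g ∧
      (∫ t in Icc 0 (G.len b), |deriv g t| ^ 2) ≤ τ (Sum.inl b) ∧
      ∀ x ∈ Icc 0 (G.len b), Tendsto (fun i => u i (Sum.inl b) x) 𝒰 (𝓝 (g x)) := fun b => by
    refine 𝒰.exists_memH1On_limit (A := A) (c := W (G.src b)) (G.len_pos b).le
      (fun i => H1.memH1On_bounded (hu i) b) (fun i => hTe i (Sum.inl b)) ?_ (hτ (Sum.inl b))
    simp only [((hw _).1 b).1]
    exact hW _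
  choose g hg hgT hgl using hcore
  -- No weak limit is taken on half-lines: they matter only through root value, mass and kinetic
  -- energy. The inequality relating these passes to the limit, and an exponential realizes it.
  have hhalf : ∀ h, ∃ f, MemH1On (Ici 0) f ∧ f 0 = W (G.root h) ∧
      (∫ x in Ici 0, |f x| ^ 2) ≤ m (Sum.inr h) ∧
      (∫ x in Ici 0, |deriv f x| ^ 2) ≤ τ (Sum.inr h) := fun h => by
    refine exists_memH1On_halfLine (ge_of_tendsto' (hm (Sum.inr h)) fun i =>
      integral_nonneg fun _ => by positivity) (ge_of_tendsto' (hτ (Sum.inr h)) fun i =>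
      integral_nonneg fun _ => by positivity) fun κ hκ => ?_
    refine le_of_tendsto_of_tendsto' (((hW (G.root h)).pow 2).const_mul κ)
      ((hτ (Sum.inr h)).add ((hm (Sum.inr h)).const_mul (κ ^ 2))) fun i => ?_
    rw [← (hw i).2 h]
    exact mul_sq_le_of_memH1On_Ici (H1.memH1On_halfLine (hu i) h) hκ le_rfl
  choose f hf hf0 hfM hfT using hhalf
  have hpow : ∀ b n, Tendsto (fun i => ∫ t in Icc 0 (G.len b), |u i (Sum.inl b) t| ^ n) 𝒰
      (𝓝 (∫ t in Icc 0 (G.len b), |g b t| ^ n)) := fun b n =>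
    tendsto_integral_abs_pow (G.len_pos b).le (fun i => H1.memH1On_bounded (hu i) b) (hg b)
      (fun i => hTe i (Sum.inl b)) (fun i x hx => hsup i (Sum.inl b) x hx) (hgl b) n
  refine ⟨Sum.elim g f, ⟨?_, W, fun b => ⟨?_, ?_⟩, hf0⟩, ∑ e, m e, ∑ e, τ e,
    tendsto_finsetSum _ fun e _ => hm e, Finset.sum_le_sum ?_,
    tendsto_finsetSum _ fun e _ => hτ e, Finset.sum_le_sum ?_, ?_⟩
  · rintro (b | h)
    · exact hg b
    · exact hf h
  · refine tendsto_nhds_unique (hgl b 0 ⟨le_rfl, (G.len_pos b).le⟩) ?_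
    simp only [((hw _).1 b).1]
    exact hW _
  · refine tendsto_nhds_unique (hgl b _ ⟨(G.len_pos b).le, le_rfl⟩) ?_
    simp only [((hw _).1 b).2]
    exact hW _
  · rintro (b | h) -
    · exact (tendsto_nhds_unique (hpow b 2) (hm (Sum.inl b))).le
    · exact hfM h
  · rintro (b | h) -
    · exact hgT b
    · exact hfT h
  · exact tendsto_finsetSum _ fun b _ => hpow b 6

end MetricGraph

/-! ### Test functions -/

/-- The profile of the soliton, whose square is `√3 / 2 / cosh x`. -/
noncomputable def soliton (x : ℝ) : ℝ := √(√3 / 2 / Real.cosh x)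

theorem soliton_pos (x : ℝ) : 0 < soliton x :=
  Real.sqrt_pos.2 (div_pos (by positivity) (Real.cosh_pos x))

theorem soliton_sq (x : ℝ) : soliton x ^ 2 = √3 / 2 / Real.cosh x :=
  Real.sq_sqrt (div_pos (by positivity) (Real.cosh_pos x)).le

theorem soliton_neg (x : ℝ) : soliton (-x) = soliton x := by simp [soliton]

theorem hasDerivAt_soliton (x : ℝ) :
    HasDerivAt soliton (-(1 / 2) * (Real.sinh x / Real.cosh x) * soliton x) x := by
  have hc := (Real.cosh_pos x).ne'
  have h1 : HasDerivAt (fun x => √3 / 2 / Real.cosh x) (-(√3 / 2) * Real.sinh x / Real.cosh x ^ 2)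
      x := by
    refine ((hasDerivAt_const x (√3 / 2)).fun_div (Real.hasDerivAt_cosh x) hc).congr_deriv ?_
    ring
  refine (h1.sqrt (div_pos (by positivity) (Real.cosh_pos x)).ne').congr_deriv ?_
  have hs := soliton_pos x
  have hsq := soliton_sq x
  change _ / (2 * soliton x) = _
  rw [div_eq_iff (by positivity)]
  have : -(1 / 2) * (Real.sinh x / Real.cosh x) * soliton x * (2 * soliton x) =
      -(Real.sinh x / Real.cosh x) * soliton x ^ 2 := by ring
  rw [this, hsq]
  field_simp

theorem differentiable_soliton : Differentiable ℝ soliton := fun x =>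
  (hasDerivAt_soliton x).differentiableAt

theorem continuous_soliton : Continuous soliton := differentiable_soliton.continuous

theorem soliton_anti {x y : ℝ} (hx : 0 ≤ x) (hxy : x ≤ y) : soliton y ≤ soliton x := by
  unfold soliton
  gcongr
  · rwa [Real.cosh_le_cosh, abs_of_nonneg hx, abs_of_nonneg (hx.trans hxy)]

theorem soliton_le (x : ℝ) : soliton x ≤ soliton 0 := by
  rcases le_total 0 x with h | h
  · exact soliton_anti le_rfl h
  · rw [← soliton_neg x]; exact soliton_anti le_rfl (by linarith)

theorem abs_deriv_soliton_le (x : ℝ) : |deriv soliton x| ≤ soliton 0 := by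
  rw [(hasDerivAt_soliton x).deriv, abs_mul, abs_of_pos (soliton_pos x), abs_mul, abs_div,
    abs_of_pos (Real.cosh_pos x)]
  have h1 : |Real.sinh x| / Real.cosh x ≤ 1 := by
    rw [div_le_one (Real.cosh_pos x), abs_le]
    have h2 := Real.cosh_sq x
    have h3 := Real.cosh_pos x
    constructor <;> nlinarith
  have h4 : |(-(1 / 2) : ℝ)| = 1 / 2 := by norm_num
  rw [h4]
  have h5 : 0 ≤ |Real.sinh x| / Real.cosh x := div_nonneg (abs_nonneg _) (Real.cosh_pos x).le
  have h6 := soliton_le x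
  have h7 := soliton_pos x
  nlinarith

theorem soliton_lipschitz (x y : ℝ) : |soliton x - soliton y| ≤ soliton 0 * |x - y| :=
  Convex.norm_image_sub_le_of_norm_deriv_le (fun z _ => differentiable_soliton z)
    (fun z _ => abs_deriv_soliton_le z) convex_univ (mem_univ y) (mem_univ x)

theorem tendsto_soliton : Tendsto soliton atTop (𝓝 0) := by
  have h1 : Tendsto Real.cosh atTop atTop := by
    refine tendsto_atTop_mono (fun x => ?_) (Real.tendsto_exp_atTop.atTop_div_const two_pos)
    rw [Real.cosh_eq]
    have := Real.exp_pos (-x)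
    linarith
  have h2 := (tendsto_const_nhds (x := √3 / 2)).div_atTop h1
  have := (Real.continuous_sqrt.tendsto 0).comp h2
  rwa [Real.sqrt_zero] at this

theorem integral_soliton_sq_le {L : ℝ} : ∫ x in (0 : ℝ)..L, soliton x ^ 2 ≤
    criticalMassHalfLine := by
  have h1 : ∫ x in (0 : ℝ)..L, soliton x ^ 2 =
      √3 / 2 * Real.arctan (Real.sinh L) - √3 / 2 * Real.arctan (Real.sinh 0) := by
    refine intervalIntegral.integral_eq_sub_of_hasDerivAt
      (f := fun x => √3 / 2 * Real.arctan (Real.sinh x)) (fun x _ => ?_)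
      ((continuous_soliton.pow 2).intervalIntegrable _ _)
    have := ((Real.hasDerivAt_sinh x).arctan).const_mul (√3 / 2)
    refine this.congr_deriv ?_
    rw [soliton_sq, show 1 + Real.sinh x ^ 2 = Real.cosh x ^ 2 by rw [Real.cosh_sq]; ring]
    have := (Real.cosh_pos x).ne'
    field_simp
  rw [h1, Real.sinh_zero, Real.arctan_zero, mul_zero, sub_zero]
  have := (Real.arctan_lt_pi_div_two (Real.sinh L)).le
  unfold criticalMassHalfLine criticalMassLine
  nlinarith [Real.sqrt_nonneg 3]

/-- The function `φ⁶ - 3φ'²` is the derivative of a multiple of `sinh / cosh²`, which vanishes at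
`0` and is nonnegative at `L`. -/
theorem integral_deriv_soliton_sq_le {L : ℝ} (hL : 0 ≤ L) :
    3 * ∫ x in (0 : ℝ)..L, |deriv soliton x| ^ 2 ≤ ∫ x in (0 : ℝ)..L, soliton x ^ 6 := by
  have e1 : ∀ x, |deriv soliton x| ^ 2 =
      √3 / 8 * (Real.sinh x ^ 2 / Real.cosh x ^ 3) := fun x => by
    rw [(hasDerivAt_soliton x).deriv, sq_abs, mul_pow, soliton_sq]
    have := (Real.cosh_pos x).ne'
    field_simp
    norm_num
    ring
  have e2 : ∀ x, soliton x ^ 6 = √3 * (3 / 8) / Real.cosh x ^ 3 := fun x => by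
    rw [show soliton x ^ 6 = (soliton x ^ 2) ^ 3 by ring, soliton_sq, div_pow, div_pow,
      pow_succ √3 2, Real.sq_sqrt (by norm_num)]
    ring
  have hcc : ∀ x : ℝ, Real.cosh x ^ 3 ≠ 0 := fun x => pow_ne_zero _ (Real.cosh_pos x).ne'
  have c1 : Continuous fun x : ℝ => √3 / 8 * (Real.sinh x ^ 2 / Real.cosh x ^ 3) :=
    continuous_const.mul ((Real.continuous_sinh.pow 2).div (Real.continuous_cosh.pow 3) hcc)
  have c2 : Continuous fun x : ℝ => √3 * (3 / 8) / Real.cosh x ^ 3 :=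
    continuous_const.div (Real.continuous_cosh.pow 3) hcc
  simp only [e1, e2]
  have h1 : ∫ x in (0 : ℝ)..L, (√3 * (3 / 8) / Real.cosh x ^ 3 -
      3 * (√3 / 8 * (Real.sinh x ^ 2 / Real.cosh x ^ 3))) =
      √3 * (3 / 8) * (Real.sinh L / Real.cosh L ^ 2) -
        √3 * (3 / 8) * (Real.sinh 0 / Real.cosh 0 ^ 2) := by
    refine intervalIntegral.integral_eq_sub_of_hasDerivAt
      (f := fun x => √3 * (3 / 8) * (Real.sinh x / Real.cosh x ^ 2)) (fun x _ => ?_)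
      ((c2.sub (continuous_const.mul c1)).intervalIntegrable _ _)
    have hc := (Real.cosh_pos x).ne'
    have := ((Real.hasDerivAt_sinh x).fun_div ((Real.hasDerivAt_cosh x).fun_pow 2)
      (pow_ne_zero 2 hc)).const_mul (√3 * (3 / 8))
    refine this.congr_deriv ?_
    have hs := Real.cosh_sq x
    field_simp
    push_cast
    ring_nf
    rw [show Real.cosh x ^ 3 = Real.cosh x * Real.cosh x ^ 2 by ring, hs]
    ring
  rw [intervalIntegral.integral_sub (c2.intervalIntegrable _ _)
    ((c1.intervalIntegrable _ _).const_mul 3), intervalIntegral.integral_const_mul 3,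
    Real.sinh_zero] at h1
  have h2 : 0 ≤ √3 * (3 / 8) * (Real.sinh L / Real.cosh L ^ 2) := by
    have := Real.sinh_nonneg_iff.2 hL
    positivity
  simp only [zero_div, mul_zero, sub_zero] at h1
  linarith

/-! ### Compactly supported bumps and their rescalings -/

/-- Even Lipschitz functions supported in `[-L, L]`. -/
structure IsBump (f : ℝ → ℝ) (L K : ℝ) : Prop where
  L_pos : 0 < L
  lipschitz : ∀ x y, |f x - f y| ≤ K * |x - y|
  even : ∀ x, f (-x) = f x
  eq_zero : ∀ x, L ≤ x → f x = 0

/-- Compactly supported bumps of negative energy exist at any mass above that of the half soliton. -/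
theorem exists_isBump {μ : ℝ} (hμ : criticalMassHalfLine < μ) :
    ∃ f L K, IsBump f L K ∧ ∫ x in (0 : ℝ)..L, |f x| ^ 2 = μ ∧
      3 * ∫ x in (0 : ℝ)..L, |deriv f x| ^ 2 < ∫ x in (0 : ℝ)..L, |f x| ^ 6 := by
  have hμH : 0 < criticalMassHalfLine := by
    unfold criticalMassHalfLine criticalMassLine; positivity
  set μ₀ := criticalMassHalfLine with hμ₀
  set q := μ / μ₀ with hq
  have hq1 : 1 < q := (one_lt_div hμH).2 hμ
  set S₁ := ∫ x in (0 : ℝ)..1, soliton x ^ 6 with hS₁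
  have hS₁pos : 0 < S₁ := intervalIntegral.intervalIntegral_pos_of_pos
    ((continuous_soliton.pow 6).intervalIntegrable _ _) (fun x => pow_pos (soliton_pos x) 6) one_pos
  -- Truncation at height `c` costs at most `6 φ(0)³ μ₀ c` in the sextic integral. `L` is taken so
  -- large that `q²` times this stays below `(q² - 1) S₁`, the surplus due to the extra mass.
  set D := 6 * soliton 0 ^ 3 * μ₀ * q ^ 2 with hD
  have hDpos : 0 < D := by have := soliton_pos 0; positivity
  have hev : ∀ᶠ L in atTop, soliton L < (q ^ 2 - 1) * S₁ / D :=
    tendsto_soliton.eventually_lt_const (div_pos (mul_pos (by nlinarith) hS₁pos) hDpos)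
  obtain ⟨L, hLc, hL1⟩ := (hev.and (eventually_ge_atTop 1)).exists
  have hL : 0 < L := by linarith
  set c := soliton L with hc
  have hcpos : 0 < c := soliton_pos L
  rw [lt_div_iff₀ hDpos] at hLc
  -- Subtracting the height at `L` gives compact support without changing the derivative on `(0,
  -- L)`.
  set g : ℝ → ℝ := fun x => max (soliton x - c) 0 with hg
  have hgL : ∀ x ∈ Icc 0 L, g x = soliton x - c := fun x hx =>
    max_eq_left (sub_nonneg.2 (soliton_anti hx.1 hx.2))
  have hgc : Continuous g := (continuous_soliton.sub continuous_const).max continuous_const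
  have hbump : IsBump g L (soliton 0) := by
    refine ⟨hL, fun x y => ?_, fun x => by simp only [hg, soliton_neg], fun x hx => ?_⟩
    · refine (abs_max_sub_max_le_abs _ _ _).trans ?_
      rw [sub_sub_sub_cancel_right]
      exact soliton_lipschitz x y
    · exact max_eq_right (sub_nonpos.2 (soliton_anti hL.le hx))
  have hderiv : ∫ x in (0 : ℝ)..L, |deriv g x| ^ 2 = ∫ x in (0 : ℝ)..L, |deriv soliton x| ^ 2 := by
    rw [intervalIntegral.integral_of_le hL.le, intervalIntegral.integral_of_le hL.le,
      integral_Ioc_eq_integral_Ioo, integral_Ioc_eq_integral_Ioo]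
    refine setIntegral_congr_fun measurableSet_Ioo fun x hx => ?_
    have : g =ᶠ[𝓝 x] fun x => soliton x - c := by
      filter_upwards [isOpen_Ioo.mem_nhds hx] with y hy
      exact hgL y ⟨hy.1.le, hy.2.le⟩
    simp only [this.deriv_eq, deriv_sub_const]
  set M := ∫ x in (0 : ℝ)..L, |g x| ^ 2 with hM
  have hMle : M ≤ μ₀ := by
    refine le_trans ?_ (integral_soliton_sq_le (L := L))
    refine intervalIntegral.integral_mono_on hL.le ((hgc.abs.pow 2).intervalIntegrable _ _)
      ((continuous_soliton.pow 2).intervalIntegrable _ _) fun x hx => ?_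
    rw [sq_abs, hgL x hx]
    have h1 := soliton_anti hx.1 hx.2
    have h2 := soliton_pos x
    nlinarith
  have hMpos : 0 < M := by
    refine intervalIntegral.intervalIntegral_pos_of_pos_on
      ((hgc.abs.pow 2).intervalIntegrable _ _) (fun x hx => ?_) hL
    rw [sq_abs, hgL x ⟨hx.1.le, hx.2.le⟩]
    have : c < soliton x := by
      rw [hc]
      unfold soliton
      refine Real.sqrt_lt_sqrt (div_nonneg (by positivity) (Real.cosh_pos _).le) ?_
      refine div_lt_div_of_pos_left (by positivity) (Real.cosh_pos _) ?_
      rw [Real.cosh_lt_cosh, abs_of_pos hx.1, abs_of_pos hL]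
      exact hx.2
    have : 0 < soliton x - c := sub_pos.2 this
    positivity
  have hSg : (∫ x in (0 : ℝ)..L, soliton x ^ 6) - 6 * soliton 0 ^ 3 * μ₀ * c ≤
      ∫ x in (0 : ℝ)..L, |g x| ^ 6 := by
    have h1 : ∫ x in (0 : ℝ)..L, (soliton x ^ 6 - 6 * soliton 0 ^ 3 * c * soliton x ^ 2) ≤
        ∫ x in (0 : ℝ)..L, |g x| ^ 6 := by
      refine intervalIntegral.integral_mono_on hL.le (((continuous_soliton.pow 6).sub
        (continuous_const.mul (continuous_soliton.pow 2))).intervalIntegrable _ _)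
        ((hgc.abs.pow 6).intervalIntegrable _ _) fun x hx => ?_
      rw [hgL x hx, abs_of_nonneg (sub_nonneg.2 (soliton_anti hx.1 hx.2))]
      have hs := soliton_pos x
      have hle := soliton_anti hx.1 hx.2
      have hb := one_add_mul_le_pow (a := -(c / soliton x)) (by
        have : c / soliton x ≤ 1 := (div_le_one hs).2 hle
        linarith) 6
      have h3 : (soliton x - c) ^ 6 = soliton x ^ 6 * (1 + -(c / soliton x)) ^ 6 := by
        rw [← mul_pow]; congr 1; field_simp; ring
      have h4 : soliton x ^ 6 * (1 + ((6 : ℕ) : ℝ) * -(c / soliton x)) =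
          soliton x ^ 6 - 6 * c * soliton x ^ 3 * soliton x ^ 2 := by
        field_simp; push_cast; ring
      have h5 := mul_le_mul_of_nonneg_left hb (pow_pos hs 6).le
      rw [h4, ← h3] at h5
      refine le_trans ?_ h5
      have h6 : soliton x ^ 3 ≤ soliton 0 ^ 3 := pow_le_pow_left₀ hs.le (soliton_le x) 3
      have h7 : c * soliton x ^ 3 * soliton x ^ 2 ≤ c * soliton 0 ^ 3 * soliton x ^ 2 := by gcongr
      linarith
    rw [intervalIntegral.integral_sub (f := fun x => soliton x ^ 6)
      (g := fun x => 6 * soliton 0 ^ 3 * c * soliton x ^ 2)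
      ((continuous_soliton.pow 6).intervalIntegrable _ _)
      (((continuous_soliton.pow 2).intervalIntegrable _ _).const_mul _),
      intervalIntegral.integral_const_mul] at h1
    have h2 := integral_soliton_sq_le (L := L)
    have h3 := mul_le_mul_of_nonneg_left h2
      (show 0 ≤ 6 * soliton 0 ^ 3 * c by have := soliton_pos 0; positivity)
    linarith
  have hSφ : S₁ ≤ ∫ x in (0 : ℝ)..L, soliton x ^ 6 :=
    intervalIntegral.integral_mono_interval le_rfl zero_le_one hL1
      (ae_of_all _ fun x => (pow_pos (soliton_pos x) 6).le)
      ((continuous_soliton.pow 6).intervalIntegrable _ _)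
  have hT := integral_deriv_soliton_sq_le hL.le
  have hμpos : 0 < μ := by linarith
  -- Scaling restores mass `μ`: the sextic term gains `s⁶`, the kinetic one only `s²`, and `s² ≥ q >
  -- 1` because truncation leaves `M ≤ μ₀`.
  set s := √(μ / M) with hs
  have hs2 : s ^ 2 = μ / M := Real.sq_sqrt (by positivity)
  have hspos : 0 < s := Real.sqrt_pos.2 (by positivity)
  have hsq : q ≤ s ^ 2 := by
    rw [hs2, hq]; gcongr
  refine ⟨fun x => s * g x, L, s * soliton 0, ⟨hL, fun x y => ?_, fun x => ?_, fun x hx => ?_⟩,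
    ?_, ?_⟩
  · rw [← mul_sub, abs_mul, abs_of_pos hspos, mul_assoc]
    gcongr
    exact hbump.lipschitz x y
  · rw [hbump.even]
  · rw [hbump.eq_zero x hx, mul_zero]
  · simp only [abs_mul, mul_pow, intervalIntegral.integral_const_mul, sq_abs s, hs2]
    rw [← hM]
    field_simp
  · have e1 : ∀ x, |deriv (fun x => s * g x) x| ^ 2 = s ^ 2 * |deriv g x| ^ 2 := fun x => by
      rw [deriv_const_mul_field, abs_mul, mul_pow, sq_abs s]
    have e2 : ∀ x, |s * g x| ^ 6 = s ^ 6 * |g x| ^ 6 := fun x => by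
      rw [abs_mul, mul_pow, abs_of_pos hspos]
    simp only [e1, e2, intervalIntegral.integral_const_mul, hderiv]
    set Sφ := ∫ x in (0 : ℝ)..L, soliton x ^ 6
    set Sg := ∫ x in (0 : ℝ)..L, |g x| ^ 6
    have hSg0 : 0 ≤ Sg := intervalIntegral.integral_nonneg hL.le fun x _ => by positivity
    have h1 : Sφ < q ^ 2 * Sg := by
      have h2 := mul_le_mul_of_nonneg_left hSg (sq_nonneg q)
      have h3 := mul_le_mul_of_nonneg_left hSφ (show 0 ≤ q ^ 2 - 1 by nlinarith)
      nlinarith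
    have h4 : q ^ 2 * Sg ≤ (s ^ 2) ^ 2 * Sg := by gcongr
    have h5 : s ^ 2 * (3 * ∫ x in (0 : ℝ)..L, |deriv soliton x| ^ 2) < s ^ 2 * ((s ^ 2) ^ 2 * Sg) :=
      mul_lt_mul_of_pos_left (by linarith) (by positivity)
    calc _ = s ^ 2 * (3 * ∫ x in (0 : ℝ)..L, |deriv soliton x| ^ 2) := by ring
      _ < _ := h5
      _ = _ := by ring

theorem memH1On_of_lipschitz {F : ℝ → ℝ} {K : ℝ} (hF : ∀ x y, |F x - F y| ≤ K * |x - y|) (ℓ : ℝ) :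
    MetricGraph.MemH1On (Icc 0 ℓ) F := by
  have hK : 0 ≤ K := by
    have := (abs_nonneg _).trans (hF 1 0)
    simpa using this
  have hL : LipschitzWith ⟨K, hK⟩ F := LipschitzWith.of_dist_le_mul fun x y => by
    simpa only [Real.dist_eq] using! hF x y
  refine ⟨fun x _ => hL.lipschitzOnWith.absolutelyContinuousOnInterval, ?_, ?_⟩
  · rw [memLp_two_iff_integrable_sq hL.continuous.aestronglyMeasurable]
    exact (hL.continuous.pow 2).continuousOn.integrableOn_compact isCompact_Icc
  · exact MemLp.of_bound (measurable_deriv F).aestronglyMeasurable K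
      (ae_of_all _ fun x => norm_deriv_le_of_lipschitz hL)

namespace IsBump

variable {f : ℝ → ℝ} {L K : ℝ}

theorem continuous (hf : IsBump f L K) : Continuous f := by
  have hK : 0 ≤ K := by
    have := (abs_nonneg _).trans (hf.lipschitz 1 0)
    simpa using this
  exact (LipschitzWith.of_dist_le_mul (K := ⟨K, hK⟩) fun x y => by
    simpa only [Real.dist_eq] using! hf.lipschitz x y).continuous

theorem abs_deriv_even (hf : IsBump f L K) (x : ℝ) : |deriv f (-x)| = |deriv f x| := by
  have h1 : (fun x => f (-x)) = f := funext hf.even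
  have h2 := deriv_comp_neg f x
  rw [h1] at h2
  rw [h2, abs_neg]

theorem deriv_eq_zero (hf : IsBump f L K) {x : ℝ} (hx : L < x) : deriv f x = 0 := by
  have : f =ᶠ[𝓝 x] fun _ => 0 := by
    filter_upwards [Ioi_mem_nhds hx] with y hy
    exact hf.eq_zero y hy.le
  rw [this.deriv_eq, deriv_const]

theorem intervalIntegrable_deriv_sq (hf : IsBump f L K) (a b : ℝ) :
    IntervalIntegrable (fun x => |deriv f x| ^ 2) volume a b := by
  have hK : 0 ≤ K := by
    have := (abs_nonneg _).trans (hf.lipschitz 1 0)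
    simpa using this
  have hL : LipschitzWith ⟨K, hK⟩ f := LipschitzWith.of_dist_le_mul fun x y => by
    simpa only [Real.dist_eq] using! hf.lipschitz x y
  refine (intervalIntegrable_const (c := K ^ 2)).mono_fun'
    (((measurable_deriv f).abs.pow_const 2).aestronglyMeasurable) (ae_of_all _ fun x => ?_)
  have h1 : |deriv f x| ≤ K := norm_deriv_le_of_lipschitz hL
  change ‖|deriv f x| ^ 2‖ ≤ K ^ 2
  rw [Real.norm_of_nonneg (by positivity)]
  gcongr

end IsBump

theorem integral_eq_of_support {φ : ℝ → ℝ} {L a : ℝ} (hz : ∀ x, L < x → φ x = 0)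
    (hintg : ∀ a b, IntervalIntegrable φ volume a b) (ha : L ≤ a) :
    ∫ x in (0 : ℝ)..a, φ x = ∫ x in (0 : ℝ)..L, φ x := by
  rw [← intervalIntegral.integral_add_adjacent_intervals (hintg 0 L) (hintg L a)]
  have : ∫ x in L..a, φ x = 0 := by
    rw [intervalIntegral.integral_of_le ha]
    exact (setIntegral_congr_fun measurableSet_Ioc fun x hx => hz x hx.1).trans (integral_zero _ _)
  rw [this, add_zero]

theorem integral_neg_eq_of_even {φ : ℝ → ℝ} (he : ∀ x, φ (-x) = φ x) (a : ℝ) :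
    ∫ x in (-a)..(0 : ℝ), φ x = ∫ x in (0 : ℝ)..a, φ x := by
  have := intervalIntegral.integral_comp_neg (a := 0) (b := a) φ
  simp only [he, neg_zero] at this
  exact this.symm

/-- The interval `[-d, a]` contains `n` halves of the support `[-L, L]`. -/
def CoversHalves (L d a n : ℝ) : Prop :=
  ∀ φ : ℝ → ℝ, (∀ x, φ (-x) = φ x) → (∀ x, L < x → φ x = 0) →
    (∀ a b, IntervalIntegrable φ volume a b) →
    ∫ x in (-d)..a, φ x = n * ∫ x in (0 : ℝ)..L, φ x

theorem coversHalves_right {L a : ℝ} (ha : L ≤ a) : CoversHalves L 0 a 1 :=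
  fun φ _ hz hintg => by rw [neg_zero, one_mul, integral_eq_of_support hz hintg ha]

theorem coversHalves_left {L d : ℝ} (hd : L ≤ d) : CoversHalves L d 0 1 :=
  fun φ he hz hintg => by
    rw [one_mul, integral_neg_eq_of_even he, integral_eq_of_support hz hintg hd]

theorem coversHalves_both {L d a : ℝ} (hd : L ≤ d) (ha : L ≤ a) : CoversHalves L d a 2 :=
  fun φ he hz hintg => by
    rw [← intervalIntegral.integral_add_adjacent_intervals (hintg _ 0) (hintg 0 _),
      integral_neg_eq_of_even he, integral_eq_of_support hz hintg hd,
      integral_eq_of_support hz hintg ha]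
    ring

/-- Rescaled bumps on a bounded interval. -/
theorem IsBump.rescale {f : ℝ → ℝ} {L K : ℝ} (hf : IsBump f L K) {lam d ℓ n : ℝ} (hlam : 0 < lam)
    (hℓ : 0 ≤ ℓ) (hcov : CoversHalves L d (lam * ℓ - d) n) :
    MetricGraph.MemH1On (Icc 0 ℓ) (fun x => √lam * f (lam * x - d)) ∧
    (∫ x in Icc 0 ℓ, |√lam * f (lam * x - d)| ^ 2 = n * ∫ x in (0 : ℝ)..L, |f x| ^ 2) ∧
    (∫ x in Icc 0 ℓ, |deriv (fun x => √lam * f (lam * x - d)) x| ^ 2 =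
      lam ^ 2 * (n * ∫ x in (0 : ℝ)..L, |deriv f x| ^ 2)) ∧
    (∫ x in Icc 0 ℓ, |√lam * f (lam * x - d)| ^ 6 =
      lam ^ 2 * (n * ∫ x in (0 : ℝ)..L, |f x| ^ 6)) := by
  have hsq : √lam ^ 2 = lam := Real.sq_sqrt hlam.le
  have hs0 : 0 ≤ √lam := Real.sqrt_nonneg _
  have conv : ∀ φ : ℝ → ℝ, ∫ x in Icc 0 ℓ, φ (lam * x - d) =
      lam⁻¹ * ∫ x in (-d)..(lam * ℓ - d), φ x := fun φ => by
    rw [integral_Icc_eq_integral_Ioc, ← intervalIntegral.integral_of_le hℓ,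
      intervalIntegral.integral_comp_mul_sub φ hlam.ne', mul_zero, zero_sub, smul_eq_mul]
  have hpow : ∀ k, k ≠ 0 → ∫ x in (-d)..(lam * ℓ - d), |f x| ^ k =
      n * ∫ x in (0 : ℝ)..L, |f x| ^ k := fun k hk =>
    hcov (fun x => |f x| ^ k) (fun x => by rw [hf.even])
      (fun x hx => by rw [hf.eq_zero x hx.le]; simp [hk])
      fun a b => (hf.continuous.abs.pow k).intervalIntegrable a b
  refine ⟨memH1On_of_lipschitz (K := √lam * (K * lam)) (fun x y => ?_) ℓ, ?_, ?_, ?_⟩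
  · rw [← mul_sub, abs_mul, abs_of_nonneg hs0, mul_assoc, mul_assoc]
    refine mul_le_mul_of_nonneg_left ((hf.lipschitz _ _).trans (le_of_eq ?_)) hs0
    rw [sub_sub_sub_cancel_right, ← mul_sub, abs_mul, abs_of_pos hlam]
  · simp only [abs_mul, mul_pow, abs_of_nonneg hs0]
    rw [integral_const_mul, conv fun x => |f x| ^ 2, hpow 2 two_ne_zero, hsq]
    field_simp
  · have hd : ∀ x, deriv (fun x => √lam * f (lam * x - d)) x =
        √lam * (lam * deriv f (lam * x - d)) := fun x => by
      rw [deriv_const_mul_field]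
      have h1 := deriv_comp_mul_left lam (fun y => f (y - d)) x
      rw [deriv_comp_sub_const, smul_eq_mul] at h1
      rw [← h1]
    simp only [hd, abs_mul, mul_pow, abs_of_nonneg hs0, abs_of_pos hlam]
    rw [integral_const_mul, integral_const_mul, conv fun x => |deriv f x| ^ 2,
      hcov (fun x => |deriv f x| ^ 2) (fun x => by rw [hf.abs_deriv_even])
        (fun x hx => by rw [hf.deriv_eq_zero hx]; simp) hf.intervalIntegrable_deriv_sq, hsq]
    field_simp
  · simp only [abs_mul, mul_pow, abs_of_nonneg hs0]
    rw [integral_const_mul, conv fun x => |f x| ^ 6, hpow 6 (by norm_num),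
      show √lam ^ 6 = (√lam ^ 2) ^ 3 by ring, hsq]
    field_simp

/-! ### Test functions on the graph: single edges and plateaus -/

namespace MetricGraph

variable {V B H : Type*} {G : MetricGraph V B H}

open Classical in
/-- The function equal to `F` on the bounded edge `b₀` and to zero elsewhere. -/
noncomputable def edgeFunction (b₀ : B) (F : ℝ → ℝ) : B ⊕ H → ℝ → ℝ := fun e =>
  if e = Sum.inl b₀ then F else fun _ => 0

theorem edgeFunction_self (b₀ : B) (F : ℝ → ℝ) :
    edgeFunction (H := H) b₀ F (Sum.inl b₀) = F := by simp [edgeFunction]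

theorem edgeFunction_of_ne {b₀ b : B} (hb : b ≠ b₀) (F : ℝ → ℝ) :
    edgeFunction (H := H) b₀ F (Sum.inl b) = fun _ => 0 := by simp [edgeFunction, hb]

theorem edgeFunction_inr (b₀ : B) (h : H) (F : ℝ → ℝ) :
    edgeFunction b₀ F (Sum.inr h) = fun _ => 0 := by simp [edgeFunction]

theorem edgeFunction_mem_H1 {b₀ : B} {F : ℝ → ℝ} (hF : MemH1On (Icc 0 (G.len b₀)) F)
    (hA : G.AgreesAtVertices (edgeFunction b₀ F)) : edgeFunction b₀ F ∈ G.H1 := by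
  have hz : ∀ I : Set ℝ, MemH1On I fun _ => 0 := fun I =>
    ⟨fun x _ => ContDiffOn.absolutelyContinuousOnInterval contDiffOn_const, by simp, by simp⟩
  refine ⟨?_, hA⟩
  rintro (b | h)
  · by_cases hb : b = b₀
    · subst hb
      rw [edgeFunction_self]
      exact hF
    · rw [edgeFunction_of_ne hb]
      exact hz _
  · rw [edgeFunction_inr]
    exact hz _

/-- Connectedness and the presence of a bounded edge put one at every vertex, so at a vertex of
degree one the only edge is bounded; a loop would count twice. -/
theorem HasTerminalEdge.exists_edge [Fintype B] [Fintype H] (hG : G.HasTerminalEdge)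
    (hconn : G.Connected) (hB : Nonempty B) : ∃ b₀ v,
      (G.src b₀ = v ∧ G.tgt b₀ ≠ v ∨ G.tgt b₀ = v ∧ G.src b₀ ≠ v) ∧
      (∀ b, b ≠ b₀ → G.src b ≠ v ∧ G.tgt b ≠ v) ∧ ∀ h, G.root h ≠ v := by
  obtain ⟨-, v, -, hdeg⟩ := hG
  obtain ⟨b₀, hb₀⟩ := hconn.exists_incident hB v
  unfold degree at hdeg
  have emp : ∀ {α : Type _} [Finite α] {p : α → Prop}, Nat.card {a // p a} = 0 → ∀ a, ¬ p a := by
    intro α _ p h a ha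
    have := Finite.card_eq_zero_iff.1 h
    exact this.false ⟨a, ha⟩
  have uniq : ∀ {p : B → Prop}, Nat.card {a // p a} = 1 → ∀ a b, p a → p b → a = b := by
    intro p h a b ha hb
    have := (Finite.card_le_one_iff_subsingleton.1 h.le).elim ⟨a, ha⟩ ⟨b, hb⟩
    exact congrArg Subtype.val this
  rcases hb₀ with hb₀ | hb₀
  · have hpos : 0 < Nat.card {b : B // G.src b = v} := by
      have : Nonempty {b : B // G.src b = v} := ⟨⟨b₀, hb₀.symm⟩⟩
      exact Nat.card_pos
    have e2 := emp (p := fun b => G.tgt b = v) (by omega)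
    have e3 : Nat.card {h : H // G.root h = v} = 0 := by omega
    have e1 := uniq (p := fun b => G.src b = v) (by omega)
    refine ⟨b₀, v, Or.inl ⟨hb₀.symm, e2 b₀⟩, fun b hb => ⟨fun h => hb (e1 b b₀ h hb₀.symm), e2 b⟩,
      fun h hh => ?_⟩
    exact (Finite.card_eq_zero_iff.1 e3).false ⟨h, hh⟩
  · have hpos : 0 < Nat.card {b : B // G.tgt b = v} := by
      have : Nonempty {b : B // G.tgt b = v} := ⟨⟨b₀, hb₀.symm⟩⟩
      exact Nat.card_pos
    have e2 := emp (p := fun b => G.src b = v) (by omega)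
    have e3 : Nat.card {h : H // G.root h = v} = 0 := by omega
    have e1 := uniq (p := fun b => G.tgt b = v) (by omega)
    refine ⟨b₀, v, Or.inr ⟨hb₀.symm, e2 b₀⟩, fun b hb => ⟨e2 b, fun h => hb (e1 b b₀ h hb₀.symm)⟩,
      fun h hh => ?_⟩
    exact (Finite.card_eq_zero_iff.1 e3).false ⟨h, hh⟩

theorem coreSextic_edgeFunction [Fintype B] (b₀ : B) (F : ℝ → ℝ) :
    G.coreSextic (edgeFunction b₀ F) = ∫ x in Icc 0 (G.len b₀), |F x| ^ 6 := by
  rw [coreSextic_eq, Finset.sum_eq_single b₀, edgeFunction_self]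
  · intro b _ hb
    rw [edgeFunction_of_ne hb]
    simp
  · simp

/-- The function equal to `1 + ε x (ℓ - x)` on bounded edges and to a decaying exponential on
half-lines. -/
noncomputable def plateau (G : MetricGraph V B H) (ε κ : ℝ) : B ⊕ H → ℝ → ℝ
  | Sum.inl b => fun x => 1 + ε * (x * (G.len b - x))
  | Sum.inr _ => fun x => 1 * Real.exp (-κ * x)

theorem plateau_mem_H1 (ε : ℝ) {κ : ℝ} (hκ : 0 < κ) : G.plateau ε κ ∈ G.H1 := by
  refine ⟨?_, fun _ => 1, fun b => ⟨by simp [plateau], by simp [plateau]⟩,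
    fun h => by simp [plateau]⟩
  rintro (b | h)
  · change MemH1On (Icc 0 (G.len b)) fun x => 1 + ε * (x * (G.len b - x))
    have hc : ContDiff ℝ 1 fun x : ℝ => 1 + ε * (x * (G.len b - x)) := by fun_prop
    refine ⟨fun x _ => hc.contDiffOn.absolutelyContinuousOnInterval, ?_, ?_⟩
    · rw [memLp_two_iff_integrable_sq hc.continuous.aestronglyMeasurable]
      exact (hc.continuous.pow 2).continuousOn.integrableOn_compact isCompact_Icc
    · have hd := hc.continuous_deriv le_rfl
      refine (memLp_two_iff_integrable_sq hd.aestronglyMeasurable).2 ?_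
      exact (hd.pow 2).continuousOn.integrableOn_compact isCompact_Icc
  · exact (memH1On_exp 1 hκ).1

theorem H1.const_mul (c : ℝ) {u : B ⊕ H → ℝ → ℝ} (hu : u ∈ G.H1) :
    (fun e x => c * u e x) ∈ G.H1 := by
  obtain ⟨hu, w, hw, hw'⟩ := hu
  refine ⟨fun e => ⟨fun x hx => ((hu e).1 x hx).const_mul c, (hu e).2.1.const_mul c, ?_⟩,
    fun v => c * w v, fun b => ?_, fun h => ?_⟩
  · have : deriv (fun x => c * u e x) = fun x => c * deriv (u e) x := by
      ext x
      rw [deriv_const_mul_field]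
    rw [this]
    exact (hu e).2.2.const_mul c
  · simp only [(hw b).1, (hw b).2, and_self]
  · simp only [hw' h]

theorem coreSextic_const_mul [Fintype B] (c : ℝ) (u : B ⊕ H → ℝ → ℝ) :
    G.coreSextic (fun e x => c * u e x) = c ^ 6 * G.coreSextic u := by
  simp only [coreSextic, abs_mul, mul_pow, show |c| ^ 6 = c ^ 6 from Even.pow_abs ⟨3, rfl⟩ c,
    integral_const_mul, Finset.mul_sum]

theorem sum_len_pos [Fintype B] (hB : Nonempty B) : 0 < ∑ b, G.len b :=
  Finset.sum_pos (fun b _ => G.len_pos b) Finset.univ_nonempty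

variable [Fintype B] [Fintype H]

theorem sum_edgeFunction (b₀ : B) (F : ℝ → ℝ) (φ : B ⊕ H → (ℝ → ℝ) → ℝ)
    (hφ : ∀ e, φ e (fun _ => 0) = 0) :
    ∑ e, φ e (edgeFunction b₀ F e) = φ (Sum.inl b₀) F := by
  rw [Finset.sum_eq_single (Sum.inl b₀), edgeFunction_self]
  · rintro (b | h) - hne
    · rw [edgeFunction_of_ne (by simpa using hne), hφ]
    · rw [edgeFunction_inr, hφ]
  · simp

theorem mass_edgeFunction (b₀ : B) (F : ℝ → ℝ) :
    G.mass (edgeFunction b₀ F) = ∫ x in Icc 0 (G.len b₀), |F x| ^ 2 :=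
  sum_edgeFunction b₀ F (fun e f => ∫ x in G.interval e, |f x| ^ 2) (by simp)

theorem kinetic_edgeFunction (b₀ : B) (F : ℝ → ℝ) :
    G.kinetic (edgeFunction b₀ F) = ∫ x in Icc 0 (G.len b₀), |deriv F x| ^ 2 :=
  sum_edgeFunction b₀ F (fun e f => ∫ x in G.interval e, |deriv f x| ^ 2) (by simp)

theorem infEnergy_eq_bot_iff {μ : ℝ} :
    G.infEnergy μ = ⊥ ↔ ∀ r : ℝ, ∃ u ∈ G.H1mass μ, G.energy u < r := by
  rw [EReal.eq_bot_iff_forall_lt]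
  refine forall_congr' fun r => ?_
  simp only [infEnergy, iInf_lt_iff, EReal.coe_lt_coe_iff, exists_prop]

/-- Concentrating bumps drive the energy to `-∞`. -/
theorem infEnergy_eq_bot_of_bump {μ n : ℝ} (hn : 0 < n) (hμ : n * criticalMassHalfLine < μ) (b₀ : B)
    (d : ℝ → ℝ) (hcov : ∀ L > 0, ∀ᶠ lam in atTop,
      CoversHalves L (d lam) (lam * G.len b₀ - d lam) n)
    (hA : ∀ f L K, IsBump f L K → ∀ᶠ lam in atTop,
      G.AgreesAtVertices (edgeFunction b₀ fun x => √lam * f (lam * x - d lam))) :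
    G.infEnergy μ = ⊥ := by
  obtain ⟨f, L, K, hf, hmass, hneg⟩ := exists_isBump (μ := μ / n) (by rwa [lt_div_iff₀' hn])
  rw [infEnergy_eq_bot_iff]
  intro r
  -- At fixed mass both energy terms scale by `lam²`, so the rescaled energy is `-lam² a` with `a >
  -- 0`.
  set a := n * (1 / 6 * (∫ x in (0 : ℝ)..L, |f x| ^ 6) -
    1 / 2 * ∫ x in (0 : ℝ)..L, |deriv f x| ^ 2) with ha
  have hapos : 0 < a := mul_pos hn (by linarith)
  have hlim : ∀ᶠ lam : ℝ in atTop, -r < lam ^ 2 * a :=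
    ((tendsto_pow_atTop two_ne_zero).atTop_mul_const hapos).eventually_gt_atTop (-r)
  obtain ⟨lam, h1, h2, h3, h4⟩ := ((hcov L hf.L_pos).and ((hA f L K hf).and
    (hlim.and (eventually_gt_atTop 0)))).exists
  obtain ⟨m1, m2, m3, m4⟩ := hf.rescale h4 (G.len_pos b₀).le h1
  refine ⟨_, ⟨edgeFunction_mem_H1 m1 h2, ?_⟩, ?_⟩
  · rw [mass_edgeFunction, m2, hmass]
    field_simp
  · rw [energy, kinetic_edgeFunction, coreSextic_edgeFunction, m3, m4]
    rw [ha] at h3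
    linarith

/-- Both halves of a bump centred at the midpoint of a bounded edge eventually fit inside it. -/
theorem infEnergy_eq_bot (hB : Nonempty B) {μ : ℝ} (hμ : criticalMassLine < μ) :
    G.infEnergy μ = ⊥ := by
  obtain ⟨b₀⟩ := hB
  have hev : ∀ L, ∀ᶠ lam in atTop, L ≤ lam * G.len b₀ / 2 := fun L => by
    filter_upwards [eventually_ge_atTop (2 * L / G.len b₀)] with lam h
    rw [div_le_iff₀ (G.len_pos b₀)] at h
    linarith
  refine infEnergy_eq_bot_of_bump two_pos (by
    unfold criticalMassHalfLine; linarith) b₀ (fun lam => lam * G.len b₀ / 2) (fun L _ => ?_)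
    fun f L K hf => ?_
  · filter_upwards [hev L] with lam h
    exact coversHalves_both h (by linarith)
  · filter_upwards [hev L] with lam h
    refine ⟨fun _ => 0, fun b => ?_, fun k => by rw [edgeFunction_inr]⟩
    by_cases hb : b = b₀
    · subst hb
      rw [edgeFunction_self]
      constructor
      · rw [mul_zero, zero_sub, hf.even, hf.eq_zero _ h, mul_zero]
      · rw [hf.eq_zero _ (by linarith), mul_zero]
    · rw [edgeFunction_of_ne hb]
      exact ⟨rfl, rfl⟩

/-- Half a bump can peak at the terminal vertex, where no other edge constrains its value, so half
the mass suffices. -/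
theorem HasTerminalEdge.infEnergy_eq_bot (hG : G.HasTerminalEdge) (hconn : G.Connected)
    (hB : Nonempty B) {μ : ℝ} (hμ : criticalMassHalfLine < μ) : G.infEnergy μ = ⊥ := by
  classical
  obtain ⟨b₀, v, hv, hother, hroot⟩ := hG.exists_edge hconn hB
  have hev : ∀ L, ∀ᶠ lam in atTop, L ≤ lam * G.len b₀ := fun L => by
    filter_upwards [eventually_ge_atTop (L / G.len b₀)] with lam h
    rwa [div_le_iff₀ (G.len_pos b₀)] at h
  rcases hv with ⟨hv, hv'⟩ | ⟨hv, hv'⟩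
  · refine infEnergy_eq_bot_of_bump one_pos (by linarith) b₀ (fun _ => 0) (fun L _ => ?_)
      fun f L K hf => ?_
    · filter_upwards [hev L] with lam h
      exact coversHalves_right (by linarith)
    · filter_upwards [hev L] with lam h
      refine ⟨fun x => if x = v then √lam * f (lam * 0 - 0) else 0, fun b => ?_, fun k => ?_⟩
      · by_cases hb : b = b₀
        · subst hb
          beta_reduce
          rw [edgeFunction_self, if_pos hv, if_neg hv', hf.eq_zero (lam * G.len b - 0) (by linarith)]
          exact ⟨rfl, mul_zero _⟩
        · beta_reduce
          rw [edgeFunction_of_ne hb, if_neg (hother b hb).1, if_neg (hother b hb).2]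
          exact ⟨rfl, rfl⟩
      · beta_reduce
        rw [edgeFunction_inr, if_neg (hroot k)]
  · refine infEnergy_eq_bot_of_bump one_pos (by linarith) b₀ (fun lam => lam * G.len b₀)
      (fun L _ => ?_) fun f L K hf => ?_
    · filter_upwards [hev L] with lam h
      rw [sub_self]
      exact coversHalves_left h
    · filter_upwards [hev L] with lam h
      refine ⟨fun x => if x = v then √lam * f (lam * G.len b₀ - lam * G.len b₀) else 0,
        fun b => ?_, fun k => ?_⟩
      · by_cases hb : b = b₀
        · subst hb
          beta_reduce
          rw [edgeFunction_self, if_pos hv, if_neg hv', mul_zero, zero_sub, hf.even,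
            hf.eq_zero _ h]
          exact ⟨mul_zero _, rfl⟩
        · beta_reduce
          rw [edgeFunction_of_ne hb, if_neg (hother b hb).1, if_neg (hother b hb).2]
          exact ⟨rfl, rfl⟩
      · beta_reduce
        rw [edgeFunction_inr, if_neg (hroot k)]

theorem exists_plateau_estimates (hB : Nonempty B) : ∃ P Q D : ℝ, 0 < P ∧ ∀ ε κ : ℝ, 0 ≤ ε → 0 < κ →
    G.mass (G.plateau ε κ) =
      (∑ b, G.len b) + 2 * ε * P + ε ^ 2 * Q + Fintype.card H / (2 * κ) ∧
    G.kinetic (G.plateau ε κ) = ε ^ 2 * D + Fintype.card H * κ / 2 ∧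
    (∑ b, G.len b) + 6 * ε * P ≤ G.coreSextic (G.plateau ε κ) := by
  have hcont : ∀ b, Continuous fun x : ℝ => x * (G.len b - x) := fun b => by fun_prop
  have hintg : ∀ (b : B) {f : ℝ → ℝ}, Continuous f → IntegrableOn f (Icc 0 (G.len b)) :=
    fun b f hf => hf.continuousOn.integrableOn_compact isCompact_Icc
  refine ⟨∑ b, ∫ x in Icc 0 (G.len b), x * (G.len b - x),
    ∑ b, ∫ x in Icc 0 (G.len b), (x * (G.len b - x)) ^ 2,
    ∑ b, ∫ x in Icc 0 (G.len b), (G.len b - 2 * x) ^ 2, ?_, fun ε κ hε hκ => ⟨?_, ?_, ?_⟩⟩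
  · refine Finset.sum_pos (fun b _ => ?_) Finset.univ_nonempty
    rw [integral_Icc_eq_integral_Ioc, ← intervalIntegral.integral_of_le (G.len_pos b).le]
    exact intervalIntegral.intervalIntegral_pos_of_pos_on ((hcont b).intervalIntegrable _ _)
      (fun x hx => mul_pos hx.1 (sub_pos.2 hx.2)) (G.len_pos b)
  · rw [mass_eq]
    obtain ⟨-, h2, -⟩ := memH1On_exp 1 hκ
    simp only [plateau, h2, Finset.mul_sum, ← Finset.sum_add_distrib]
    congr 1
    · refine Finset.sum_congr rfl fun b _ => ?_
      have : ∀ x, |1 + ε * (x * (G.len b - x))| ^ 2 =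
          1 + 2 * ε * (x * (G.len b - x)) + ε ^ 2 * (x * (G.len b - x)) ^ 2 := fun x => by
        rw [sq_abs]; ring
      simp only [this]
      rw [integral_add (hintg b (by fun_prop)) (hintg b (by fun_prop)),
        integral_add (hintg b (by fun_prop)) (hintg b (by fun_prop)), integral_const_mul,
        integral_const_mul]
      simp [(G.len_pos b).le]
    · simp
      ring
  · rw [kinetic_eq]
    obtain ⟨-, -, h3⟩ := memH1On_exp 1 hκ
    simp only [plateau, h3, Finset.mul_sum]
    congr 1
    · refine Finset.sum_congr rfl fun b _ => ?_
      have : ∀ x, deriv (fun x => 1 + ε * (x * (G.len b - x))) x = ε * (G.len b - 2 * x) :=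
        fun x => by
          have h1 : HasDerivAt (fun x => x * (G.len b - x)) (1 * (G.len b - x) + x * (-1)) x :=
            (hasDerivAt_id x).mul ((hasDerivAt_id x).const_sub _)
          rw [((h1.const_mul ε).const_add 1).deriv]
          ring
      simp only [this, sq_abs, mul_pow]
      rw [integral_const_mul]
    · simp
      ring
  · rw [coreSextic_eq]
    simp only [plateau, Finset.mul_sum, ← Finset.sum_add_distrib]
    refine Finset.sum_le_sum fun b _ => ?_
    have h1 : ∫ x in Icc 0 (G.len b), (1 + 6 * ε * (x * (G.len b - x))) =
        G.len b + 6 * ε * ∫ x in Icc 0 (G.len b), x * (G.len b - x) := by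
      rw [integral_add (hintg b (by fun_prop)) (hintg b (by fun_prop)), integral_const_mul]
      simp [(G.len_pos b).le]
    rw [← h1]
    refine setIntegral_mono_on (hintg b (by fun_prop)) (hintg b (by fun_prop)) measurableSet_Icc
      fun x hx => ?_
    have hp : 0 ≤ ε * (x * (G.len b - x)) :=
      mul_nonneg hε (mul_nonneg hx.1 (sub_nonneg.2 hx.2))
    have := one_add_mul_le_pow (a := ε * (x * (G.len b - x))) (by linarith) 6
    rw [abs_of_nonneg (by linarith)]
    norm_num at this
    linarith

/-- For `ε = 0` and `κ = 1/(2Λ)`, `Λ` being the length of the core, core and half-line have equal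
mass and both sides equal `Λ`. To first order in `ε` the left side grows by `2Pε`, while the right
side grows by at least `6Pε`. -/
theorem exists_mass_sq_mul_kinetic_lt_coreSextic (hB : Nonempty B) (hH : Fintype.card H = 1) :
    ∃ u ∈ G.H1, 0 < G.mass u ∧ G.mass u ^ 2 * G.kinetic u < G.coreSextic u := by
  obtain ⟨P, Q, D, hP, hest⟩ := G.exists_plateau_estimates hB
  have hΛ := G.sum_len_pos hB
  set Λ := ∑ b, G.len b
  -- The gap `Λ + 6εP - mass² · kinetic` divided by `ε`, written so that it is continuous at `0`.
  let g : ℝ → ℝ := fun ε => 4 * P - ε * Q - ε * (2 * P + ε * Q) ^ 2 / (4 * Λ) -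
    ε * D * (2 * Λ + ε * (2 * P + ε * Q)) ^ 2
  have hg : Continuous g := by fun_prop
  have hg0 : 0 < g 0 := by simp [g, hP]
  have hm : Continuous fun ε : ℝ => 2 * Λ + 2 * ε * P + ε ^ 2 * Q := by fun_prop
  have e1 : ∀ᶠ ε in 𝓝[>] (0 : ℝ), 0 < g ε :=
    (hg.continuousAt.eventually (lt_mem_nhds hg0)).filter_mono nhdsWithin_le_nhds
  have e2 : ∀ᶠ ε in 𝓝[>] (0 : ℝ), 0 < 2 * Λ + 2 * ε * P + ε ^ 2 * Q :=
    (hm.continuousAt.eventually (lt_mem_nhds (by simpa using hΛ))).filter_mono nhdsWithin_le_nhds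
  obtain ⟨ε, hgε, hmε, hε⟩ := (e1.and (e2.and self_mem_nhdsWithin)).exists
  replace hε : 0 < ε := hε
  have hκ : 0 < 1 / (2 * Λ) := by positivity
  obtain ⟨h1, h2, h3⟩ := hest ε (1 / (2 * Λ)) hε.le hκ
  rw [hH] at h1 h2
  have h1' : G.mass (G.plateau ε (1 / (2 * Λ))) = 2 * Λ + 2 * ε * P + ε ^ 2 * Q := by
    rw [h1]; field_simp; push_cast; ring
  refine ⟨_, plateau_mem_H1 ε hκ, h1' ▸ hmε, lt_of_lt_of_le ?_ h3⟩
  rw [h1', h2]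
  have key : Λ + 6 * ε * P - (2 * Λ + 2 * ε * P + ε ^ 2 * Q) ^ 2 *
      (ε ^ 2 * D + ((1 : ℕ) : ℝ) * (1 / (2 * Λ)) / 2) = ε * g ε := by
    simp only [g]; field_simp; push_cast; ring
  have := mul_pos hε hgε
  linarith

theorem mass_const_mul (c : ℝ) (u : B ⊕ H → ℝ → ℝ) :
    G.mass (fun e x => c * u e x) = c ^ 2 * G.mass u := by
  simp only [mass, abs_mul, mul_pow, sq_abs c, integral_const_mul, Finset.mul_sum]

theorem kinetic_const_mul (c : ℝ) (u : B ⊕ H → ℝ → ℝ) :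
    G.kinetic (fun e x => c * u e x) = c ^ 2 * G.kinetic u := by
  simp only [kinetic, deriv_const_mul_field, abs_mul, mul_pow, sq_abs c, integral_const_mul,
    Finset.mul_sum]

end MetricGraph

theorem criticalMassHalfLine_pos : 0 < criticalMassHalfLine := by
  unfold criticalMassHalfLine criticalMassLine; positivity

theorem criticalMassHalfLine_lt : criticalMassHalfLine < criticalMassLine := by
  have := criticalMassHalfLine_pos
  unfold criticalMassHalfLine at *
  linarith

theorem sqrt_three_lt_criticalMassLine : √3 < criticalMassLine := by
  have h1 : 0 < √(3 : ℝ) := by positivity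
  have h2 := Real.pi_gt_three
  unfold criticalMassLine
  nlinarith

/-! ### Rescaling, and the energy in terms of the quotient -/

namespace MetricGraph

variable {V B H : Type*} {G : MetricGraph V B H} [Fintype B]

theorem coreSextic_le_sum_len {u : B ⊕ H → ℝ → ℝ} {R : ℝ} (hu : u ∈ G.H1)
    (hR : ∀ b, ∀ x ∈ Icc 0 (G.len b), u (Sum.inl b) x ^ 2 ≤ R) :
    G.coreSextic u ≤ R ^ 3 * ∑ b, G.len b := by
  rw [coreSextic_eq, Finset.mul_sum]
  refine Finset.sum_le_sum fun b _ => ?_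
  have h1 : ∫ _ in Icc 0 (G.len b), R ^ 3 = R ^ 3 * G.len b := by
    simp [(G.len_pos b).le, mul_comm]
  rw [← h1]
  refine setIntegral_mono_on (H1.integrableOn_pow hu b 6) (by simp) measurableSet_Icc
    fun x hx => ?_
  rw [show |u (Sum.inl b) x| ^ 6 = (|u (Sum.inl b) x| ^ 2) ^ 3 by ring, sq_abs]
  exact pow_le_pow_left₀ (sq_nonneg _) (hR b x hx) 3

variable [Fintype H] {μ : ℝ}
  {u : B ⊕ H → ℝ → ℝ}

theorem exists_rescale (hu : u ∈ G.H1) (hM : 0 < G.mass u) (hμ : 0 < μ) :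
    ∃ v ∈ G.H1mass μ, G.kinetic v = μ / G.mass u * G.kinetic u ∧
      G.coreSextic v = (μ / G.mass u) ^ 3 * G.coreSextic u := by
  have hsq : √(μ / G.mass u) ^ 2 = μ / G.mass u := Real.sq_sqrt (by positivity)
  refine ⟨fun e x => √(μ / G.mass u) * u e x, ⟨H1.const_mul _ hu, ?_⟩, ?_, ?_⟩
  · rw [mass_const_mul, hsq]
    field_simp
  · rw [kinetic_const_mul, hsq]
  · rw [coreSextic_const_mul, show √(μ / G.mass u) ^ 6 = (√(μ / G.mass u) ^ 2) ^ 3 by ring, hsq]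

theorem exists_rescale_quotient (hu : u ∈ G.H1) (hM : 0 < G.mass u) (hμ : 0 < μ) :
    ∃ v ∈ G.H1mass μ, G.quotient v = G.quotient u := by
  obtain ⟨v, hv, hT, hS⟩ := exists_rescale hu hM hμ
  refine ⟨v, hv, ?_⟩
  rw [quotient, quotient, hv.2, hT, hS]
  -- Without kinetic energy both quotients are divisions by zero, hence `0`.
  rcases (G.kinetic_nonneg u).eq_or_lt with h | h
  · simp [← h]
  · field_simp

/-- The sign of the energy is that of `3 - m²Q`; this is what connects `μ_K` with the energy level.
-/
theorem energy_eq (hM : 0 < G.mass u) (hT : 0 < G.kinetic u) :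
    G.energy u = G.kinetic u / 6 * (3 - G.mass u ^ 2 * G.quotient u) := by
  rw [energy, quotient]
  field_simp
  ring

/-! ### The sharp constant -/

/-- The quotient is invariant under scaling, so the mass may be taken equal to `N μ_{R⁺}`, where the
energy is positive. -/
theorem quotient_le (hconn : G.Connected) (hH : Nonempty H) (hB : Nonempty B) (hu : u ∈ G.H1)
    (hM : 0 < G.mass u) {N : ℝ} (hN : G.HasMultiplicity N) (hN0 : 0 < N) :
    G.quotient u ≤ 3 / (N * criticalMassHalfLine) ^ 2 := by
  have hpos : 0 < N * criticalMassHalfLine := mul_pos hN0 criticalMassHalfLine_pos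
  obtain ⟨v, hv, hq⟩ := exists_rescale_quotient hu hM hpos
  have hv0 : 0 < G.mass v := hv.2 ▸ hpos
  have hT := kinetic_pos (hasMultiplicity_one hconn hH) hB hv.1 hv0
  have hE := hN.energy_pos hconn hH hB hv.1 hv0 hv.2.le
  rw [energy_eq hv0 hT, hv.2, hq] at hE
  have := pos_of_mul_pos_right hE (by positivity)
  rw [le_div_iff₀ (by positivity)]
  linarith

theorem mass_pos_of_ne (hu : G.mass u ≠ 0) : 0 < G.mass u := (G.mass_nonneg u).lt_of_ne' hu

theorem plateau_mass_pos (hH : Nonempty H) (hB : Nonempty B) {κ : ℝ} (hκ : 0 < κ) :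
    0 < G.mass (G.plateau 0 κ) ∧ 0 < G.coreSextic (G.plateau 0 κ) ∧
      G.kinetic (G.plateau 0 κ) ≤ κ ^ 2 * G.mass (G.plateau 0 κ) := by
  obtain ⟨P, Q, D, hP, hest⟩ := G.exists_plateau_estimates hB
  obtain ⟨h1, h2, h3⟩ := hest 0 κ le_rfl hκ
  have hΛ := G.sum_len_pos hB
  rw [h1, h2]
  refine ⟨?_, lt_of_lt_of_le (by linarith) h3, ?_⟩
  · simp only [mul_zero, zero_mul, add_zero, ne_eq, OfNat.ofNat_ne_zero, not_false_eq_true, zero_pow]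
    positivity
  · have : κ ^ 2 * (Fintype.card H / (2 * κ)) = Fintype.card H * κ / 2 := by field_simp
    have h4 : 0 ≤ κ ^ 2 * ∑ b, G.len b := by positivity
    linarith

theorem isLUB_sharpConstant (hconn : G.Connected) (hH : Nonempty H) (hB : Nonempty B) :
    IsLUB G.quotientValues G.sharpConstant := by
  obtain ⟨h1, -, -⟩ := G.plateau_mass_pos hH hB one_pos
  refine isLUB_csSup ⟨_, _, plateau_mem_H1 0 one_pos, h1.ne', rfl⟩
    ⟨3 / (1 * criticalMassHalfLine) ^ 2, ?_⟩
  rintro _ ⟨u, hu, hu0, rfl⟩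
  exact quotient_le hconn hH hB hu (mass_pos_of_ne hu0) (hasMultiplicity_one hconn hH) one_pos

theorem sharpConstant_pos (hconn : G.Connected) (hH : Nonempty H) (hB : Nonempty B) :
    0 < G.sharpConstant := by
  obtain ⟨h1, h2, -⟩ := G.plateau_mass_pos hH hB one_pos
  have hT := kinetic_pos (hasMultiplicity_one hconn hH) hB (plateau_mem_H1 0 one_pos) h1
  refine lt_of_lt_of_le (div_pos h2 (mul_pos (pow_pos h1 2) hT))
    ((isLUB_sharpConstant hconn hH hB).1 ⟨_, plateau_mem_H1 0 one_pos, h1.ne', rfl⟩)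

theorem reducedCriticalMass_sq (hconn : G.Connected) (hH : Nonempty H) (hB : Nonempty B) :
    G.reducedCriticalMass ^ 2 * G.sharpConstant = 3 := by
  have := sharpConstant_pos hconn hH hB
  rw [reducedCriticalMass, Real.sq_sqrt (by positivity)]
  field_simp

theorem reducedCriticalMass_pos (hconn : G.Connected) (hH : Nonempty H) (hB : Nonempty B) :
    0 < G.reducedCriticalMass := by
  have := sharpConstant_pos hconn hH hB
  rw [reducedCriticalMass]
  positivity

theorem le_reducedCriticalMass (hconn : G.Connected) (hH : Nonempty H) (hB : Nonempty B) {N : ℝ}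
    (hN : G.HasMultiplicity N) (hN0 : 0 < N) :
    N * criticalMassHalfLine ≤ G.reducedCriticalMass := by
  have hpos : 0 < N * criticalMassHalfLine := mul_pos hN0 criticalMassHalfLine_pos
  have h1 : G.sharpConstant ≤ 3 / (N * criticalMassHalfLine) ^ 2 := by
    refine (isLUB_sharpConstant hconn hH hB).2 ?_
    rintro _ ⟨u, hu, hu0, rfl⟩
    exact quotient_le hconn hH hB hu (mass_pos_of_ne hu0) hN hN0
  have hC := sharpConstant_pos hconn hH hB
  rw [le_div_iff₀ (by positivity)] at h1
  refine Real.le_sqrt_of_sq_le ?_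
  rw [le_div_iff₀ hC]
  linarith

theorem energy_pos_of_mass_lt (hconn : G.Connected) (hH : Nonempty H) (hB : Nonempty B)
    (hu : u ∈ G.H1) (h0 : 0 < G.mass u) (hlt : G.mass u < G.reducedCriticalMass) :
    0 < G.energy u := by
  have hT := kinetic_pos (hasMultiplicity_one hconn hH) hB hu h0
  have hC := sharpConstant_pos hconn hH hB
  rw [energy_eq h0 hT]
  have hq : G.quotient u ≤ G.sharpConstant :=
    (isLUB_sharpConstant hconn hH hB).1 ⟨u, hu, h0.ne', rfl⟩
  have h1 : G.mass u ^ 2 * G.quotient u ≤ G.mass u ^ 2 * G.sharpConstant := by gcongr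
  have h2 : G.mass u ^ 2 * G.sharpConstant < G.reducedCriticalMass ^ 2 * G.sharpConstant := by
    gcongr
  rw [reducedCriticalMass_sq hconn hH hB] at h2
  exact mul_pos (by positivity) (by linarith)

theorem energy_nonneg_of_mass_le (hconn : G.Connected) (hH : Nonempty H) (hB : Nonempty B)
    (hu : u ∈ G.H1) (h0 : 0 < G.mass u) (hle : G.mass u ≤ G.reducedCriticalMass) :
    0 ≤ G.energy u := by
  have hT := kinetic_pos (hasMultiplicity_one hconn hH) hB hu h0
  have hC := sharpConstant_pos hconn hH hB
  rw [energy_eq h0 hT]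
  have hq : G.quotient u ≤ G.sharpConstant :=
    (isLUB_sharpConstant hconn hH hB).1 ⟨u, hu, h0.ne', rfl⟩
  have hq0 : 0 ≤ G.quotient u :=
    div_nonneg (G.coreSextic_nonneg u) (by positivity)
  have h1 : G.mass u ^ 2 * G.quotient u ≤ G.reducedCriticalMass ^ 2 * G.sharpConstant := by gcongr
  rw [reducedCriticalMass_sq hconn hH hB] at h1
  exact mul_nonneg (by positivity) (by linarith)

theorem exists_energy_neg (hconn : G.Connected) (hH : Nonempty H) (hB : Nonempty B)
    (hμ : G.reducedCriticalMass < μ) : ∃ u ∈ G.H1mass μ, G.energy u < 0 := by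
  have hμK := reducedCriticalMass_pos hconn hH hB
  have hμ0 : 0 < μ := hμK.trans hμ
  have hC := sharpConstant_pos hconn hH hB
  have h1 : 3 / μ ^ 2 < G.sharpConstant := by
    rw [div_lt_iff₀ (by positivity), ← reducedCriticalMass_sq hconn hH hB, mul_comm]
    gcongr
  obtain ⟨_, ⟨u, hu, hu0, rfl⟩, hq, -⟩ := (isLUB_sharpConstant hconn hH hB).exists_between h1
  obtain ⟨v, hv, hvq⟩ := exists_rescale_quotient hu (mass_pos_of_ne hu0) hμ0
  refine ⟨v, hv, ?_⟩
  have hv0 : 0 < G.mass v := hv.2 ▸ hμ0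
  have hT := kinetic_pos (hasMultiplicity_one hconn hH) hB hv.1 hv0
  rw [energy_eq hv0 hT, hv.2, hvq]
  rw [div_lt_iff₀ (by positivity)] at hq
  exact mul_neg_of_pos_of_neg (by positivity) (by linarith)

/-! ### The ground state energy level -/

theorem infEnergy_le (hu : u ∈ G.H1mass μ) : G.infEnergy μ ≤ G.energy u := iInf₂_le u hu

theorem infEnergy_le_zero (hH : Nonempty H) (hB : Nonempty B) (hμ : 0 < μ) :
    G.infEnergy μ ≤ 0 := by
  by_contra! h
  obtain ⟨r, hr0, hr⟩ := EReal.lt_iff_exists_real_btwn.1 h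
  have hr0' : 0 < r := by exact_mod_cast hr0
  -- A plateau spread along the half-lines has kinetic energy at most `κ² μ` once scaled to mass
  -- `μ`; this `κ` makes that equal to `r`.
  have hκ : 0 < √(r / μ) := by positivity
  obtain ⟨h1, -, h3⟩ := G.plateau_mass_pos hH hB hκ
  obtain ⟨v, hv, hT, hS⟩ := exists_rescale (plateau_mem_H1 0 hκ) h1 hμ
  refine absurd (hr.trans_le (infEnergy_le hv)) (not_lt.2 ?_)
  rw [Real.sq_sqrt (by positivity)] at h3
  have h4 : G.kinetic v ≤ r := by
    rw [hT]
    calc _ ≤ μ / G.mass (G.plateau 0 √(r / μ)) * (r / μ * G.mass (G.plateau 0 √(r / μ))) := by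
          gcongr
      _ = r := by field_simp
  have h5 := G.coreSextic_nonneg v
  rw [EReal.coe_le_coe_iff, energy]
  linarith

theorem infEnergy_eq_zero (hconn : G.Connected) (hH : Nonempty H) (hB : Nonempty B) (hμ : 0 < μ)
    (hle : μ ≤ G.reducedCriticalMass) : G.infEnergy μ = 0 := by
  refine le_antisymm (infEnergy_le_zero hH hB hμ) (le_iInf₂ fun u hu => ?_)
  exact_mod_cast energy_nonneg_of_mass_le hconn hH hB hu.1 (hu.2 ▸ hμ) (hu.2 ▸ hle)

theorem infEnergy_neg (hconn : G.Connected) (hH : Nonempty H) (hB : Nonempty B)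
    (hμ : G.reducedCriticalMass < μ) : G.infEnergy μ < 0 := by
  obtain ⟨u, hu, hE⟩ := exists_energy_neg hconn hH hB hμ
  exact (infEnergy_le hu).trans_lt (by exact_mod_cast hE)

theorem reducedCriticalMass_le_of_infEnergy_eq_bot (hconn : G.Connected) (hH : Nonempty H)
    (hB : Nonempty B) {m : ℝ} (hm : 0 < m) (h : ∀ μ, m < μ → G.infEnergy μ = ⊥) :
    G.reducedCriticalMass ≤ m := by
  by_contra! hlt
  have h1 := h _ hlt
  rw [infEnergy_eq_zero hconn hH hB (hm.trans hlt) le_rfl] at h1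
  exact absurd h1 (by simp)

theorem reducedCriticalMass_le (hconn : G.Connected) (hH : Nonempty H) (hB : Nonempty B) :
    G.reducedCriticalMass ≤ criticalMassLine :=
  reducedCriticalMass_le_of_infEnergy_eq_bot hconn hH hB
    (criticalMassHalfLine_pos.trans criticalMassHalfLine_lt) fun _ => infEnergy_eq_bot hB

theorem not_isGroundState_of_bot (h : G.infEnergy μ = ⊥) : ¬ ∃ u, G.IsGroundState μ u := by
  rintro ⟨u, -, hu⟩
  rw [h] at hu
  exact EReal.coe_ne_bot _ hu

theorem not_isGroundState_of_energy_pos (hH : Nonempty H) (hB : Nonempty B) (hμ : 0 < μ)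
    (h : ∀ u ∈ G.H1mass μ, 0 < G.energy u) : ¬ ∃ u, G.IsGroundState μ u := by
  rintro ⟨u, hu, hE⟩
  have h1 := infEnergy_le_zero (G := G) hH hB hμ
  rw [← hE] at h1
  exact absurd (h u hu) (not_lt.2 (by exact_mod_cast h1))

theorem isGroundState_of_forall_le (hu : u ∈ G.H1mass μ)
    (h : ∀ v ∈ G.H1mass μ, G.energy u ≤ G.energy v) : G.IsGroundState μ u :=
  ⟨hu, le_antisymm (le_iInf₂ fun v hv => by exact_mod_cast h v hv) (infEnergy_le hu)⟩

/-- If the energy becomes unbounded below at the very mass up to which it is positive, then there are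
no ground states. -/
theorem not_isGroundState_of_threshold (hconn : G.Connected) (hH : Nonempty H) (hB : Nonempty B)
    {N : ℝ} (hN : G.HasMultiplicity N)
    (hbot : ∀ μ, N * criticalMassHalfLine < μ → G.infEnergy μ = ⊥) (hμ : 0 < μ) :
    ¬ ∃ u, G.IsGroundState μ u := by
  rcases le_or_gt μ (N * criticalMassHalfLine) with h | h
  · refine not_isGroundState_of_energy_pos hH hB hμ fun u hu => ?_
    exact hN.energy_pos hconn hH hB hu.1 (hu.2 ▸ hμ) (hu.2 ▸ h)
  · exact not_isGroundState_of_bot (hbot μ h)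

/-! ### Existence of ground states -/

theorem coreSextic_le_mul_mass {R : ℝ} (hu : u ∈ G.H1)
    (hR : ∀ b, ∀ x ∈ Icc 0 (G.len b), u (Sum.inl b) x ^ 2 ≤ R) :
    G.coreSextic u ≤ R ^ 2 * G.mass u := by
  have h0 : 0 ≤ ∑ h, ∫ x in Ici 0, |u (Sum.inr h) x| ^ 2 :=
    Finset.sum_nonneg fun _ _ => integral_nonneg fun _ => by positivity
  rw [coreSextic_eq, mass_eq]
  refine le_trans ?_ (mul_le_mul_of_nonneg_left (le_add_of_nonneg_right h0) (sq_nonneg R))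
  rw [Finset.mul_sum]
  refine Finset.sum_le_sum fun b _ => ?_
  rw [← integral_const_mul]
  refine setIntegral_mono_on (H1.integrableOn_pow hu b 6)
    ((H1.integrableOn_pow hu b 2).const_mul _) measurableSet_Icc fun x hx => ?_
  rw [show |u (Sum.inl b) x| ^ 6 = (|u (Sum.inl b) x| ^ 2) ^ 2 * |u (Sum.inl b) x| ^ 2 by ring,
    sq_abs]
  exact mul_le_mul_of_nonneg_right (pow_le_pow_left₀ (sq_nonneg _) (hR b x hx) 2) (sq_nonneg _)

/-- Functions of negative energy do not vanish on the core. -/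
theorem le_coreSextic_of_energy_neg (hconn : G.Connected) (hH : Nonempty H) (hB : Nonempty B)
    (hu : u ∈ G.H1) {A : ℝ} (h0 : 0 < G.mass u) (hA : G.mass u ≤ A) (hE : G.energy u < 0) :
    3 * (3 / (4 * A * ∑ b, G.len b)) ^ 2 / (4 * A) ≤ G.coreSextic u := by
  have hN := hasMultiplicity_one hconn hH
  have hΛ := G.sum_len_pos hB
  have hA0 : 0 < A := h0.trans_le hA
  obtain ⟨b₀, x₀, hm⟩ := exists_isCoreMax hB hu
  have hS := coreSextic_le_sum_len hu hm.2
  have hT := kinetic_pos hN hB hu h0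
  set c := u (Sum.inl b₀) x₀ ^ 2 with hc
  have h3 : 3 * G.kinetic u < G.coreSextic u := by
    rw [energy] at hE
    linarith
  have hc0 : 0 < c := by
    refine (sq_nonneg _).lt_of_ne fun h => ?_
    rw [← hc] at h
    rw [← h] at hS
    norm_num at hS
    linarith
  have hcT : c ^ 2 ≤ 4 * A * G.kinetic u := by
    have h4 := mul_sq_le_kinetic_add_mass hN hB hu (K := c / (4 * G.mass u)) (by positivity)
      (Sum.inl b₀) hm.1
    rw [← hc] at h4
    have h5 : c / (4 * G.mass u) * c - 2 * (c / (4 * G.mass u)) ^ 2 * G.mass u =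
        c ^ 2 / (8 * G.mass u) := by
      field_simp
      ring
    have h6 : c ^ 2 / (8 * G.mass u) ≤ 1 / 2 * G.kinetic u := by linarith
    rw [div_le_iff₀ (by positivity)] at h6
    nlinarith
  -- Combine `3T < S ≤ c³Λ` with `c² ≤ 4AT` and cancel `c²`, where `T` is the kinetic term, `S` the
  -- sextic term and `Λ` the core length.
  have hcl : 3 / (4 * A * ∑ b, G.len b) ≤ c := by
    rw [div_le_iff₀ (by positivity)]
    have h7 : c ^ 2 * 3 ≤ c ^ 2 * (c * (4 * A * ∑ b, G.len b)) := by
      calc c ^ 2 * 3 ≤ 4 * A * (3 * G.kinetic u) := by linarith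
        _ ≤ 4 * A * (c ^ 3 * ∑ b, G.len b) :=
          mul_le_mul_of_nonneg_left (by linarith) (by positivity)
        _ = _ := by ring
    exact le_of_mul_le_mul_left h7 (by positivity)
  rw [div_le_iff₀ (by positivity)]
  calc _ ≤ 3 * c ^ 2 := by gcongr
    _ ≤ 4 * A * (3 * G.kinetic u) := by linarith
    _ ≤ 4 * A * G.coreSextic u := by gcongr
    _ = _ := by ring

/-- The sup bound on the core controls the sextic term, and negative energy then controls the
kinetic one, so compactness applies. The uniform lower bound on the sextic term keeps the limit
nonzero; for the mass only an inequality survives. -/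
theorem exists_limit_of_energy_neg (hconn : G.Connected) (hH : Nonempty H) (hB : Nonempty B)
    {u : ℕ → B ⊕ H → ℝ → ℝ} (hu : ∀ n, u n ∈ G.H1) (h0 : ∀ n, 0 < G.mass (u n)) {m : ℝ}
    (hlim : Tendsto (fun n => G.mass (u n)) atTop (𝓝 m)) {A R : ℝ} (hA : ∀ n, G.mass (u n) ≤ A)
    (hE : ∀ n, G.energy (u n) < 0)
    (hR : ∀ n, ∀ b, ∀ x ∈ Icc 0 (G.len b), u n (Sum.inl b) x ^ 2 ≤ R) :
    ∃ v ∈ G.H1, 0 < G.mass v ∧ G.mass v ≤ m ∧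
      ∀ (a : ℕ → ℝ) (l : ℝ), (∀ n, G.energy (u n) ≤ a n) → Tendsto a atTop (𝓝 l) →
        G.energy v ≤ l := by
  have hS : ∀ n, G.coreSextic (u n) ≤ R ^ 2 * A := fun n =>
    (coreSextic_le_mul_mass (hu n) (hR n)).trans (by gcongr; exact hA n)
  have hT : ∀ n, G.kinetic (u n) ≤ R ^ 2 * A := fun n => by
    have h1 := hE n
    have h2 := hS n
    have h3 := G.kinetic_nonneg (u n)
    rw [energy] at h1
    linarith
  obtain ⟨v, hv, M, T, hM, hvM, hTl, hvT, hSl⟩ := exists_H1_limit hconn hH hB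
    (hyperfilter ℕ) hu (A := max A (R ^ 2 * A)) (fun n => (hA n).trans (le_max_left _ _))
    fun n => (hT n).trans (le_max_right _ _)
  have hle : (hyperfilter ℕ : Filter ℕ) ≤ atTop := Nat.hyperfilter_le_atTop
  have hMm : M = m := tendsto_nhds_unique hM (hlim.mono_left hle)
  refine ⟨v, hv, ?_, hMm ▸ hvM, fun a l ha hal => ?_⟩
  · refine (G.mass_nonneg v).lt_of_ne fun hv0 => ?_
    have h1 := ge_of_tendsto' hSl fun n =>
      le_coreSextic_of_energy_neg hconn hH hB (hu n) (h0 n) (hA n) (hE n)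
    obtain ⟨b₀, x₀, hm⟩ := exists_isCoreMax hB hv
    have h2 := coreSextic_le_mul_mass hv hm.2
    rw [← hv0, mul_zero] at h2
    have hA0 := (h0 0).trans_le (hA 0)
    have hΛ := G.sum_len_pos hB
    have h3 : 0 < 3 * (3 / (4 * A * ∑ b, G.len b)) ^ 2 / (4 * A) := by positivity
    linarith
  · have h1 : Tendsto (fun n => G.energy (u n)) (hyperfilter ℕ)
        (𝓝 (1 / 2 * T - 1 / 6 * G.coreSextic v)) :=
      (hTl.const_mul _).sub (hSl.const_mul _)
    have h2 := le_of_tendsto_of_tendsto' h1 (hal.mono_left hle) ha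
    rw [energy]
    linarith

/-! ### Ground states without terminal edges -/

section NoTerminalEdge

theorem exists_core_bound_of_energy_le (hG : ¬ G.HasTerminalEdge) (hB : Nonempty B) {δ : ℝ}
    (hδ : 0 < δ) : ∃ R, ∀ u ∈ G.H1, G.mass u ≤ criticalMassLine → G.energy u < -δ →
      ∀ b, ∀ x ∈ Icc 0 (G.len b), u (Sum.inl b) x ^ 2 ≤ R := by
  obtain ⟨R, hR⟩ := exists_forall_energy_ge hG hB hδ
  refine ⟨R, fun u hu hM hE b x hx => ?_⟩
  obtain ⟨b₀, x₀, hm⟩ := exists_isCoreMax hB hu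
  refine (hm.2 b x hx).trans (le_of_not_ge fun hge => ?_)
  have h1 := hR u hu b₀ x₀ hm hM hge
  have h2 : 0 ≤ (u (Sum.inl b₀) x₀ ^ 2) ^ 2 / 6 * (criticalMassLine - G.mass u) :=
    mul_nonneg (by positivity) (by linarith)
  linarith

theorem exists_core_bound_of_mass_le (hG : ¬ G.HasTerminalEdge) (hB : Nonempty B) {m : ℝ}
    (hm : m < criticalMassLine) : ∃ R, ∀ u ∈ G.H1, G.mass u ≤ m → G.energy u < 0 →
      ∀ b, ∀ x ∈ Icc 0 (G.len b), u (Sum.inl b) x ^ 2 ≤ R := by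
  obtain ⟨R, hR⟩ := exists_forall_energy_ge hG hB one_pos
  have hd : 0 < criticalMassLine - m := sub_pos.2 hm
  -- Above this level `c² (μ_R - m)/6 ≥ 1`, which offsets the slack `δ = 1` and contradicts negative
  -- energy.
  refine ⟨max R (6 / (criticalMassLine - m) + 1), fun u hu hM hE b x hx => ?_⟩
  obtain ⟨b₀, x₀, hmax⟩ := exists_isCoreMax hB hu
  refine (hmax.2 b x hx).trans (le_of_not_ge fun hge => ?_)
  have h1 := hR u hu b₀ x₀ hmax (hM.trans hm.le) ((le_max_left _ _).trans hge)
  have h2 := (le_max_right _ _).trans hge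
  set c := u (Sum.inl b₀) x₀ ^ 2
  have h3 : 0 < 6 / (criticalMassLine - m) := by positivity
  have h4 : 6 / (criticalMassLine - m) ≤ c ^ 2 := by nlinarith
  rw [div_le_iff₀ hd] at h4
  have h5 : c ^ 2 * (criticalMassLine - m) ≤ c ^ 2 * (criticalMassLine - G.mass u) := by gcongr
  linarith

/-- Take functions of negative energy with masses decreasing to `m`. The masses stay below `(μ_R +
m)/2 < μ_R`, so the core bound is uniform and a limit exists. -/
theorem exists_energy_nonpos (hG : ¬ G.HasTerminalEdge) (hconn : G.Connected) (hH : Nonempty H)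
    (hB : Nonempty B) {m : ℝ} (hm : G.reducedCriticalMass ≤ m) (hm' : m < criticalMassLine) :
    ∃ v ∈ G.H1, 0 < G.mass v ∧ G.mass v ≤ m ∧ G.energy v ≤ 0 := by
  have hd : 0 < (criticalMassLine - m) / 2 := by linarith
  have hm0 := (reducedCriticalMass_pos hconn hH hB).trans_le hm
  have hpos : ∀ n : ℕ, 0 < (criticalMassLine - m) / 2 * (1 / ((n : ℝ) + 1)) := fun n => by positivity
  choose u hu hE using fun n : ℕ => exists_energy_neg hconn hH hB
    (hm.trans_lt (lt_add_of_pos_right m (hpos n)))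
  have hle : ∀ n, G.mass (u n) ≤ (criticalMassLine + m) / 2 := fun n => by
    rw [(hu n).2]
    have h1 : (1 : ℝ) / ((n : ℝ) + 1) ≤ 1 := by
      rw [div_le_one (by positivity)]
      have : (0 : ℝ) ≤ n := n.cast_nonneg
      linarith
    have := mul_le_mul_of_nonneg_left h1 hd.le
    linarith
  have hlim : Tendsto (fun n => G.mass (u n)) atTop (𝓝 m) := by
    simp only [fun n => (hu n).2]
    simpa using (tendsto_one_div_add_atTop_nhds_zero_nat.const_mul
      ((criticalMassLine - m) / 2)).const_add m
  obtain ⟨R, hR⟩ := exists_core_bound_of_mass_le hG hB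
    (show (criticalMassLine + m) / 2 < criticalMassLine by linarith)
  obtain ⟨v, hv, h1, h2, h3⟩ := exists_limit_of_energy_neg hconn hH hB (fun n => (hu n).1)
    (fun n => by rw [(hu n).2]; linarith [hpos n]) hlim hle hE
    fun n => hR _ (hu n).1 (hle n) (hE n)
  exact ⟨v, hv, h1, h2, h3 (fun _ => 0) 0 (fun n => (hE n).le) tendsto_const_nhds⟩

theorem criticalMassHalfLine_lt_reducedCriticalMass (hG : ¬ G.HasTerminalEdge)
    (hconn : G.Connected) (hH : Nonempty H) (hB : Nonempty B) :
    criticalMassHalfLine < G.reducedCriticalMass := by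
  by_contra! hle
  obtain ⟨v, hv, h1, h2, h3⟩ := exists_energy_nonpos hG hconn hH hB hle criticalMassHalfLine_lt
  exact h3.not_gt ((hasMultiplicity_one hconn hH).energy_pos hconn hH hB hv h1 (by linarith))

theorem exists_isGroundState_of_lt (hG : ¬ G.HasTerminalEdge) (hconn : G.Connected)
    (hH : Nonempty H) (hB : Nonempty B) (hμ : G.reducedCriticalMass < μ)
    (hμ' : μ ≤ criticalMassLine) : ∃ u, G.IsGroundState μ u := by
  have hμ0 := (reducedCriticalMass_pos hconn hH hB).trans hμ
  obtain ⟨u₀, hu₀, hE₀⟩ := exists_energy_neg hconn hH hB hμ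
  have hbdd : BddBelow (G.energy '' G.H1mass μ) := by
    obtain ⟨R, hR⟩ := exists_core_bound_of_energy_le hG hB one_pos
    refine ⟨min (-1) (-(R ^ 2 * μ / 6)), ?_⟩
    rintro _ ⟨u, hu, rfl⟩
    rcases lt_or_ge (G.energy u) (-1) with h | h
    · refine (min_le_right _ _).trans ?_
      have h1 := coreSextic_le_mul_mass hu.1 (hR u hu.1 (hu.2 ▸ hμ') h)
      have h2 := G.kinetic_nonneg u
      rw [hu.2] at h1
      rw [energy]
      linarith
    · exact (min_le_left _ _).trans h
  set I := sInf (G.energy '' G.H1mass μ) with hI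
  have hI0 : I < 0 := (csInf_le hbdd ⟨u₀, hu₀, rfl⟩).trans_lt hE₀
  -- At mass `μ_R` the core bound needs energies uniformly below zero; the minimizing sequence is
  -- kept below `I/2`.
  have hδ : 0 < -I / 2 := by linarith
  have hpos : ∀ n : ℕ, 0 < -I / 2 * (1 / ((n : ℝ) + 1)) := fun n => by positivity
  have hseq : ∀ n : ℕ, ∃ u ∈ G.H1mass μ, G.energy u < I + -I / 2 * (1 / ((n : ℝ) + 1)) := by
    intro n
    obtain ⟨_, ⟨u, hu, rfl⟩, h⟩ := exists_lt_of_csInf_lt (Set.Nonempty.image G.energy ⟨u₀, hu₀⟩)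
      (show sInf (G.energy '' G.H1mass μ) < I + -I / 2 * (1 / ((n : ℝ) + 1)) by
        linarith [hpos n])
    exact ⟨u, hu, h⟩
  choose u hu hE using hseq
  have hEδ : ∀ n, G.energy (u n) < -(-I / 2) := fun n => by
    have h1 : (1 : ℝ) / ((n : ℝ) + 1) ≤ 1 := by
      rw [div_le_one (by positivity)]
      have : (0 : ℝ) ≤ n := n.cast_nonneg
      linarith
    have h2 := mul_le_mul_of_nonneg_left h1 hδ.le
    have h3 := hE n
    linarith
  obtain ⟨R, hR⟩ := exists_core_bound_of_energy_le hG hB hδ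
  have hlim : Tendsto (fun n => G.mass (u n)) atTop (𝓝 μ) := by
    simp only [fun n => (hu n).2, tendsto_const_nhds]
  obtain ⟨v, hv, h1, h2, h3⟩ := exists_limit_of_energy_neg hconn hH hB (fun n => (hu n).1)
    (fun n => (hu n).2 ▸ hμ0) hlim (fun n => (hu n).2.le) (fun n => by linarith [hEδ n])
    fun n => hR _ (hu n).1 ((hu n).2 ▸ hμ') (hEδ n)
  have hvI : G.energy v ≤ I := h3 _ _ (fun n => (hE n).le) (by
    simpa using (tendsto_one_div_add_atTop_nhds_zero_nat.const_mul (-I / 2)).const_add I)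
  obtain ⟨w, hw, hwT, hwS⟩ := exists_rescale hv h1 hμ0
  refine ⟨w, isGroundState_of_forall_le hw fun z hz => le_trans ?_ (csInf_le hbdd ⟨z, hz, rfl⟩)⟩
  refine le_trans ?_ hvI
  rw [energy] at hvI
  rw [energy, energy, hwT, hwS]
  -- Raising the mass by a factor `t ≥ 1` multiplies the kinetic term by `t` and the sextic one by
  -- `t³`, so the new energy is at most `t E(v) ≤ E(v)`.
  have ht : 1 ≤ μ / G.mass v := (one_le_div h1).2 h2
  set t := μ / G.mass v
  have hS := G.coreSextic_nonneg v
  have h4 : t * G.coreSextic v ≤ t ^ 3 * G.coreSextic v :=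
    mul_le_mul_of_nonneg_right (le_self_pow₀ ht (by norm_num)) hS
  nlinarith

/-- The limit of nonpositive energy cannot lose mass, because the energy is positive at masses below
`μ_K`. -/
theorem exists_isGroundState_reducedCriticalMass (hG : ¬ G.HasTerminalEdge) (hconn : G.Connected)
    (hH : Nonempty H) (hB : Nonempty B) (hlt : G.reducedCriticalMass < criticalMassLine) :
    ∃ u, G.IsGroundState G.reducedCriticalMass u := by
  obtain ⟨v, hv, h1, h2, h3⟩ := exists_energy_nonpos hG hconn hH hB le_rfl hlt
  have hmass : G.mass v = G.reducedCriticalMass := by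
    refine h2.antisymm (le_of_not_gt fun h => ?_)
    exact h3.not_gt (energy_pos_of_mass_lt hconn hH hB hv h1 h)
  refine ⟨v, isGroundState_of_forall_le ⟨hv, hmass⟩ fun w hw => h3.trans ?_⟩
  exact energy_nonneg_of_mass_le hconn hH hB hw.1 (by rw [hw.2, ← hmass]; exact h1) hw.2.le

theorem exists_isGroundState_iff (hG : ¬ G.HasTerminalEdge) (hconn : G.Connected)
    (hH : Nonempty H) (hB : Nonempty B) (hlt : G.reducedCriticalMass < criticalMassLine)
    (hμ : 0 < μ) :
    (∃ u, G.IsGroundState μ u) ↔ μ ∈ Icc G.reducedCriticalMass criticalMassLine := by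
  refine ⟨fun h => ⟨le_of_not_gt fun hlt' => ?_, le_of_not_gt fun hgt => ?_⟩, fun ⟨h1, h2⟩ => ?_⟩
  · refine not_isGroundState_of_energy_pos hH hB hμ (fun u hu => ?_) h
    exact energy_pos_of_mass_lt hconn hH hB hu.1 (hu.2 ▸ hμ) (hu.2 ▸ hlt')
  · exact not_isGroundState_of_bot (infEnergy_eq_bot hB hgt) h
  · rcases h1.eq_or_lt with rfl | h1
    · exact exists_isGroundState_reducedCriticalMass hG hconn hH hB hlt
    · exact exists_isGroundState_of_lt hG hconn hH hB h1 h2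

end NoTerminalEdge

theorem reducedCriticalMass_lt_sqrt_three (hconn : G.Connected) (hH : Nonempty H)
    (hB : Nonempty B) (hcard : Fintype.card H = 1) : G.reducedCriticalMass < √3 := by
  obtain ⟨u, hu, hM, hlt⟩ := G.exists_mass_sq_mul_kinetic_lt_coreSextic hB hcard
  have hT := kinetic_pos (hasMultiplicity_one hconn hH) hB hu hM
  have hq : 1 < G.quotient u := by
    rw [quotient, one_lt_div (by positivity)]
    exact hlt
  have hC : 1 < G.sharpConstant :=
    hq.trans_le ((isLUB_sharpConstant hconn hH hB).1 ⟨u, hu, hM.ne', rfl⟩)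
  refine Real.sqrt_lt_sqrt (by positivity) ?_
  rw [div_lt_iff₀ (by linarith)]
  linarith

end MetricGraph

/-! ### Assembly of the theorem -/

theorem theorem1 {V B H : Type*} [Fintype B] [Fintype H] (G : MetricGraph V B H)
    (hconn : G.Connected) (hnoncompact : Nonempty H) (hcore : Nonempty B) :
    -- the sharp constant is the supremum of a set of reals that is bounded above
    IsLUB G.quotientValues G.sharpConstant ∧
    G.reducedCriticalMass ∈ Set.Icc criticalMassHalfLine criticalMassLine ∧
    (∀ μ : ℝ, 0 < μ →
      (μ ≤ G.reducedCriticalMass → G.infEnergy μ = 0) ∧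
      (μ ∈ Set.Ioc G.reducedCriticalMass criticalMassLine → G.infEnergy μ < 0) ∧
      (criticalMassLine < μ → G.infEnergy μ = ⊥)) ∧
    -- (i)
    (G.HasTerminalEdge →
      G.reducedCriticalMass = criticalMassHalfLine ∧
      (∀ μ : ℝ, G.reducedCriticalMass < μ → G.infEnergy μ = ⊥) ∧
      ∀ μ : ℝ, 0 < μ → ¬ ∃ u, G.IsGroundState μ u) ∧
    -- (ii)
    (G.HasCycleCovering →
      G.reducedCriticalMass = criticalMassLine ∧
      ∀ μ : ℝ, 0 < μ → ¬ ∃ u, G.IsGroundState μ u) ∧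
    -- (iii)
    (Nat.card H = 1 → ¬ G.HasTerminalEdge →
      criticalMassHalfLine < G.reducedCriticalMass ∧ G.reducedCriticalMass < Real.sqrt 3 ∧
      ∀ μ : ℝ, 0 < μ →
        ((∃ u, G.IsGroundState μ u) ↔ μ ∈ Set.Icc G.reducedCriticalMass criticalMassLine)) ∧
    -- (iv)
    (¬ G.HasTerminalEdge → ¬ G.HasCycleCovering → 2 ≤ Nat.card H →
      criticalMassHalfLine < G.reducedCriticalMass ∧
      G.reducedCriticalMass ≤ criticalMassLine ∧
      (G.reducedCriticalMass ≠ criticalMassLine →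
        ∀ μ : ℝ, 0 < μ →
          ((∃ u, G.IsGroundState μ u) ↔
            μ ∈ Set.Icc G.reducedCriticalMass criticalMassLine))) := by

  have hone := MetricGraph.hasMultiplicity_one hconn hnoncompact
  have hline : (2 : ℝ) * criticalMassHalfLine = criticalMassLine := by
    unfold criticalMassHalfLine; ring
  have hlow : criticalMassHalfLine ≤ G.reducedCriticalMass := by
    simpa using MetricGraph.le_reducedCriticalMass hconn hnoncompact hcore hone one_pos
  have hupp := MetricGraph.reducedCriticalMass_le hconn hnoncompact hcore
  refine ⟨MetricGraph.isLUB_sharpConstant hconn hnoncompact hcore, ⟨hlow, hupp⟩,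
    fun μ hμ => ⟨MetricGraph.infEnergy_eq_zero hconn hnoncompact hcore hμ,
      fun h => MetricGraph.infEnergy_neg hconn hnoncompact hcore h.1,
      MetricGraph.infEnergy_eq_bot hcore⟩, fun hG => ?_, fun hG => ?_, fun hcard hG => ?_,
    fun hG _ _ => ?_⟩
  · have hbot : ∀ μ, criticalMassHalfLine < μ → G.infEnergy μ = ⊥ := fun μ =>
      hG.infEnergy_eq_bot hconn hcore
    have heq := (MetricGraph.reducedCriticalMass_le_of_infEnergy_eq_bot hconn hnoncompact hcore
      criticalMassHalfLine_pos hbot).antisymm hlow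
    refine ⟨heq, fun μ hμ => hbot μ (heq ▸ hμ), fun μ hμ => ?_⟩
    exact MetricGraph.not_isGroundState_of_threshold hconn hnoncompact hcore hone
      (by simpa using hbot) hμ
  · have htwo := MetricGraph.hasMultiplicity_two hconn hnoncompact hG
    refine ⟨hupp.antisymm ?_, fun μ hμ => ?_⟩
    · rw [← hline]
      exact MetricGraph.le_reducedCriticalMass hconn hnoncompact hcore htwo two_pos
    · refine MetricGraph.not_isGroundState_of_threshold hconn hnoncompact hcore htwo ?_ hμ
      rw [hline]
      exact fun μ => MetricGraph.infEnergy_eq_bot hcore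
  · have hlt := MetricGraph.reducedCriticalMass_lt_sqrt_three hconn hnoncompact hcore
      (Nat.card_eq_fintype_card (α := H) ▸ hcard)
    refine ⟨MetricGraph.criticalMassHalfLine_lt_reducedCriticalMass hG hconn hnoncompact hcore, hlt,
      fun μ hμ => ?_⟩
    -- The strict inequality `μ_K < μ_R`, an assumption in (iv), follows here from `μ_K < √3 < μ_R`.
    exact MetricGraph.exists_isGroundState_iff hG hconn hnoncompact hcore
      (hlt.trans sqrt_three_lt_criticalMassLine) hμ
  · refine ⟨MetricGraph.criticalMassHalfLine_lt_reducedCriticalMass hG hconn hnoncompact hcore,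
      hupp, fun hne μ hμ => ?_⟩
    exact MetricGraph.exists_isGroundState_iff hG hconn hnoncompact hcore
      (lt_of_le_of_ne hupp hne) hμ
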